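/- **Tensor PCA on the sphere: the conditions of the SoS-versus-spectral theorem hold.** *Setting.* Let $n\ge 2$, $k\ge1$, $N=[n]^k$, and let instances be tensors $T\in\mathbb R^{N}$. Let $\nu$ be the law of a tensor with i.i.d. $\mathcal N(0,1)$ entries. For $\lambda\in\mathbb R$ let $\mu$ be the law of $\lambda v^{\otimes k}+G$, with $v$ uniform on $\{\pm n^{-1/2}\}^n$ and $G\sim\nu$ independent of $v$. For a threshold $\mathrm{obj}\in\mathbb R$ the polynomial system on $T$ is $$\mathcal S_T:\qquad \langle x^{\otimes k},T\rangle\ \ge\ \mathrm{obj},\qquad \|x\|_2^2=1 .$$ For $k\le 2d$, a *refutation* of $\mathcal S_T$ is a polynomial identity in $x=(x_1,\dots,x_n)$ $$-1=\big\langle x^{\le d}(x^{\le d})^{\top},A\big\rangle+b\,\big(\langle x^{\otimes k},T\rangle-\mathrm{obj}\big)+q(x)\,\big(\|x\|_2^2-1\big),$$ where $x^{\le d}$ is the vector of all monomials indexed by tuples in $[n]^{\le d}$, $A\succeq0$ is an $[n]^{\le d}\times[n]^{\le d}$ matrix, $b\ge 0$ is a real number and $q$ is a polynomial of degree at most $2d-2$.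 Its numbers are the entries of $A$, the number $b$ and the coefficients of $q$. For $\rho\in[0,1]$ let $\Theta_\rho$ be the law of a random $S\subseteq N$ containing each entry independently with probability $\rho$ (subsampling: the entries outside $S$ are zeroed). *Statement.* There are universal constants $c_1\in\mathbb N$, $c_1>1$, and $c,K>0$ such that the following holds for all $n\ge2$, $k\ge 1$, $d$ with $k\le 2d$, $D>3d$, and all real $\lambda,\varepsilon,\mathrm{obj}$ with $$\varepsilon\ \ge\ \frac{c\,d}{D-3d},\qquad \lambda n^{-\varepsilon}\ \ge\ K\sqrt{d\log n},\qquad n^{k-\varepsilon}\ \ge\ K\,d\log n,\qquad \mathrm{obj}\le\lambda n^{-\varepsilon},\quad \mathrm{obj}\le\lambda/2 .$$ (So $\mathrm{obj}=\lambda n^{-\varepsilon}$ is allowed as soon as $n^{\varepsilon}\ge 2$; for fixed $d$ and $\lambda\le n^k$ the second and third conditions follow from $\lambda n^{-\varepsilon}\gg\log n$.) Put $B=c_1d$. Then there is $\rho\in[n^{-\varepsilon},1]$ such that: 1. (Robust inference.) There are measurable maps $x_S:\mathbb R^S\to\mathbb R^n$ ($S\subseteq N$) such that, for independent $T\sim\mu$,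 $S\sim\Theta_\rho$, $T'\sim\nu$, the point $x_S(T|_S)$ is feasible for the system on the tensor equal to $T$ on $S$ and to $T'$ off $S$, except with probability at most $n^{-8B}$. 2. (Subsampling.) For every set $\alpha\subseteq N$ with $|\alpha|\ge D-3d$, $\Pr_{S\sim\Theta_\rho}[\alpha\subseteq S]\le n^{-8B}$. 3. (Well-conditioned refutations and distinguisher.) Suppose that for $T\sim\nu$ the system $\mathcal S_T$ fails to have a refutation with probability at most $\tfrac12n^{-8B}$. Then, for $T\sim\nu$, $\mathcal S_T$ fails to have a refutation all of whose numbers are at most $n^B$ in absolute value with probability at most $n^{-8B}$. Moreover there is a symmetric $[n]^{\le d}\times[n]^{\le d}$ matrix $Q$ of polynomials in the entries of $T$, each of whose monomials involves at most $2D$ distinct entries of $T$ (whatever the powers), with $$\frac{\mathbb E_{T\sim\mu}\,\lambda_{\max}^+(Q(T))}{\mathbb E_{T\sim\nu}\,\lambda_{\max}^+(Q(T))}\ \ge\ n^{B/2},$$ where $\lambda_{\max}^+$ is the maximum of $0$ and the largest eigenvalue, both expectations exist, and the denominator is positive. -/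

import Mathlib

open MeasureTheory ProbabilityTheory
open scoped NNReal ENNReal

noncomputable section

namespace TensorPCA

/-- Positions of the entries of an order-`k` tensor over `ℝ^n`. -/
abbrev Idx (n k : ℕ) : Type := Fin k → Fin n

/-- Order-`k` tensors over `ℝ^n`: these are the instances. -/
abbrev Tensor (n k : ℕ) : Type := Idx n k → ℝ

/-- `[n]^{≤ d}`: tuples of length at most `d` with entries in `[n]`. -/
abbrev Tup (n d : ℕ) : Type := Σ m : Fin (d + 1), (Fin m → Fin n)

/-! ### The two distributions on instances -/

/-- The uniform distribution `ν`: independent standard Gaussian entries. -/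
def unif (n k : ℕ) : Measure (Tensor n k) := Measure.pi fun _ => gaussianReal 0 1

/-- The vector in `{± 1/√n}^n` with sign pattern `s`. -/
def signVec {n : ℕ} (s : Fin n → Bool) : Fin n → ℝ :=
  fun i => (if s i then 1 else -1) / Real.sqrt n

/-- `v^{⊗ k}`. -/
def tensorPow {n : ℕ} (k : ℕ) (v : Fin n → ℝ) : Tensor n k := fun a => ∏ j, v (a j)

/-- The planted distribution `μ`: the law of `lam • v^{⊗ k} + G`, where `v` is uniform on
`{± 1/√n}^n` and `G` is an independent sample from `ν`. -/
def planted (n k : ℕ) (lam : ℝ) : Measure (Tensor n k) :=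
  ((PMF.uniformOfFintype (Fin n → Bool)).toMeasure.prod (unif n k)).map
    fun p => lam • tensorPow k (signVec p.1) + p.2

/-! ### The polynomial system `obj ≤ ⟨x^{⊗ k}, T⟩`, `‖x‖² = 1` -/

/-- The polynomial `⟨x^{⊗ k}, T⟩ - obj`, required to be nonnegative. -/
def objPoly {n k : ℕ} (obj : ℝ) (T : Tensor n k) : MvPolynomial (Fin n) ℝ :=
  (∑ a, MvPolynomial.C (T a) * ∏ j, MvPolynomial.X (a j)) - MvPolynomial.C obj

/-- The polynomial `‖x‖² - 1`, required to vanish. -/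
def spherePoly (n : ℕ) : MvPolynomial (Fin n) ℝ := (∑ i, MvPolynomial.X i ^ 2) - 1

/-- `x` is a feasible solution of the system on the instance `T`. -/
def Feasible {n k : ℕ} (obj : ℝ) (T : Tensor n k) (x : Fin n → ℝ) : Prop :=
  0 ≤ MvPolynomial.eval x (objPoly obj T) ∧ MvPolynomial.eval x (spherePoly n) = 0

/-! ### Sum-of-squares refutations -/

/-- The monomial of a tuple. -/
def tupMonomial {n d : ℕ} (t : Tup n d) : MvPolynomial (Fin n) ℝ :=
  ∏ j, MvPolynomial.X (t.2 j)

/-- The polynomial `⟨x^{≤ d} (x^{≤ d})ᵀ, A⟩`; it is a sum of squares of polynomials of degree at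
most `d` when `A` is positive semidefinite. -/
def gramPoly {n d : ℕ} (A : Matrix (Tup n d) (Tup n d) ℝ) : MvPolynomial (Fin n) ℝ :=
  ∑ s, ∑ t, MvPolynomial.C (A s t) * (tupMonomial s * tupMonomial t)

/-- `(A, b, q)` is a sum-of-squares refutation, with moment matrices indexed by `[n]^{≤ d}` (so all
polynomials have degree at most `2 d`), of the system on the instance `T`:
`-1 = ⟨x^{≤ d} (x^{≤ d})ᵀ, A⟩ + b (⟨x^{⊗ k}, T⟩ - obj) + q (‖x‖² - 1)`. -/
def IsRefutation {n k : ℕ} (d : ℕ) (obj : ℝ) (T : Tensor n k)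
    (A : Matrix (Tup n d) (Tup n d) ℝ) (b : ℝ) (q : MvPolynomial (Fin n) ℝ) : Prop :=
  A.PosSemidef ∧ 0 ≤ b ∧ q.totalDegree + 2 ≤ 2 * d ∧
    (-1 : MvPolynomial (Fin n) ℝ) =
      gramPoly A + MvPolynomial.C b * objPoly obj T + q * spherePoly n

/-- The system on `T` has a sum-of-squares refutation. -/
def Refutable {n k : ℕ} (d : ℕ) (obj : ℝ) (T : Tensor n k) : Prop :=
  ∃ A b q, IsRefutation d obj T A b q

/-- The system on `T` has a sum-of-squares refutation all of whose numbers are at most `R`. -/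
def RefutableWithin {n k : ℕ} (d : ℕ) (obj R : ℝ) (T : Tensor n k) : Prop :=
  ∃ A b q, IsRefutation d obj T A b q ∧
    (∀ s t, |A s t| ≤ R) ∧ b ≤ R ∧ ∀ m, |q.coeff m| ≤ R

/-! ### Subsampling and robust inference -/

/-- The random subset of `ι` containing each element independently with probability `r`. -/
def bernoulliSubset (ι : Type) [Fintype ι] [DecidableEq ι] (r : ℝ≥0) (hr : r ≤ 1) :
    PMF (Finset ι) :=
  PMF.ofFintype
    (fun S => (r : ℝ≥0∞) ^ S.card * ((1 - r : ℝ≥0) : ℝ≥0∞) ^ (Fintype.card ι - S.card)) (by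
      have h := Finset.sum_pow_mul_eq_add_pow (r : ℝ≥0∞) ((1 - r : ℝ≥0) : ℝ≥0∞)
        (Finset.univ : Finset ι)
      rw [Finset.powerset_univ, Finset.card_univ] at h
      rw [h, ← ENNReal.coe_add, add_tsub_cancel_of_le hr, ENNReal.coe_one, one_pow])

/-- `δ`-robust inference for the planted distribution `planted n k lam` and the subsampling
distribution `Θ`: some map `x` from sub-instances `(S, T_S)` to `ℝ^n` yields, except with
probability at most `δ` over `T ∼ μ`, `S ∼ Θ` and a fresh `T' ∼ ν`, a feasible solution on the
instance that agrees with `T` on `S` and with `T'` off `S`. -/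
def RobustlyInferable (n k : ℕ) (lam obj : ℝ) (Θ : PMF (Finset (Idx n k))) (δ : ℝ≥0∞) : Prop :=
  ∃ x : (S : Finset (Idx n k)) → (S → ℝ) → Fin n → ℝ, (∀ S, Measurable (x S)) ∧
    ∑ S, Θ S * ((planted n k lam).prod (unif n k))
      {p | ¬ Feasible obj (S.piecewise p.1 p.2) (x S fun a => p.1 a)} ≤ δ

/-! ### Low-degree spectral distinguishers -/

/-- `λ_max^+ (M)`: the largest eigenvalue of the symmetric matrix `M`, or `0` if it is negative. -/
def lambdaMaxPlus {ι : Type} [Fintype ι] [DecidableEq ι] (M : Matrix ι ι ℝ) : ℝ :=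
  sSup (insert 0 (spectrum ℝ M))

/-- `Q` is a symmetric matrix of polynomials in the tensor entries, each of whose monomials involves
at most `m` distinct entries (whatever the powers). -/
def HasInstDegreeLE {n k d : ℕ} (Q : Matrix (Tup n d) (Tup n d) (MvPolynomial (Idx n k) ℝ))
    (m : ℕ) : Prop :=
  Q.IsSymm ∧ ∀ s t, ∀ e ∈ (Q s t).support, e.support.card ≤ m

/-- `T ↦ λ_max^+ (Q(T))`. -/
def topEig {n k d : ℕ} (Q : Matrix (Tup n d) (Tup n d) (MvPolynomial (Idx n k) ℝ))
    (T : Tensor n k) : ℝ :=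
  lambdaMaxPlus (Q.map (MvPolynomial.eval T))

/-- The distinguishing property: `E_μ λ_max^+ (Q) / E_ν λ_max^+ (Q) ≥ R`, where both expectations
exist and the denominator is positive. -/
def Distinguishes {n k d : ℕ} (lam R : ℝ)
    (Q : Matrix (Tup n d) (Tup n d) (MvPolynomial (Idx n k) ℝ)) : Prop :=
  Integrable (topEig Q) (planted n k lam) ∧ Integrable (topEig Q) (unif n k) ∧
    0 < ∫ T, topEig Q T ∂(unif n k) ∧
    R ≤ (∫ T, topEig Q T ∂(planted n k lam)) / ∫ T, topEig Q T ∂(unif n k)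

end TensorPCA

end

/-! Write `x = n ^ d` and `L = d log n`. The subsampling rate and the noise parameter below are both
`ρ = n ^ (-ε / 2)`; the lower bound on `ε` makes `ρ ^ (D - 3 d) ≤ x ^ (-1000)`, which beats every
polynomial loss in the argument and also bounds the survival probability `ρ ^ |α|` of a large set
`α`.

Robust inference: maximise `⟨T_S, w^{⊗ k}⟩` over sign vectors `w`. The maximum is at least the value
at the planted vector, `lam |S| / n ^ k` plus a Gaussian of variance at most one, and the fresh
entries off `S` contribute another Gaussian of variance at most one. Since `|S| ≥ 0.9 ρ n ^ k` with
high probability, the objective exceeds `obj` by a large multiple of `√L` (`prob_not_feasible_le`).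

Well-conditioned refutations: a refutation of the slightly enlarged tensor `(1 - η)⁻¹ T` has slack,
and rescaling it gives a refutation of `T` with the explicit multiplier `b = 1 / (η obj)`. Its sum
of squares then has known, polynomially bounded values on the sphere. Bounded values give a Gram
matrix with bounded entries, because a coefficient of a homogeneous polynomial is its Gaussian inner
product with a Hermite polynomial (`sum_coeff_sq_le`, `exists_bounded_gram`). The multiplier `q` is
recovered by explicit division by `‖x‖² - 1` (`sphereQuot_mul`). Enlarging a Gaussian tensor by `1 +
O(x ^ (-18))` costs a constant factor in probability (`stdG_scaled_le`).

Distinguisher: choose bounded certificates `A(T)`, `b(T)` measurably, apply the Ornstein–Uhlenbeck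
operator `f ↦ E f(ρ T + σ G)` with `ρ² + σ² = 1`, and truncate at degree `D`, at an `L²` cost of `ρ
^ D`. Noise commutes with `b ↦ b T_a` up to the cross term `σ E[b(ρ T + σ G) G_a]`. As `b` is
nonnegative and bounded, a level-one inequality bounds the cross terms by `κ E b` plus a Gaussian
tail, `κ ~ √L`. So the noisy `A`, plus `κ b` times a diagonal weight, plus the flattened cross
terms, is positive semidefinite up to a tiny error; `Q` is minus its truncation, and `λ_max^+(Q)` is
tiny on average under `ν` (`integral_topEig_lowQ_le`). At the vector `v^{≤ d}` of the planted `v`,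
the refutation identity becomes `1 = ⟨Q, ·⟩ + defect - b (ρ ⟨T, v^{⊗ k}⟩ - obj - κ)` with truncated
`b` and defect (`quad_lowQ_mvec`). The bracket is typically positive, since `⟨T, v^{⊗ k}⟩` is `lam`
plus noise, so `Q` has an eigenvalue of order at least `1 / (d + 1)` unless an error term is large.

The error terms are low-degree polynomials that are small under `ν` but must be controlled under
`μ`. This is why the proof is by contradiction: if nothing distinguishes, then `1 × 1` matrices do
not either, and moments under `μ` are at most `R` times those under `ν`. The defect polynomial
depends on the planted vector itself; having low degree in the signs, it is bounded pointwise by its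
average over independent signs (`WalshDegLE.sq_le`). The resulting inequality
`half_le_of_not_distinguishes` fails numerically. -/

noncomputable section

namespace TensorPCA

/-! ### One-dimensional Gaussian integrals of polynomials -/

section OneDim

open Polynomial

theorem integrable_gaussian_iff (f : ℝ → ℝ) :
    Integrable f (gaussianReal 0 1) ↔ Integrable (fun x => gaussianPDFReal 0 1 x * f x) := by
  rw [gaussianReal_of_var_ne_zero 0 one_ne_zero]
  rw [integrable_withDensity_iff_integrable_smul' (measurable_gaussianPDF 0 1)
    (Filter.Eventually.of_forall fun x => gaussianPDF_lt_top)]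
  simp only [toReal_gaussianPDF, smul_eq_mul]

theorem integrable_pow_gaussian (m : ℕ) : Integrable (fun x : ℝ => x ^ m) (gaussianReal 0 1) := by
  have h := (memLp_id_gaussianReal (μ := 0) (v := 1) (m : ℝ≥0)).integrable_norm_pow'
  simp only [id] at h
  refine (integrable_norm_iff (by fun_prop)).1 ?_
  refine h.congr (Filter.Eventually.of_forall fun x => ?_)
  simp

theorem integrable_eval_gaussian (p : ℝ[X]) :
    Integrable (fun x => p.eval x) (gaussianReal 0 1) := by
  induction p using Polynomial.induction_on' with
  | add p q hp hq => simp only [eval_add]; exact hp.add hq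
  | monomial m a => simpa using (integrable_pow_gaussian m).const_mul a

theorem hasDerivAt_gaussianPDFReal (x : ℝ) :
    HasDerivAt (gaussianPDFReal 0 1) (-x * gaussianPDFReal 0 1 x) x := by
  have h : gaussianPDFReal 0 1 = fun y : ℝ => (√(2 * Real.pi))⁻¹ * Real.exp (-y ^ 2 / 2) := by
    ext y; simp [gaussianPDFReal]
  rw [h]
  have h1 : HasDerivAt (fun y : ℝ => -y ^ 2 / 2) (-x) x := by
    have := ((hasDerivAt_pow 2 x).neg).div_const 2
    refine this.congr_deriv ?_
    push_cast; ring
  have := (h1.exp).const_mul ((√(2 * Real.pi))⁻¹)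
  refine this.congr_deriv ?_
  ring

/-- Gaussian integration by parts. -/
theorem integral_mul_eval_gaussian (p : ℝ[X]) :
    ∫ x, x * p.eval x ∂(gaussianReal 0 1) = ∫ x, p.derivative.eval x ∂(gaussianReal 0 1) := by
  have hI := integrable_eval_gaussian
  have h0 : ∫ x, (p.derivative - X * p).eval x ∂(gaussianReal 0 1) = 0 := by
    rw [integral_gaussianReal_eq_integral_smul one_ne_zero]
    refine integral_eq_zero_of_hasDerivAt_of_integrable
      (f := fun x => gaussianPDFReal 0 1 x * p.eval x) (fun x => ?_)
      ((integrable_gaussian_iff _).1 (hI _)) ((integrable_gaussian_iff _).1 (hI p))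
    refine ((hasDerivAt_gaussianPDFReal x).mul (p.hasDerivAt x)).congr_deriv ?_
    simp only [eval_sub, eval_mul, eval_X]
    ring
  have h1 : ∫ x, (p.derivative - X * p).eval x ∂(gaussianReal 0 1)
      = ∫ x, p.derivative.eval x ∂(gaussianReal 0 1) - ∫ x, (X * p).eval x ∂(gaussianReal 0 1) := by
    rw [← integral_sub (hI _) (hI _)]
    simp
  rw [h0] at h1
  simp only [eval_mul, eval_X] at h1
  linarith

/-- The probabilists' Hermite polynomials with real coefficients. -/
def He (m : ℕ) : ℝ[X] := (hermite m).map (Int.castRingHom ℝ)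

theorem He_zero : He 0 = 1 := by simp [He]

theorem He_succ (m : ℕ) : He (m + 1) = X * He m - derivative (He m) := by
  simp [He, hermite_succ, derivative_map]

theorem natDegree_He (m : ℕ) : (He m).natDegree = m := by
  rw [He, (hermite_monic m).natDegree_map, natDegree_hermite]

theorem derivative_He_succ (m : ℕ) : derivative (He (m + 1)) = C ((m : ℝ) + 1) * He m := by
  induction m with
  | zero => simp [He_succ, He_zero]
  | succ m ih =>
    rw [He_succ (m + 1), derivative_sub, derivative_mul, derivative_X, ih, derivative_C_mul]
    have h := He_succ m
    have : derivative (He m) = X * He m - He (m + 1) := by rw [h]; ring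
    rw [this]
    simp only [map_add, map_one, Nat.cast_add, Nat.cast_one]
    ring

theorem X_mul_He_succ (m : ℕ) : X * He (m + 1) = He (m + 2) + C ((m : ℝ) + 1) * He m := by
  rw [He_succ (m + 1), derivative_He_succ]; ring

/-- Integration by parts for `He m * g` produces a term with the derivative of `He m`, which cancels
the one in the recursion for `He (m + 1)`. -/
theorem integral_He_succ_mul (m : ℕ) (g : ℝ[X]) :
    ∫ x, (He (m + 1) * g).eval x ∂(gaussianReal 0 1)
      = ∫ x, (He m * derivative g).eval x ∂(gaussianReal 0 1) := by
  have h := integral_mul_eval_gaussian (He m * g)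
  have hI := integrable_eval_gaussian
  have h1 : ∫ x, (He (m + 1) * g).eval x ∂(gaussianReal 0 1)
      = ∫ x, (X * (He m * g)).eval x ∂(gaussianReal 0 1)
        - ∫ x, (derivative (He m) * g).eval x ∂(gaussianReal 0 1) := by
    rw [← integral_sub (hI _) (hI _)]
    congr 1; ext x; rw [He_succ]; simp; ring
  have h2 : ∫ x, (X * (He m * g)).eval x ∂(gaussianReal 0 1)
      = ∫ x, (derivative (He m) * g).eval x ∂(gaussianReal 0 1)
        + ∫ x, (He m * derivative g).eval x ∂(gaussianReal 0 1) := by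
    rw [← integral_add (hI _) (hI _)]
    have h3 : ∀ x : ℝ, (X * (He m * g)).eval x = x * (He m * g).eval x := by intro x; simp
    simp_rw [h3]
    rw [h]
    congr 1; ext x; simp [derivative_mul]
  linarith

theorem integral_He_mul (m : ℕ) (g : ℝ[X]) :
    ∫ x, (He m * g).eval x ∂(gaussianReal 0 1)
      = ∫ x, (derivative^[m] g).eval x ∂(gaussianReal 0 1) := by
  induction m generalizing g with
  | zero => simp [He_zero]
  | succ m ih => rw [integral_He_succ_mul, ih, Function.iterate_succ_apply]

theorem integral_He_mul_of_lt {m : ℕ} {g : ℝ[X]} (h : g.natDegree < m) :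
    ∫ x, (He m * g).eval x ∂(gaussianReal 0 1) = 0 := by
  rw [integral_He_mul, iterate_derivative_eq_zero h]; simp

theorem iterate_derivative_He (m : ℕ) : derivative^[m] (He m) = C (m.factorial : ℝ) := by
  induction m with
  | zero => simp [He_zero]
  | succ m ih =>
    rw [Function.iterate_succ_apply, derivative_He_succ, iterate_derivative_C_mul, ih, ← C_mul]
    simp [Nat.factorial_succ]

theorem integral_He_mul_He (m l : ℕ) :
    ∫ x, (He m).eval x * (He l).eval x ∂(gaussianReal 0 1) = if m = l then (m.factorial : ℝ) else 0 := by
  have h0 : ∀ a b : ℕ, ∫ x, (He a).eval x * (He b).eval x ∂(gaussianReal 0 1)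
      = ∫ x, (He a * He b).eval x ∂(gaussianReal 0 1) := by intro a b; simp
  split_ifs with h
  · subst h
    rw [h0, integral_He_mul, iterate_derivative_He]; simp
  · rcases lt_or_gt_of_ne h with h | h
    · simp_rw [mul_comm ((He m).eval _)]
      rw [h0, integral_He_mul_of_lt (by rwa [natDegree_He])]
    · rw [h0, integral_He_mul_of_lt (by rwa [natDegree_He])]

theorem integral_He_mul_pow (m : ℕ) :
    ∫ x, x ^ m * (He m).eval x ∂(gaussianReal 0 1) = m.factorial := by
  have : ∀ x : ℝ, x ^ m * (He m).eval x = (He m * X ^ m).eval x := by intro x; simp; ring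
  simp_rw [this]
  rw [integral_He_mul, iterate_derivative_X_pow_eq_smul]
  simp [Nat.descFactorial_self]

theorem integral_He_mul_pow_of_lt {m l : ℕ} (h : l < m) :
    ∫ x, x ^ l * (He m).eval x ∂(gaussianReal 0 1) = 0 := by
  have : ∀ x : ℝ, x ^ l * (He m).eval x = (He m * X ^ l).eval x := by intro x; simp; ring
  simp_rw [this]
  exact integral_He_mul_of_lt (by simpa using h)

/-- The Hermite polynomials are eigenfunctions of the Ornstein–Uhlenbeck operators. -/
theorem integral_He_noise {ρ σ : ℝ} (h : ρ ^ 2 + σ ^ 2 = 1) (m : ℕ) (x : ℝ) :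
    ∫ y, (He m).eval (ρ * x + σ * y) ∂(gaussianReal 0 1) = ρ ^ m * (He m).eval x := by
  have key : ∀ p : ℝ[X], ∀ y : ℝ, p.eval (ρ * x + σ * y) = (p.comp (C (ρ * x) + C σ * X)).eval y := by
    intro p y; simp
  have hI : ∀ p : ℝ[X], Integrable (fun y => p.eval (ρ * x + σ * y)) (gaussianReal 0 1) := by
    intro p; simp_rw [key]; exact integrable_eval_gaussian _
  -- The recurrence has three terms, so the induction carries two consecutive degrees.
  have two : ∀ m, (∫ y, (He m).eval (ρ * x + σ * y) ∂(gaussianReal 0 1) = ρ ^ m * (He m).eval x) ∧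
      (∫ y, (He (m + 1)).eval (ρ * x + σ * y) ∂(gaussianReal 0 1)
        = ρ ^ (m + 1) * (He (m + 1)).eval x) := by
    have ibp : ∀ p : ℝ[X], ∫ y, (X * p).eval (ρ * x + σ * y) ∂(gaussianReal 0 1)
        = ρ * x * ∫ y, p.eval (ρ * x + σ * y) ∂(gaussianReal 0 1)
          + σ ^ 2 * ∫ y, (derivative p).eval (ρ * x + σ * y) ∂(gaussianReal 0 1) := by
      intro p
      have h1 := integral_mul_eval_gaussian (p.comp (C (ρ * x) + C σ * X))
      have h2 : ∀ y : ℝ, (derivative (p.comp (C (ρ * x) + C σ * X))).eval y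
          = σ * (derivative p).eval (ρ * x + σ * y) := by
        intro y; rw [derivative_comp]; simp
      simp_rw [h2, integral_const_mul, ← key] at h1
      have h3 : ∀ y : ℝ, (X * p).eval (ρ * x + σ * y)
          = ρ * x * p.eval (ρ * x + σ * y) + σ * (y * p.eval (ρ * x + σ * y)) := by
        intro y; simp; ring
      simp_rw [h3]
      rw [integral_add ((hI p).const_mul _), integral_const_mul, integral_const_mul, h1]
      · ring
      · refine Integrable.const_mul ?_ _
        have := integrable_eval_gaussian (X * p.comp (C (ρ * x) + C σ * X))
        refine this.congr (Filter.Eventually.of_forall fun y => ?_)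
        simp
    intro m
    induction m with
    | zero =>
      refine ⟨by simp [He_zero], ?_⟩
      have := ibp 1
      simpa [He_succ, He_zero] using this
    | succ m ih =>
      refine ⟨ih.2, ?_⟩
      have h1 := ibp (He (m + 1))
      have h2 : ∀ z : ℝ, (He (m + 1 + 1)).eval z
          = (X * He (m + 1)).eval z - ((m : ℝ) + 1) * (He m).eval z := by
        intro z; rw [X_mul_He_succ]; simp
      rw [derivative_He_succ] at h1
      simp only [eval_mul, eval_C, integral_const_mul] at h1
      rw [ih.1, ih.2] at h1
      simp_rw [h2]
      rw [integral_sub (hI _) ((hI _).const_mul _), integral_const_mul, ih.1]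
      simp only [eval_mul, eval_X] at h1 ⊢
      rw [h1]
      have : σ ^ 2 = 1 - ρ ^ 2 := by linarith
      rw [this]; ring
  exact (two m).1

theorem integrable_exp_sq_gaussian {s : ℝ} (hs : s < 1 / 2) :
    Integrable (fun x : ℝ => Real.exp (s * x ^ 2)) (gaussianReal 0 1) := by
  rw [integrable_gaussian_iff]
  have := (integrable_exp_neg_mul_sq (b := 1 / 2 - s) (by linarith)).const_mul
    ((√(2 * Real.pi))⁻¹)
  refine this.congr (Filter.Eventually.of_forall fun x => ?_)
  simp only [gaussianPDFReal]
  rw [mul_assoc (√_)⁻¹ , ← Real.exp_add]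
  simp only [NNReal.coe_one, mul_one, sub_zero]
  ring_nf

theorem integral_exp_sq_gaussian {s : ℝ} (hs : s < 1 / 2) :
    ∫ x : ℝ, Real.exp (s * x ^ 2) ∂(gaussianReal 0 1) = √(1 / (1 - 2 * s)) := by
  rw [integral_gaussianReal_eq_integral_smul one_ne_zero]
  have h1 : ∀ x : ℝ, gaussianPDFReal 0 1 x • Real.exp (s * x ^ 2)
      = (√(2 * Real.pi))⁻¹ * Real.exp (-(1 / 2 - s) * x ^ 2) := by
    intro x
    simp only [gaussianPDFReal, smul_eq_mul]
    rw [mul_assoc (√_)⁻¹ , ← Real.exp_add]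
    simp only [NNReal.coe_one, mul_one, sub_zero]
    ring_nf
  simp_rw [h1, integral_const_mul]
  rw [integral_gaussian, ← Real.sqrt_inv, ← Real.sqrt_mul (by positivity)]
  congr 1
  have : (1 - 2 * s) ≠ 0 := by linarith
  have h2 : (1 / 2 - s) ≠ 0 := by linarith
  have := Real.pi_ne_zero
  field_simp

theorem integral_exp_gaussian (t : ℝ) :
    ∫ x : ℝ, Real.exp (t * x) ∂(gaussianReal 0 1) = Real.exp (t ^ 2 / 2) := by
  have := congrFun (mgf_id_gaussianReal (μ := 0) (v := 1)) t
  simpa [mgf] using this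

end OneDim

/-! ### Standard Gaussian vectors -/

/-- The law of a vector of independent standard Gaussians. -/
abbrev stdG (ι : Type) [Fintype ι] : Measure (ι → ℝ) := Measure.pi fun _ => gaussianReal 0 1

section MultiDim

variable {ι : Type} [Fintype ι]

theorem integrable_exp_linear (u : ι → ℝ) :
    Integrable (fun T : ι → ℝ => Real.exp (∑ a, u a * T a)) (stdG ι) := by
  simp_rw [Real.exp_sum]
  exact Integrable.fintype_prod (f := fun a x => Real.exp (u a * x))
    fun a => integrable_exp_mul_gaussianReal (μ := 0) (v := 1) (u a)

theorem integral_exp_linear (u : ι → ℝ) :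
    ∫ T : ι → ℝ, Real.exp (∑ a, u a * T a) ∂(stdG ι) = Real.exp ((∑ a, u a ^ 2) / 2) := by
  simp_rw [Real.exp_sum]
  rw [integral_fintype_prod_eq_prod (fun a x => Real.exp (u a * x))]
  simp_rw [integral_exp_gaussian, ← Real.exp_sum, Finset.sum_div]

theorem integrable_exp_sq {s : ℝ} (hs : s < 1 / 2) :
    Integrable (fun T : ι → ℝ => Real.exp (s * ∑ a, T a ^ 2)) (stdG ι) := by
  simp_rw [Finset.mul_sum, Real.exp_sum]
  exact Integrable.fintype_prod (f := fun a x => Real.exp (s * x ^ 2))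
    fun a => integrable_exp_sq_gaussian hs

theorem integral_exp_sq {s : ℝ} (hs : s < 1 / 2) :
    ∫ T : ι → ℝ, Real.exp (s * ∑ a, T a ^ 2) ∂(stdG ι) = √(1 / (1 - 2 * s)) ^ Fintype.card ι := by
  simp_rw [Finset.mul_sum, Real.exp_sum]
  rw [integral_fintype_prod_eq_pow (fun x : ℝ => Real.exp (s * x ^ 2)),
    integral_exp_sq_gaussian hs]

theorem integrable_mvEval (p : MvPolynomial ι ℝ) :
    Integrable (fun T => MvPolynomial.eval T p) (stdG ι) := by
  induction p using MvPolynomial.induction_on' with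
  | monomial e c =>
    have : (fun T : ι → ℝ => MvPolynomial.eval T (MvPolynomial.monomial e c))
        = fun T => c * ∏ a, T a ^ e a := by
      ext T
      rw [MvPolynomial.eval_monomial, Finsupp.prod_fintype _ _ (by simp)]
    rw [this]
    exact (Integrable.fintype_prod (f := fun a x => x ^ e a)
      fun a => integrable_pow_gaussian (e a)).const_mul c
  | add p q hp hq => simp only [map_add]; exact hp.add hq

theorem measurable_mvEval (p : MvPolynomial ι ℝ) :
    Measurable (fun T : ι → ℝ => MvPolynomial.eval T p) :=
  (MvPolynomial.continuous_eval p).measurable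

theorem memLp_mvEval (p : MvPolynomial ι ℝ) :
    MemLp (fun T => MvPolynomial.eval T p) 2 (stdG ι) := by
  rw [memLp_two_iff_integrable_sq (measurable_mvEval p).aestronglyMeasurable]
  refine (integrable_mvEval (p * p)).congr (Filter.Eventually.of_forall fun T => ?_)
  change MvPolynomial.eval T (p * p) = MvPolynomial.eval T p ^ 2
  rw [pow_two, MvPolynomial.eval_mul]

/-- Full support lets a continuous function that vanishes almost everywhere under the null be
replaced by zero, hence vanish under the planted law too. -/
instance : (stdG ι).IsOpenPosMeasure := by
  have : (gaussianReal 0 1).IsOpenPosMeasure :=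
    (gaussianReal_absolutelyContinuous' 0 one_ne_zero).isOpenPosMeasure
  infer_instance

end MultiDim

/-! ### Square-integrable functions and their norms -/

section L2

variable {α : Type*} [MeasurableSpace α] {μ : Measure α}

/-- The `L²` norm of a real function. -/
def l2 (μ : Measure α) (f : α → ℝ) : ℝ := √(∫ x, f x ^ 2 ∂μ)

theorem l2_nonneg (f : α → ℝ) : 0 ≤ l2 μ f := Real.sqrt_nonneg _

theorem l2_sq (f : α → ℝ) : l2 μ f ^ 2 = ∫ x, f x ^ 2 ∂μ :=
  Real.sq_sqrt (integral_nonneg fun _ => sq_nonneg _)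

theorem inner_toLp {f g : α → ℝ} (hf : MemLp f 2 μ) (hg : MemLp g 2 μ) :
    inner ℝ (hf.toLp f) (hg.toLp g) = ∫ x, f x * g x ∂μ := by
  rw [L2.inner_def]
  refine integral_congr_ae ?_
  filter_upwards [hf.coeFn_toLp, hg.coeFn_toLp] with x h1 h2
  rw [h1, h2]
  simp [mul_comm]

theorem norm_toLp_eq_l2 {f : α → ℝ} (hf : MemLp f 2 μ) : ‖hf.toLp f‖ = l2 μ f := by
  rw [l2, norm_eq_sqrt_real_inner, inner_toLp]
  simp_rw [pow_two]

theorem l2_congr {f g : α → ℝ} (h : f =ᵐ[μ] g) : l2 μ f = l2 μ g := by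
  unfold l2
  congr 1
  refine integral_congr_ae ?_
  filter_upwards [h] with x hx
  rw [hx]

theorem l2_add_le {f g : α → ℝ} (hf : MemLp f 2 μ) (hg : MemLp g 2 μ) :
    l2 μ (fun x => f x + g x) ≤ l2 μ f + l2 μ g := by
  have := norm_add_le (hf.toLp f) (hg.toLp g)
  rw [← MemLp.toLp_add, norm_toLp_eq_l2, norm_toLp_eq_l2, norm_toLp_eq_l2] at this
  exact this

theorem abs_integral_mul_le {f g : α → ℝ} (hf : MemLp f 2 μ) (hg : MemLp g 2 μ) :
    |∫ x, f x * g x ∂μ| ≤ l2 μ f * l2 μ g := by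
  have := abs_real_inner_le_norm (hf.toLp f) (hg.toLp g)
  rwa [inner_toLp, norm_toLp_eq_l2, norm_toLp_eq_l2] at this

theorem l2_abs (f : α → ℝ) : l2 μ (fun x => |f x|) = l2 μ f := by
  simp [l2]

theorem integral_abs_mul_le {f g : α → ℝ} (hf : MemLp f 2 μ) (hg : MemLp g 2 μ) :
    ∫ x, |f x * g x| ∂μ ≤ l2 μ f * l2 μ g := by
  have hf' : MemLp (fun x => |f x|) 2 μ := hf.abs
  have hg' : MemLp (fun x => |g x|) 2 μ := hg.abs
  have := abs_integral_mul_le hf' hg'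
  rw [l2_abs, l2_abs] at this
  simp_rw [abs_mul]
  exact (le_abs_self _).trans this

theorem integral_abs_le_l2 [IsProbabilityMeasure μ] {f : α → ℝ} (hf : MemLp f 2 μ) :
    ∫ x, |f x| ∂μ ≤ l2 μ f := by
  have := integral_abs_mul_le hf (memLp_const (1 : ℝ))
  simpa [l2] using this

theorem sq_integral_le [IsProbabilityMeasure μ] {f : α → ℝ} (hf : MemLp f 2 μ) :
    (∫ x, f x ∂μ) ^ 2 ≤ ∫ x, f x ^ 2 ∂μ := by
  rw [← l2_sq, ← sq_abs]
  exact pow_le_pow_left₀ (abs_nonneg _) ((abs_integral_le_integral_abs).trans (integral_abs_le_l2 hf)) 2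

theorem l2_mono {f g : α → ℝ} (hg : MemLp g 2 μ) (h : ∀ x, |f x| ≤ g x) :
    l2 μ f ≤ l2 μ g := by
  refine Real.sqrt_le_sqrt (integral_mono_of_nonneg
    (Filter.Eventually.of_forall fun x => sq_nonneg _) hg.integrable_sq
    (Filter.Eventually.of_forall fun x => ?_))
  exact sq_le_sq' (by linarith [neg_abs_le (f x), h x]) (by linarith [le_abs_self (f x), h x])

theorem l2_const_mul (c : ℝ) (f : α → ℝ) : l2 μ (fun x => c * f x) = |c| * l2 μ f := by
  unfold l2
  simp_rw [mul_pow, integral_const_mul]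
  rw [Real.sqrt_mul (sq_nonneg c), Real.sqrt_sq_eq_abs]

theorem l2_const [IsProbabilityMeasure μ] (c : ℝ) : l2 μ (fun _ => c) = |c| := by
  simp [l2, Real.sqrt_sq_eq_abs]

end L2

/-! ### Polynomials are dense in `L²` of the Gaussian -/

section Density

variable {ι : Type} [Fintype ι]

theorem memLp_exp_linear (u : ι → ℝ) :
    MemLp (fun T : ι → ℝ => Real.exp (∑ a, u a * T a)) 2 (stdG ι) := by
  rw [memLp_two_iff_integrable_sq (integrable_exp_linear u).1]
  have := integrable_exp_linear (fun a => 2 * u a)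
  refine this.congr (Filter.Eventually.of_forall fun T => ?_)
  simp only
  rw [← Real.exp_nat_mul, Finset.mul_sum]
  congr 1
  refine Finset.sum_congr rfl fun a _ => ?_
  push_cast; ring

/-- Expanding the exponential in its power series leaves integrals of `f` against polynomials.
Termwise integration is dominated by `|f| exp |ℓ|`, integrable because `exp |ℓ| ≤ exp ℓ + exp (-ℓ)`
and both are square integrable. -/
theorem integral_mul_cexp_eq_zero {f : (ι → ℝ) → ℝ} (hf : MemLp f 2 (stdG ι))
    (h : ∀ p : MvPolynomial ι ℝ, ∫ T, f T * MvPolynomial.eval T p ∂(stdG ι) = 0) (u : ι → ℝ) :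
    ∫ T, (f T : ℂ) * Complex.exp ((∑ a, u a * T a : ℝ) * Complex.I) ∂(stdG ι) = 0 := by
  set ℓ : (ι → ℝ) → ℝ := fun T => ∑ a, u a * T a with hℓ
  have hℓm : Measurable ℓ := by fun_prop
  have hsum : ∀ x : ℝ, HasSum (fun m : ℕ => x ^ m / (m.factorial : ℝ)) (Real.exp x) := by
    intro x
    rw [Real.exp_eq_exp_ℝ]
    exact NormedSpace.expSeries_div_hasSum_exp x
  have key := hasSum_integral_of_dominated_convergence (μ := stdG ι)
    (F := fun m T => (f T : ℂ) * (((ℓ T : ℝ) * Complex.I) ^ m / (m.factorial : ℂ)))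
    (f := fun T => (f T : ℂ) * Complex.exp ((ℓ T : ℝ) * Complex.I))
    (bound := fun m T => |f T| * (|ℓ T| ^ m / (m.factorial : ℝ))) ?_ ?_ ?_ ?_ ?_
  · have h0 : ∀ m : ℕ, ∫ T, (f T : ℂ) * (((ℓ T : ℝ) * Complex.I) ^ m / (m.factorial : ℂ)) ∂(stdG ι)
        = 0 := by
      intro m
      have h1 : ∀ T, (f T : ℂ) * (((ℓ T : ℝ) * Complex.I) ^ m / (m.factorial : ℂ))
          = (Complex.I ^ m / (m.factorial : ℂ)) * ((f T * MvPolynomial.eval T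
            ((∑ a, MvPolynomial.C (u a) * MvPolynomial.X a) ^ m) : ℝ) : ℂ) := by
        intro T
        rw [map_pow, map_sum]
        simp only [MvPolynomial.eval_mul, MvPolynomial.eval_C, MvPolynomial.eval_X]
        rw [mul_pow]
        push_cast
        simp only [hℓ]
        push_cast
        ring
      simp_rw [h1]
      rw [integral_const_mul, integral_complex_ofReal, h]
      simp
    simp_rw [h0] at key
    exact key.unique hasSum_zero
  · intro m
    have := hf.1
    fun_prop
  · intro m
    refine Filter.Eventually.of_forall fun T => ?_
    simp
  · refine Filter.Eventually.of_forall fun T => ?_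
    exact ((hsum _).mul_left _).summable
  · have : (fun T => ∑' m : ℕ, |f T| * (|ℓ T| ^ m / (m.factorial : ℝ)))
        = fun T => |f T| * Real.exp |ℓ T| := by
      ext T
      exact ((hsum _).mul_left _).tsum_eq
    rw [this]
    have hg : MemLp (fun T => Real.exp (ℓ T) + Real.exp (∑ a, (-u a) * T a)) 2 (stdG ι) :=
      (memLp_exp_linear u).add (memLp_exp_linear fun a => -u a)
    refine (hg.integrable_mul hf.abs).mono' ?_ (Filter.Eventually.of_forall fun T => ?_)
    · have := hf.1
      fun_prop
    · simp only [Pi.mul_apply]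
      rw [Real.norm_of_nonneg (by positivity), mul_comm]
      refine mul_le_mul_of_nonneg_right ?_ (abs_nonneg _)
      have : ∑ a, (-u a) * T a = - ℓ T := by simp [hℓ]
      rw [this]
      rcases abs_cases (ℓ T) with ⟨h1, _⟩ | ⟨h1, _⟩ <;> rw [h1] <;>
        linarith [Real.exp_pos (ℓ T), Real.exp_pos (-ℓ T)]
  · refine Filter.Eventually.of_forall fun T => ?_
    refine HasSum.mul_left _ ?_
    rw [Complex.exp_eq_exp_ℂ]
    exact NormedSpace.expSeries_div_hasSum_exp _

/-- A square-integrable function orthogonal to all polynomials vanishes. -/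
theorem ae_eq_zero_of_orthogonal_polynomials {f : (ι → ℝ) → ℝ} (hf : MemLp f 2 (stdG ι))
    (h : ∀ p : MvPolynomial ι ℝ, ∫ T, f T * MvPolynomial.eval T p ∂(stdG ι) = 0) :
    f =ᵐ[stdG ι] 0 := by
  classical
  have hint : Integrable f (stdG ι) := hf.integrable (by norm_num)
  have hneg : Integrable (fun T => - f T) (stdG ι) := hint.neg
  have hfin : ∀ g : (ι → ℝ) → ℝ, Integrable g (stdG ι) →
      IsFiniteMeasure ((stdG ι).withDensity fun T => ENNReal.ofReal (g T)) := by
    intro g hg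
    exact isFiniteMeasure_withDensity_ofReal hg.2
  have := hfin f hint
  have := hfin (fun T => - f T) hneg
  have hchar : ∀ g : (ι → ℝ) → ℝ, Integrable g (stdG ι) → ∀ L : StrongDual ℝ (ι → ℝ),
      charFunDual ((stdG ι).withDensity fun T => ENNReal.ofReal (g T)) L
        = ∫ T, ((max (g T) 0 : ℝ) : ℂ) * Complex.exp (L T * Complex.I) ∂(stdG ι) := by
    intro g hg L
    rw [charFunDual_apply, integral_withDensity_eq_integral_toReal_smul₀
      hg.1.aemeasurable.ennreal_ofReal (Filter.Eventually.of_forall fun T => ENNReal.ofReal_lt_top)]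
    refine integral_congr_ae (Filter.Eventually.of_forall fun T => ?_)
    simp only [Complex.real_smul]
    rw [ENNReal.toReal_ofReal']
  -- The measures with densities `f⁺` and `f⁻` have the same characteristic function, as the
  -- difference is the Fourier transform of `f`, which vanishes.
  have heq : (stdG ι).withDensity (fun T => ENNReal.ofReal (f T))
      = (stdG ι).withDensity (fun T => ENNReal.ofReal (- f T)) := by
    refine Measure.ext_of_charFunDual (funext fun L => ?_)
    rw [hchar _ hint, hchar _ hneg, ← sub_eq_zero, ← integral_sub]
    · have hL : ∀ T, L T = ∑ a, L (Pi.single a 1) * T a := by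
        intro T
        have h1 := LinearMap.pi_apply_eq_sum_univ (L : (ι → ℝ) →ₗ[ℝ] ℝ) T
        rw [ContinuousLinearMap.coe_coe] at h1
        rw [h1]
        refine Finset.sum_congr rfl fun a _ => ?_
        rw [smul_eq_mul, mul_comm]
        congr 2
        ext b
        simp [Pi.single_apply, eq_comm]
      rw [← integral_mul_cexp_eq_zero hf h (fun a => L (Pi.single a 1))]
      refine integral_congr_ae (Filter.Eventually.of_forall fun T => ?_)
      simp only
      rw [← hL T, ← sub_mul]
      congr 1
      norm_cast
      rcases le_total 0 (f T) with h0 | h0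
      · rw [max_eq_left h0, max_eq_right (by linarith)]; ring
      · rw [max_eq_right h0, max_eq_left (by linarith)]; ring
    all_goals
      refine Integrable.mono' hint.abs ?_ (Filter.Eventually.of_forall fun T => ?_)
      · have := hf.1
        fun_prop
      · rw [norm_mul, Complex.norm_exp_ofReal_mul_I, mul_one, Complex.norm_real,
          Real.norm_of_nonneg (le_max_right _ _)]
        simp [le_abs_self, neg_le_abs]
  rw [withDensity_eq_iff hint.1.aemeasurable.ennreal_ofReal
    hneg.1.aemeasurable.ennreal_ofReal] at heq
  · filter_upwards [heq] with T hT
    rcases le_total 0 (f T) with h0 | h0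
    · rw [ENNReal.ofReal_of_nonpos (p := - f T) (by linarith), ENNReal.ofReal_eq_zero] at hT
      exact le_antisymm hT h0
    · rw [ENNReal.ofReal_of_nonpos h0, eq_comm, ENNReal.ofReal_eq_zero] at hT
      exact le_antisymm h0 (neg_nonpos.1 hT)
  · exact hint.lintegral_lt_top.ne

end Density

/-! ### Hermite polynomials as a Hilbert basis of Gaussian `L²`. -/

section HermiteBasis

variable {ι : Type} [Fintype ι]

/-- The product Hermite polynomial with degrees `e`. -/
def mvHe (e : ι → ℕ) : MvPolynomial ι ℝ :=
  ∏ a, Polynomial.aeval (MvPolynomial.X a) (He (e a))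

theorem eval_mvHe (e : ι → ℕ) (T : ι → ℝ) :
    MvPolynomial.eval T (mvHe e) = ∏ a, (He (e a)).eval (T a) := by
  rw [mvHe, map_prod]
  refine Finset.prod_congr rfl fun a _ => ?_
  rw [Polynomial.aeval_def, Polynomial.hom_eval₂]
  rw [MvPolynomial.eval_X, Polynomial.eval, MvPolynomial.algebraMap_eq]
  congr 1
  ext x
  simp

theorem totalDegree_aeval_X_le {τ : Type} (p : Polynomial ℝ) (a : τ) :
    (Polynomial.aeval (MvPolynomial.X a : MvPolynomial τ ℝ) p).totalDegree ≤ p.natDegree := by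
  rw [Polynomial.aeval_eq_sum_range]
  refine MvPolynomial.totalDegree_finsetSum_le fun i hi => ?_
  refine (MvPolynomial.totalDegree_smul_le _ _).trans ?_
  refine (MvPolynomial.totalDegree_pow _ _).trans ?_
  rw [MvPolynomial.totalDegree_X, mul_one]
  exact Nat.lt_succ_iff.1 (Finset.mem_range.1 hi)

theorem totalDegree_mvHe_le (e : ι → ℕ) : (mvHe e).totalDegree ≤ ∑ a, e a := by
  refine (MvPolynomial.totalDegree_finsetProd _ _).trans (Finset.sum_le_sum fun a _ => ?_)
  exact (totalDegree_aeval_X_le _ _).trans (natDegree_He _).le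

theorem X_mul_mvHe (e : ι → ℕ) (a : ι) :
    (MvPolynomial.X a : MvPolynomial ι ℝ) * mvHe e ∈ Submodule.span ℝ (Set.range mvHe) := by
  classical
  have hup : ∀ (m : ℕ), mvHe (Function.update e a m)
      = Polynomial.aeval (MvPolynomial.X a : MvPolynomial ι ℝ) (He m)
        * ∏ b ∈ Finset.univ.erase a, Polynomial.aeval (MvPolynomial.X b) (He (e b)) := by
    intro m
    rw [mvHe, ← Finset.mul_prod_erase _ _ (Finset.mem_univ a)]
    simp only [Function.update_self]
    congr 1
    refine Finset.prod_congr rfl fun b hb => ?_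
    rw [Function.update_of_ne (Finset.ne_of_mem_erase hb)]
  have he : mvHe e = mvHe (Function.update e a (e a)) := by simp
  rw [he, hup, ← mul_assoc]
  have hXm : ∀ q : Polynomial ℝ, (MvPolynomial.X a : MvPolynomial ι ℝ)
      * Polynomial.aeval (MvPolynomial.X a : MvPolynomial ι ℝ) q
      = Polynomial.aeval (MvPolynomial.X a : MvPolynomial ι ℝ) (Polynomial.X * q) := by
    intro q; rw [map_mul, Polynomial.aeval_X]
  rw [hXm]
  cases hm : e a with
  | zero =>
    have : Polynomial.X * He 0 = He 1 := by simp [He_succ, He_zero]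
    rw [this, ← hup]
    exact Submodule.subset_span ⟨_, rfl⟩
  | succ m =>
    rw [X_mul_He_succ, map_add, add_mul, map_mul, ← hup, mul_assoc, ← hup,
      Polynomial.aeval_C, MvPolynomial.algebraMap_eq, ← MvPolynomial.smul_eq_C_mul]
    exact Submodule.add_mem _ (Submodule.subset_span ⟨_, rfl⟩)
      (Submodule.smul_mem _ _ (Submodule.subset_span ⟨_, rfl⟩))

theorem span_mvHe : Submodule.span ℝ (Set.range (mvHe : (ι → ℕ) → MvPolynomial ι ℝ)) = ⊤ := by
  rw [eq_top_iff]
  rintro p -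
  induction p using MvPolynomial.induction_on with
  | C c =>
    have : (MvPolynomial.C c : MvPolynomial ι ℝ) = c • mvHe (fun _ => 0) := by
      simp [mvHe, He_zero, MvPolynomial.smul_eq_C_mul]
    rw [this]
    exact Submodule.smul_mem _ _ (Submodule.subset_span ⟨_, rfl⟩)
  | add p q hp hq => exact Submodule.add_mem _ hp hq
  | mul_X p a hp =>
    induction hp using Submodule.span_induction with
    | mem x hx =>
      obtain ⟨e, rfl⟩ := hx
      rw [mul_comm]; exact X_mul_mvHe e a
    | zero => simp
    | add x y _ _ hx hy => rw [add_mul]; exact Submodule.add_mem _ hx hy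
    | smul c x _ hx => rw [smul_mul_assoc]; exact Submodule.smul_mem _ _ hx

theorem integral_mvHe_mul (e e' : ι → ℕ) :
    ∫ T, MvPolynomial.eval T (mvHe e) * MvPolynomial.eval T (mvHe e') ∂(stdG ι)
      = if e = e' then ∏ a, ((e a).factorial : ℝ) else 0 := by
  simp_rw [eval_mvHe, ← Finset.prod_mul_distrib]
  rw [integral_fintype_prod_eq_prod (fun a x => (He (e a)).eval x * (He (e' a)).eval x)]
  simp_rw [integral_He_mul_He]
  split_ifs with h
  · subst h; simp
  · obtain ⟨a, ha⟩ := Function.ne_iff.1 h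
    exact Finset.prod_eq_zero (Finset.mem_univ a) (if_neg ha)

/-- The normalised product Hermite polynomials: an orthonormal basis for the Gaussian. -/
def hermN (e : ι → ℕ) : MvPolynomial ι ℝ :=
  MvPolynomial.C ((√(∏ a, ((e a).factorial : ℝ)))⁻¹) * mvHe e

theorem totalDegree_hermN_le (e : ι → ℕ) : (hermN e).totalDegree ≤ ∑ a, e a := by
  rw [hermN, ← MvPolynomial.smul_eq_C_mul]
  exact (MvPolynomial.totalDegree_smul_le _ _).trans (totalDegree_mvHe_le e)

theorem hermN_zero : hermN (fun _ : ι => 0) = 1 := by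
  simp [hermN, mvHe, He_zero]

theorem integral_hermN_mul (e e' : ι → ℕ) :
    ∫ T, MvPolynomial.eval T (hermN e) * MvPolynomial.eval T (hermN e') ∂(stdG ι)
      = if e = e' then 1 else 0 := by
  have h : ∀ T : ι → ℝ, MvPolynomial.eval T (hermN e) * MvPolynomial.eval T (hermN e')
      = ((√(∏ a, ((e a).factorial : ℝ)))⁻¹ * (√(∏ a, ((e' a).factorial : ℝ)))⁻¹)
        * (MvPolynomial.eval T (mvHe e) * MvPolynomial.eval T (mvHe e')) := by
    intro T
    simp only [hermN, MvPolynomial.eval_mul, MvPolynomial.eval_C]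
    ring
  simp_rw [h]
  rw [integral_const_mul, integral_mvHe_mul]
  split_ifs with h
  · subst h
    have hpos : (0 : ℝ) < ∏ a, ((e a).factorial : ℝ) :=
      Finset.prod_pos fun a _ => by exact_mod_cast Nat.factorial_pos _
    rw [← mul_inv, Real.mul_self_sqrt hpos.le, inv_mul_cancel₀ hpos.ne']
  · simp

/-- The Hermite coefficients of a function. -/
def hermCoeff (f : (ι → ℝ) → ℝ) (e : ι → ℕ) : ℝ :=
  ∫ T, f T * MvPolynomial.eval T (hermN e) ∂(stdG ι)

theorem orthonormal_hermN :
    Orthonormal ℝ (fun e : ι → ℕ => (memLp_mvEval (hermN e)).toLp) := by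
  classical
  rw [orthonormal_iff_ite]
  intro e e'
  rw [inner_toLp, integral_hermN_mul]

theorem hermCoeff_eq_inner {f : (ι → ℝ) → ℝ} (hf : MemLp f 2 (stdG ι)) (e : ι → ℕ) :
    hermCoeff f e = inner ℝ ((memLp_mvEval (hermN e)).toLp) (hf.toLp f) := by
  rw [inner_toLp, hermCoeff]
  simp_rw [mul_comm]

/-- The Hilbert basis of Hermite polynomials. -/
def hermBasis (ι : Type) [Fintype ι] : HilbertBasis (ι → ℕ) ℝ (Lp ℝ 2 (stdG ι)) :=
  HilbertBasis.mkOfOrthogonalEqBot orthonormal_hermN (by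
    rw [Submodule.eq_bot_iff]
    intro F hF
    rw [Submodule.mem_orthogonal] at hF
    have hFm : MemLp (F : (ι → ℝ) → ℝ) 2 (stdG ι) := Lp.memLp F
    have h1 : ∀ p : MvPolynomial ι ℝ, ∫ T, F T * MvPolynomial.eval T p ∂(stdG ι) = 0 := by
      intro p
      have hp : p ∈ Submodule.span ℝ (Set.range (mvHe : (ι → ℕ) → MvPolynomial ι ℝ)) := by
        rw [span_mvHe]; trivial
      have hint : ∀ q : MvPolynomial ι ℝ,
          Integrable (fun T => F T * MvPolynomial.eval T q) (stdG ι) :=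
        fun q => hFm.integrable_mul (memLp_mvEval q)
      induction hp using Submodule.span_induction with
      | mem x hx =>
        obtain ⟨e, rfl⟩ := hx
        have h2 := hF _ (Submodule.subset_span ⟨e, rfl⟩)
        have h3 : F = hFm.toLp F := (Lp.toLp_coeFn F hFm).symm
        rw [h3, inner_toLp] at h2
        have hpos : (0 : ℝ) < ∏ a, ((e a).factorial : ℝ) :=
          Finset.prod_pos fun a _ => by exact_mod_cast Nat.factorial_pos _
        have h4 : ∀ T : ι → ℝ, MvPolynomial.eval T (hermN e) * F T
            = (√(∏ a, ((e a).factorial : ℝ)))⁻¹ * (F T * MvPolynomial.eval T (mvHe e)) := by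
          intro T; simp only [hermN, MvPolynomial.eval_mul, MvPolynomial.eval_C]; ring
        simp_rw [h4] at h2
        rw [integral_const_mul] at h2
        rcases mul_eq_zero.1 h2 with h5 | h5
        · rw [inv_eq_zero, Real.sqrt_eq_zero hpos.le] at h5
          exact absurd h5 hpos.ne'
        · exact h5
      | zero => simp
      | add x y _ _ hx hy =>
        simp_rw [MvPolynomial.eval_add, mul_add]
        rw [integral_add (hint x) (hint y), hx, hy, add_zero]
      | smul c x _ hx =>
        simp_rw [MvPolynomial.smul_eval, mul_left_comm _ c]
        rw [integral_const_mul, hx, mul_zero]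
    have h2 := ae_eq_zero_of_orthogonal_polynomials hFm h1
    exact (Lp.eq_zero_iff_ae_eq_zero).2 h2)

theorem hermBasis_apply (e : ι → ℕ) :
    hermBasis ι e = (memLp_mvEval (hermN e)).toLp := by
  rw [hermBasis, HilbertBasis.coe_mkOfOrthogonalEqBot]

theorem l2_sum_hermN_sq (s : Finset (ι → ℕ)) (c : (ι → ℕ) → ℝ) :
    l2 (stdG ι) (fun T => ∑ e ∈ s, c e * MvPolynomial.eval T (hermN e)) ^ 2 = ∑ e ∈ s, c e ^ 2 := by
  classical
  rw [l2_sq]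
  have hint : ∀ e e' : ι → ℕ, Integrable (fun T => (c e * MvPolynomial.eval T (hermN e))
      * (c e' * MvPolynomial.eval T (hermN e'))) (stdG ι) := fun e e' =>
    ((memLp_mvEval (hermN e)).const_mul (c e)).integrable_mul
      ((memLp_mvEval (hermN e')).const_mul (c e'))
  simp_rw [pow_two, Finset.sum_mul_sum]
  rw [integral_finsetSum _ fun e _ => integrable_finsetSum _ fun e' _ => hint e e']
  refine Finset.sum_congr rfl fun e he => ?_
  rw [integral_finsetSum _ fun e' _ => hint e e']
  simp_rw [mul_mul_mul_comm (c e), integral_const_mul, integral_hermN_mul]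
  simp [he]

theorem bessel_hermCoeff {f : (ι → ℝ) → ℝ} (hf : MemLp f 2 (stdG ι)) (s : Finset (ι → ℕ)) :
    ∑ e ∈ s, hermCoeff f e ^ 2 ≤ l2 (stdG ι) f ^ 2 := by
  have := orthonormal_hermN.sum_inner_products_le (hf.toLp f) (s := s)
  rw [norm_toLp_eq_l2] at this
  refine le_trans (le_of_eq ?_) this
  refine Finset.sum_congr rfl fun e _ => ?_
  rw [hermCoeff_eq_inner hf, Real.norm_eq_abs, sq_abs]

/-- The index set may be required to contain `s₀`, so that low degrees can later be split off
exactly. -/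
theorem exists_hermite_approx {f : (ι → ℝ) → ℝ} (hf : MemLp f 2 (stdG ι)) (s₀ : Finset (ι → ℕ))
    {δ : ℝ} (hδ : 0 < δ) : ∃ s : Finset (ι → ℕ), s₀ ⊆ s ∧
      l2 (stdG ι) (fun T => f T - ∑ e ∈ s, hermCoeff f e * MvPolynomial.eval T (hermN e)) ≤ δ := by
  have h := (hermBasis ι).hasSum_repr (hf.toLp f)
  rw [HasSum, SummationFilter.unconditional_filter, Metric.tendsto_atTop] at h
  obtain ⟨s, hs⟩ := h δ hδ
  classical
  refine ⟨s ∪ s₀, Finset.subset_union_right, ?_⟩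
  have h1 := (hs (s ∪ s₀) Finset.subset_union_left).le
  rw [dist_comm, dist_eq_norm] at h1
  have hm : MemLp (fun T => ∑ e ∈ s ∪ s₀, hermCoeff f e * MvPolynomial.eval T (hermN e)) 2
      (stdG ι) := memLp_finsetSum _ fun _ _ => (memLp_mvEval _).const_mul _
  refine le_trans (le_of_eq ?_) h1
  have h2 : ∑ e ∈ s ∪ s₀, ((hermBasis ι).repr (hf.toLp f)) e • (hermBasis ι) e = hm.toLp := by
    refine Lp.ext ?_
    refine (Lp.coeFn_finsetSum _ _).trans ?_
    refine Filter.EventuallyEq.trans ?_ hm.coeFn_toLp.symm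
    have : ∀ e ∈ s ∪ s₀, ∀ᵐ T ∂(stdG ι),
        (((hermBasis ι).repr (hf.toLp f)) e • (hermBasis ι) e : Lp ℝ 2 (stdG ι)) T
          = hermCoeff f e * MvPolynomial.eval T (hermN e) := by
      intro e _
      filter_upwards [Lp.coeFn_smul (((hermBasis ι).repr (hf.toLp f)) e) ((hermBasis ι) e),
        (memLp_mvEval (hermN e)).coeFn_toLp] with T h3 h4
      rw [h3, Pi.smul_apply, hermBasis_apply, h4, HilbertBasis.repr_apply_apply, hermBasis_apply,
        ← hermCoeff_eq_inner, smul_eq_mul]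
    have h5 := (Finset.eventually_all (s ∪ s₀)).2 this
    filter_upwards [h5] with T h6
    rw [Finset.sum_apply]
    exact Finset.sum_congr rfl fun e he => h6 e he
  rw [h2, ← MemLp.toLp_sub, norm_toLp_eq_l2]
  rfl

end HermiteBasis

/-! ### The Ornstein–Uhlenbeck operator and its low-degree truncation. -/

section OrnsteinUhlenbeck

variable {ι : Type} [Fintype ι] {ρ σ : ℝ}

theorem measurePreserving_mix_one (h : ρ ^ 2 + σ ^ 2 = 1) :
    MeasurePreserving (fun p : ℝ × ℝ => ρ * p.1 + σ * p.2)
      ((gaussianReal 0 1).prod (gaussianReal 0 1)) (gaussianReal 0 1) := by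
  refine ⟨by fun_prop, ?_⟩
  have h1 : (fun p : ℝ × ℝ => ρ * p.1 + σ * p.2)
      = (fun p : ℝ × ℝ => p.1 + p.2) ∘ Prod.map (fun x => ρ * x) (fun x => σ * x) := by
    ext p; simp
  rw [h1, ← Measure.map_map (by fun_prop) (by fun_prop),
    ← Measure.map_prod_map _ _ (by fun_prop) (by fun_prop),
    gaussianReal_map_const_mul, gaussianReal_map_const_mul]
  have h2 := gaussianReal_conv_gaussianReal (m₁ := ρ * 0) (m₂ := σ * 0)
    (v₁ := NNReal.mk (ρ ^ 2) (sq_nonneg ρ) * 1) (v₂ := NNReal.mk (σ ^ 2) (sq_nonneg σ) * 1)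
  rw [Measure.conv] at h2
  rw [h2]
  congr 1
  · ring
  · ext
    simpa using h

/-- A convex rotation of two independent standard Gaussian vectors is standard Gaussian. -/
theorem measurePreserving_mix (h : ρ ^ 2 + σ ^ 2 = 1) :
    MeasurePreserving (fun p : (ι → ℝ) × (ι → ℝ) => fun a => ρ * p.1 a + σ * p.2 a)
      ((stdG ι).prod (stdG ι)) (stdG ι) := by
  have h1 := (measurePreserving_arrowProdEquivProdArrow ℝ ℝ ι (fun _ => gaussianReal 0 1)
    (fun _ => gaussianReal 0 1)).symm
  have h2 := measurePreserving_pi (fun _ : ι => (gaussianReal 0 1).prod (gaussianReal 0 1))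
    (fun _ : ι => gaussianReal 0 1) (fun _ => measurePreserving_mix_one h)
  exact h2.comp h1

/-- The Ornstein–Uhlenbeck operator. -/
def ouU (ρ σ : ℝ) (f : (ι → ℝ) → ℝ) (T : ι → ℝ) : ℝ :=
  ∫ G, f (fun a => ρ * T a + σ * G a) ∂(stdG ι)

theorem memLp_mix (h : ρ ^ 2 + σ ^ 2 = 1) {f : (ι → ℝ) → ℝ} (hf : MemLp f 2 (stdG ι)) :
    MemLp (fun p : (ι → ℝ) × (ι → ℝ) => f (fun a => ρ * p.1 a + σ * p.2 a)) 2
      ((stdG ι).prod (stdG ι)) :=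
  hf.comp_measurePreserving (measurePreserving_mix h)

theorem memLp_mix_ae (h : ρ ^ 2 + σ ^ 2 = 1) {f : (ι → ℝ) → ℝ} (hf : MemLp f 2 (stdG ι)) :
    ∀ᵐ T ∂(stdG ι), MemLp (fun G : ι → ℝ => f (fun a => ρ * T a + σ * G a)) 2 (stdG ι) := by
  have h1 := memLp_mix h hf
  have h2 := h1.integrable_sq.prod_right_ae
  have h3 := h1.1.prodMk_left
  filter_upwards [h2, h3] with T h4 h5
  exact (memLp_two_iff_integrable_sq h5).2 h4

theorem ouU_sq_integral_le_aux (h : ρ ^ 2 + σ ^ 2 = 1) {f : (ι → ℝ) → ℝ}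
    (hf : MemLp f 2 (stdG ι)) :
    ∀ᵐ T ∂(stdG ι), ouU ρ σ f T ^ 2
      ≤ ∫ G, f (fun a => ρ * T a + σ * G a) ^ 2 ∂(stdG ι) := by
  filter_upwards [memLp_mix_ae h hf] with T hT
  exact sq_integral_le hT

theorem aestronglyMeasurable_ouU (h : ρ ^ 2 + σ ^ 2 = 1) {f : (ι → ℝ) → ℝ}
    (hf : MemLp f 2 (stdG ι)) : AEStronglyMeasurable (ouU ρ σ f) (stdG ι) :=
  (memLp_mix h hf).1.integral_prod_right'

theorem memLp_ouU (h : ρ ^ 2 + σ ^ 2 = 1) {f : (ι → ℝ) → ℝ} (hf : MemLp f 2 (stdG ι)) :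
    MemLp (ouU ρ σ f) 2 (stdG ι) := by
  rw [memLp_two_iff_integrable_sq (aestronglyMeasurable_ouU h hf)]
  refine ((memLp_mix h hf).integrable_sq.integral_prod_left).mono'
    ((aestronglyMeasurable_ouU h hf).pow 2) ?_
  filter_upwards [ouU_sq_integral_le_aux h hf] with T hT
  rw [Real.norm_of_nonneg (sq_nonneg _)]
  exact hT

/-- Jensen in the noise variable, followed by invariance of the Gaussian under the mixing map. -/
theorem l2_ouU_le (h : ρ ^ 2 + σ ^ 2 = 1) {f : (ι → ℝ) → ℝ} (hf : MemLp f 2 (stdG ι)) :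
    l2 (stdG ι) (ouU ρ σ f) ≤ l2 (stdG ι) f := by
  refine Real.sqrt_le_sqrt ?_
  have h1 := integral_mono_ae (memLp_ouU h hf).integrable_sq
    (memLp_mix h hf).integrable_sq.integral_prod_left (ouU_sq_integral_le_aux h hf)
  refine h1.trans (le_of_eq ?_)
  rw [← integral_prod _ (memLp_mix h hf).integrable_sq]
  have hmp := measurePreserving_mix (ι := ι) h
  have h2 := integral_map hmp.aemeasurable (f := fun T => f T ^ 2)
    (by rw [hmp.map_eq]; exact hf.1.pow 2)
  rw [hmp.map_eq] at h2
  exact h2.symm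

theorem ouU_hermN (h : ρ ^ 2 + σ ^ 2 = 1) (e : ι → ℕ) (T : ι → ℝ) :
    ouU ρ σ (fun T => MvPolynomial.eval T (hermN e)) T
      = ρ ^ (∑ a, e a) * MvPolynomial.eval T (hermN e) := by
  simp only [ouU, hermN, MvPolynomial.eval_mul, MvPolynomial.eval_C, eval_mvHe]
  rw [integral_const_mul,
    integral_fintype_prod_eq_prod (fun a x => (He (e a)).eval (ρ * T a + σ * x))]
  simp_rw [integral_He_noise h]
  rw [Finset.prod_mul_distrib, Finset.prod_pow_eq_pow_sum]
  ring

theorem ouU_sub_ae (h : ρ ^ 2 + σ ^ 2 = 1) {f g : (ι → ℝ) → ℝ} (hf : MemLp f 2 (stdG ι))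
    (hg : MemLp g 2 (stdG ι)) :
    ouU ρ σ (fun T => f T - g T) =ᵐ[stdG ι] fun T => ouU ρ σ f T - ouU ρ σ g T := by
  filter_upwards [memLp_mix_ae h hf, memLp_mix_ae h hg] with T h1 h2
  exact integral_sub (h1.integrable (by norm_num)) (h2.integrable (by norm_num))

theorem ouU_sum_hermN (h : ρ ^ 2 + σ ^ 2 = 1) (s : Finset (ι → ℕ)) (c : (ι → ℕ) → ℝ)
    (T : ι → ℝ) :
    ouU ρ σ (fun T => ∑ e ∈ s, c e * MvPolynomial.eval T (hermN e)) T
      = ∑ e ∈ s, c e * (ρ ^ (∑ a, e a) * MvPolynomial.eval T (hermN e)) := by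
  have hint : ∀ e : ι → ℕ, Integrable (fun G : ι → ℝ =>
      MvPolynomial.eval (fun a => ρ * T a + σ * G a) (hermN e)) (stdG ι) := by
    intro e
    have := integrable_mvEval (MvPolynomial.bind₁ (fun a : ι => MvPolynomial.C (ρ * T a)
      + MvPolynomial.C σ * MvPolynomial.X a) (hermN e))
    refine this.congr (Filter.Eventually.of_forall fun G => ?_)
    simp only
    rw [MvPolynomial.eval, MvPolynomial.eval₂Hom_bind₁]
    congr 2
    ext a
    simp
  rw [ouU, integral_finsetSum _ fun e _ => (hint e).const_mul _]
  refine Finset.sum_congr rfl fun e _ => ?_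
  rw [integral_const_mul, ← ouU_hermN h]
  rfl

/-- Multi-indices of total degree less than `D`. -/
def lowIdx (ι : Type) [Fintype ι] (D : ℕ) : Finset (ι → ℕ) := by
  classical
  exact (Fintype.piFinset fun _ : ι => Finset.range D).filter fun e => ∑ a, e a < D

theorem mem_lowIdx {D : ℕ} {e : ι → ℕ} : e ∈ lowIdx ι D ↔ ∑ a, e a < D := by
  classical
  simp only [lowIdx, Finset.mem_filter, Fintype.mem_piFinset, Finset.mem_range, and_iff_right_iff_imp]
  intro h a
  exact (Finset.single_le_sum (fun _ _ => Nat.zero_le _) (Finset.mem_univ a)).trans_lt h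

/-- The truncation to degree less than `D` of the image of a function under the
Ornstein–Uhlenbeck operator, as a polynomial. -/
def lowOU (ρ : ℝ) (D : ℕ) (f : (ι → ℝ) → ℝ) : MvPolynomial ι ℝ :=
  ∑ e ∈ lowIdx ι D, MvPolynomial.C (hermCoeff f e * ρ ^ (∑ a, e a)) * hermN e

theorem eval_lowOU (D : ℕ) (f : (ι → ℝ) → ℝ) (T : ι → ℝ) :
    MvPolynomial.eval T (lowOU ρ D f)
      = ∑ e ∈ lowIdx ι D, (hermCoeff f e * ρ ^ (∑ a, e a)) * MvPolynomial.eval T (hermN e) := by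
  rw [lowOU, map_sum]
  refine Finset.sum_congr rfl fun e _ => ?_
  rw [MvPolynomial.eval_mul, MvPolynomial.eval_C]

theorem totalDegree_lowOU (D : ℕ) (f : (ι → ℝ) → ℝ) :
    (lowOU ρ D f).totalDegree ≤ D - 1 := by
  refine MvPolynomial.totalDegree_finsetSum_le fun e he => ?_
  rw [← MvPolynomial.smul_eq_C_mul]
  refine (MvPolynomial.totalDegree_smul_le _ _).trans ((totalDegree_hermN_le e).trans ?_)
  have := mem_lowIdx.1 he
  omega

theorem pow_sq_le_one (hρ : ρ ^ 2 ≤ 1) (m : ℕ) : (ρ ^ m) ^ 2 ≤ 1 := by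
  rw [← pow_mul, mul_comm, pow_mul]
  exact pow_le_one₀ (sq_nonneg _) hρ

/-- Bessel's inequality, since every Hermite coefficient is multiplied by a number of absolute value
at most one. -/
theorem l2_lowOU_le (h : ρ ^ 2 + σ ^ 2 = 1) (D : ℕ) {f : (ι → ℝ) → ℝ}
    (hf : MemLp f 2 (stdG ι)) :
    l2 (stdG ι) (fun T => MvPolynomial.eval T (lowOU ρ D f)) ≤ l2 (stdG ι) f := by
  refine le_of_sq_le_sq ?_ (l2_nonneg _)
  simp_rw [eval_lowOU]
  rw [l2_sum_hermN_sq]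
  refine le_trans (Finset.sum_le_sum fun _ _ => ?_) (bessel_hermCoeff hf (lowIdx ι D))
  rw [mul_pow]
  exact mul_le_of_le_one_right (sq_nonneg _) (pow_sq_le_one (by nlinarith [sq_nonneg σ]) _)

theorem memLp_sum_hermN (s : Finset (ι → ℕ)) (c : (ι → ℕ) → ℝ) :
    MemLp (fun T => ∑ e ∈ s, c e * MvPolynomial.eval T (hermN e)) 2 (stdG ι) :=
  memLp_finsetSum _ fun _ _ => (memLp_mvEval _).const_mul _

/-- Truncating the Ornstein–Uhlenbeck operator at degree `D` costs at most `ρ ^ D`. -/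
theorem l2_ouU_sub_lowOU_le (h : ρ ^ 2 + σ ^ 2 = 1) (hρ : 0 ≤ ρ) (D : ℕ) {f : (ι → ℝ) → ℝ}
    (hf : MemLp f 2 (stdG ι)) :
    l2 (stdG ι) (fun T => ouU ρ σ f T - MvPolynomial.eval T (lowOU ρ D f))
      ≤ ρ ^ D * l2 (stdG ι) f := by
  classical
  refine le_of_forall_pos_le_add fun δ hδ => ?_
  -- Replace `f` by a finite Hermite sum `g`. The operator is a contraction, so `f - g` costs at
  -- most `δ`; what is left of `g` after truncation has degrees at least `D` and gains `ρ ^ D`.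
  obtain ⟨s, hs, hδs⟩ := exists_hermite_approx hf (lowIdx ι D) hδ
  set g : (ι → ℝ) → ℝ := fun T => ∑ e ∈ s, hermCoeff f e * MvPolynomial.eval T (hermN e) with hg
  have hgm : MemLp g 2 (stdG ι) := memLp_sum_hermN s _
  have h1 : (fun T => ouU ρ σ f T - MvPolynomial.eval T (lowOU ρ D f)) =ᵐ[stdG ι]
      fun T => ouU ρ σ (fun T => f T - g T) T + ∑ e ∈ s \ lowIdx ι D,
        (hermCoeff f e * ρ ^ (∑ a, e a)) * MvPolynomial.eval T (hermN e) := by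
    filter_upwards [ouU_sub_ae h hf hgm] with T hT
    rw [hT, hg, ouU_sum_hermN h, eval_lowOU, ← Finset.sum_sdiff hs]
    simp_rw [mul_assoc]
    ring
  rw [l2_congr h1]
  refine (l2_add_le (memLp_ouU h (hf.sub hgm)) (memLp_sum_hermN _ _)).trans ?_
  rw [add_comm]
  refine add_le_add ?_ ((l2_ouU_le h (hf.sub hgm)).trans hδs)
  refine le_of_sq_le_sq ?_ (mul_nonneg (pow_nonneg hρ D) (l2_nonneg _))
  rw [l2_sum_hermN_sq, mul_pow]
  refine le_trans ?_ (mul_le_mul_of_nonneg_left (bessel_hermCoeff hf (s \ lowIdx ι D))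
    (sq_nonneg _))
  rw [Finset.mul_sum]
  refine Finset.sum_le_sum fun e he => ?_
  rw [mul_pow, mul_comm]
  refine mul_le_mul_of_nonneg_right ?_ (sq_nonneg _)
  refine pow_le_pow_left₀ (pow_nonneg hρ _) (pow_le_pow_of_le_one hρ ?_ ?_) 2
  · nlinarith [sq_nonneg σ]
  · have := (Finset.mem_sdiff.1 he).2
    rw [mem_lowIdx] at this
    omega

theorem hermCoeff_add {f g : (ι → ℝ) → ℝ} (hf : MemLp f 2 (stdG ι)) (hg : MemLp g 2 (stdG ι))
    (e : ι → ℕ) : hermCoeff (fun T => f T + g T) e = hermCoeff f e + hermCoeff g e := by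
  simp only [hermCoeff, add_mul]
  exact integral_add (hf.integrable_mul (memLp_mvEval _)) (hg.integrable_mul (memLp_mvEval _))

theorem lowOU_add (D : ℕ) {f g : (ι → ℝ) → ℝ} (hf : MemLp f 2 (stdG ι))
    (hg : MemLp g 2 (stdG ι)) :
    lowOU ρ D (fun T => f T + g T) = lowOU ρ D f + lowOU ρ D g := by
  simp only [lowOU, hermCoeff_add hf hg, add_mul, MvPolynomial.C_add, Finset.sum_add_distrib]

theorem lowOU_const_mul (D : ℕ) (c : ℝ) (f : (ι → ℝ) → ℝ) :
    lowOU ρ D (fun T => c * f T) = MvPolynomial.C c * lowOU ρ D f := by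
  simp only [lowOU, hermCoeff, mul_assoc, integral_const_mul, MvPolynomial.C_mul, Finset.mul_sum]

theorem lowOU_sum (D : ℕ) {κ : Type*} (s : Finset κ) (f : κ → (ι → ℝ) → ℝ)
    (hf : ∀ i ∈ s, MemLp (f i) 2 (stdG ι)) :
    lowOU ρ D (fun T => ∑ i ∈ s, f i T) = ∑ i ∈ s, lowOU ρ D (f i) := by
  classical
  induction s using Finset.induction_on with
  | empty => simp [lowOU, hermCoeff]
  | insert a s ha ih =>
    simp_rw [Finset.sum_insert ha]
    rw [lowOU_add D (hf a (Finset.mem_insert_self _ _))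
      (memLp_finsetSum s fun i hi => hf i (Finset.mem_insert_of_mem hi)),
      ih fun i hi => hf i (Finset.mem_insert_of_mem hi)]

theorem lowOU_one {D : ℕ} (hD : 0 < D) : lowOU ρ D (fun _ : ι → ℝ => 1) = 1 := by
  classical
  have h : ∀ e : ι → ℕ, hermCoeff (fun _ : ι → ℝ => 1) e = if e = fun _ => 0 then 1 else 0 := by
    intro e
    have := integral_hermN_mul (fun _ : ι => 0) e
    simp_rw [hermN_zero, map_one] at this
    rw [hermCoeff, this]
    simp_rw [eq_comm]
  rw [lowOU, Finset.sum_eq_single (fun _ => 0)]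
  · simp [h, hermN_zero]
  · intro e _ he
    simp [h, he]
  · intro hn
    exact absurd (mem_lowIdx.2 (by simpa using hD)) hn

end OrnsteinUhlenbeck

/-! ### The largest eigenvalue -/

section TopEigenvalue

variable {κ : Type} [Fintype κ]

/-- The quadratic form of a matrix. -/
def quad (M : Matrix κ κ ℝ) (z : κ → ℝ) : ℝ := ∑ s, ∑ t, M s t * (z s * z t)

theorem quad_eq (M : Matrix κ κ ℝ) (z : κ → ℝ) :
    quad M z = star z ⬝ᵥ (M.mulVec z) := by
  simp only [quad, dotProduct, Matrix.mulVec, Finset.mul_sum]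
  refine Finset.sum_congr rfl fun s _ => Finset.sum_congr rfl fun t _ => ?_
  simp; ring

theorem posSemidef_iff_quad {M : Matrix κ κ ℝ} :
    M.PosSemidef ↔ M.IsSymm ∧ ∀ z, 0 ≤ quad M z := by
  rw [Matrix.posSemidef_iff_dotProduct_mulVec]
  simp_rw [quad_eq]
  rw [Matrix.isHermitian_iff_isSymm]

theorem quad_sub (M M' : Matrix κ κ ℝ) (z : κ → ℝ) :
    quad (M - M') z = quad M z - quad M' z := by
  simp [quad, sub_mul, Finset.sum_sub_distrib]

theorem quad_add (M M' : Matrix κ κ ℝ) (z : κ → ℝ) :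
    quad (M + M') z = quad M z + quad M' z := by
  simp [quad, add_mul, Finset.sum_add_distrib]

theorem quad_le_sum_abs (M : Matrix κ κ ℝ) (z : κ → ℝ) :
    quad M z ≤ (∑ s, ∑ t, |M s t|) * ∑ s, z s ^ 2 := by
  rw [quad, Finset.sum_mul]
  refine Finset.sum_le_sum fun s _ => ?_
  rw [Finset.sum_mul]
  refine Finset.sum_le_sum fun t _ => ?_
  have h1 : |z s * z t| ≤ ∑ r, z r ^ 2 := by
    have hs := Finset.single_le_sum (f := fun r => z r ^ 2) (fun r _ => sq_nonneg _)
      (Finset.mem_univ s)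
    have ht := Finset.single_le_sum (f := fun r => z r ^ 2) (fun r _ => sq_nonneg _)
      (Finset.mem_univ t)
    rw [abs_mul]
    have := two_mul_le_add_sq |z s| |z t|
    rw [sq_abs, sq_abs] at this
    nlinarith
  calc M s t * (z s * z t) ≤ |M s t * (z s * z t)| := le_abs_self _
    _ = |M s t| * |z s * z t| := abs_mul _ _
    _ ≤ _ := mul_le_mul_of_nonneg_left h1 (abs_nonneg _)

variable [DecidableEq κ]

theorem quad_smul_one (c : ℝ) (z : κ → ℝ) :
    quad (c • (1 : Matrix κ κ ℝ)) z = c * ∑ s, z s ^ 2 := by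
  simp only [quad, Matrix.smul_apply, Matrix.one_apply, smul_eq_mul, mul_ite, mul_one, mul_zero,
    ite_mul, zero_mul, Finset.sum_ite_eq, Finset.mem_univ, if_true, Finset.mul_sum]
  exact Finset.sum_congr rfl fun s _ => by ring

open scoped Pointwise in
theorem posSemidef_smul_one_sub_iff {M : Matrix κ κ ℝ} (hM : M.IsSymm) (c : ℝ) :
    (c • (1 : Matrix κ κ ℝ) - M).PosSemidef ↔ ∀ x ∈ spectrum ℝ M, x ≤ c := by
  rw [Matrix.posSemidef_iff_isHermitian_and_spectrum_nonneg]
  have h1 : (c • (1 : Matrix κ κ ℝ) - M).IsHermitian := by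
    rw [Matrix.isHermitian_iff_isSymm]
    exact (Matrix.isSymm_one.smul c).sub hM
  have h2 : spectrum ℝ (c • (1 : Matrix κ κ ℝ) - M) = ({c} : Set ℝ) - spectrum ℝ M := by
    rw [spectrum.singleton_sub_eq, Algebra.algebraMap_eq_smul_one]
  rw [h2]
  simp only [h1, true_and]
  constructor
  · intro h x hx
    have := h (Set.sub_mem_sub (Set.mem_singleton c) hx)
    simpa using this
  · rintro h _ ⟨a, rfl, x, hx, rfl⟩
    simpa using h x hx

/-- The spectrum lies below `c` exactly when `c • 1 - M` is positive semidefinite. All later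
eigenvalue bounds go through this variational form. -/
theorem lambdaMaxPlus_le_iff {M : Matrix κ κ ℝ} (hM : M.IsSymm) (c : ℝ) :
    lambdaMaxPlus M ≤ c ↔ 0 ≤ c ∧ ∀ z, quad M z ≤ c * ∑ s, z s ^ 2 := by
  have hbdd : BddAbove (insert 0 (spectrum ℝ M)) := (Matrix.finite_real_spectrum.insert 0).bddAbove
  have h1 : lambdaMaxPlus M ≤ c ↔ 0 ≤ c ∧ ∀ x ∈ spectrum ℝ M, x ≤ c := by
    rw [lambdaMaxPlus, csSup_le_iff hbdd (Set.insert_nonempty _ _)]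
    simp
  rw [h1, ← posSemidef_smul_one_sub_iff hM, posSemidef_iff_quad]
  simp only [quad_sub, quad_smul_one, sub_nonneg]
  have h2 : (c • (1 : Matrix κ κ ℝ) - M).IsSymm := (Matrix.isSymm_one.smul c).sub hM
  simp [h2]

theorem lambdaMaxPlus_nonneg {M : Matrix κ κ ℝ} (hM : M.IsSymm) : 0 ≤ lambdaMaxPlus M :=
  ((lambdaMaxPlus_le_iff hM _).1 le_rfl).1

theorem quad_le_lambdaMaxPlus {M : Matrix κ κ ℝ} (hM : M.IsSymm) (z : κ → ℝ) :
    quad M z ≤ lambdaMaxPlus M * ∑ s, z s ^ 2 :=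
  ((lambdaMaxPlus_le_iff hM _).1 le_rfl).2 z

theorem lambdaMaxPlus_le_add {M M' : Matrix κ κ ℝ} (hM : M.IsSymm) (hM' : M'.IsSymm) :
    lambdaMaxPlus M ≤ lambdaMaxPlus M' + ∑ s, ∑ t, |M s t - M' s t| := by
  rw [lambdaMaxPlus_le_iff hM]
  refine ⟨add_nonneg (lambdaMaxPlus_nonneg hM') (Finset.sum_nonneg fun s _ =>
    Finset.sum_nonneg fun t _ => abs_nonneg _), fun z => ?_⟩
  have h1 := quad_le_lambdaMaxPlus hM' z
  have h2 := quad_le_sum_abs (M - M') z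
  rw [quad_sub] at h2
  simp only [Matrix.sub_apply] at h2
  linarith [add_mul (lambdaMaxPlus M') (∑ s, ∑ t, |M s t - M' s t|) (∑ s, z s ^ 2)]

theorem abs_lambdaMaxPlus_sub_le {M M' : Matrix κ κ ℝ} (hM : M.IsSymm) (hM' : M'.IsSymm) :
    |lambdaMaxPlus M - lambdaMaxPlus M'| ≤ ∑ s, ∑ t, |M s t - M' s t| := by
  rw [abs_le]
  have h1 := lambdaMaxPlus_le_add hM hM'
  have h2 := lambdaMaxPlus_le_add hM' hM
  simp_rw [abs_sub_comm (M' _ _)] at h2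
  constructor <;> linarith

theorem lambdaMaxPlus_le_sum_abs {M : Matrix κ κ ℝ} (hM : M.IsSymm) :
    lambdaMaxPlus M ≤ ∑ s, ∑ t, |M s t| := by
  rw [lambdaMaxPlus_le_iff hM]
  exact ⟨Finset.sum_nonneg fun s _ => Finset.sum_nonneg fun t _ => abs_nonneg _,
    quad_le_sum_abs M⟩

/-- The largest eigenvalue of a matrix with a single diagonal entry. -/
theorem lambdaMaxPlus_single (i : κ) (c : ℝ) :
    lambdaMaxPlus (Matrix.single i i c) = max c 0 := by
  have hq : ∀ z, quad (Matrix.single i i c) z = c * z i ^ 2 := by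
    intro z
    simp only [quad, Matrix.single_apply]
    rw [Finset.sum_eq_single i, Finset.sum_eq_single i]
    · simp only [and_self, if_true]; ring
    · intro b _ hb; simp [hb.symm]
    · simp
    · intro b _ hb; simp [hb.symm]
    · simp
  have hM : (Matrix.single i i c).IsSymm := by
    ext a b
    simp [Matrix.single_apply, and_comm]
  apply le_antisymm
  · rw [lambdaMaxPlus_le_iff hM]
    refine ⟨le_max_right _ _, fun z => ?_⟩
    rw [hq]
    have h1 := Finset.single_le_sum (f := fun r => z r ^ 2) (fun r _ => sq_nonneg _)
      (Finset.mem_univ i)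
    calc c * z i ^ 2 ≤ max c 0 * z i ^ 2 :=
          mul_le_mul_of_nonneg_right (le_max_left _ _) (sq_nonneg _)
      _ ≤ _ := mul_le_mul_of_nonneg_left h1 (le_max_right _ _)
  · refine max_le ?_ (lambdaMaxPlus_nonneg hM)
    have := quad_le_lambdaMaxPlus hM (Pi.single i 1)
    rw [hq] at this
    simpa [Pi.single_apply, ite_pow] using this

end TopEigenvalue

/-! ### Continuity and integrability of the top eigenvalue of a polynomial matrix. -/

section TopEig

variable {n k d : ℕ}

theorem isSymm_map_eval {Q : Matrix (Tup n d) (Tup n d) (MvPolynomial (Idx n k) ℝ)}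
    (hQ : Q.IsSymm) (T : Tensor n k) : (Q.map (MvPolynomial.eval T)).IsSymm := by
  ext s t
  simp only [Matrix.transpose_apply, Matrix.map_apply]
  rw [hQ.apply]

/-- The top eigenvalue is Lipschitz in the matrix entries, and these are polynomials. -/
theorem continuous_topEig {Q : Matrix (Tup n d) (Tup n d) (MvPolynomial (Idx n k) ℝ)}
    (hQ : Q.IsSymm) : Continuous (topEig Q) := by
  rw [continuous_iff_continuousAt]
  intro T₀
  have h1 : Filter.Tendsto (fun T => ∑ s, ∑ t, |MvPolynomial.eval T (Q s t)
      - MvPolynomial.eval T₀ (Q s t)|) (nhds T₀) (nhds 0) := by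
    have hc : Continuous (fun T => ∑ s, ∑ t, |MvPolynomial.eval T (Q s t)
        - MvPolynomial.eval T₀ (Q s t)|) := by
      refine continuous_finsetSum _ fun s _ => continuous_finsetSum _ fun t _ => ?_
      exact ((MvPolynomial.continuous_eval _).sub continuous_const).abs
    simpa using hc.tendsto T₀
  rw [ContinuousAt, tendsto_iff_dist_tendsto_zero]
  refine squeeze_zero (fun _ => dist_nonneg) (fun T => ?_) h1
  exact abs_lambdaMaxPlus_sub_le (isSymm_map_eval hQ T) (isSymm_map_eval hQ T₀)

theorem topEig_nonneg {Q : Matrix (Tup n d) (Tup n d) (MvPolynomial (Idx n k) ℝ)}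
    (hQ : Q.IsSymm) (T : Tensor n k) : 0 ≤ topEig Q T :=
  lambdaMaxPlus_nonneg (isSymm_map_eval hQ T)

theorem integrable_topEig {Q : Matrix (Tup n d) (Tup n d) (MvPolynomial (Idx n k) ℝ)}
    (hQ : Q.IsSymm) {P : Measure (Tensor n k)}
    (hP : ∀ p : MvPolynomial (Idx n k) ℝ, Integrable (fun T => MvPolynomial.eval T p) P) :
    Integrable (topEig Q) P := by
  refine Integrable.mono' (g := fun T => ∑ s, ∑ t, |MvPolynomial.eval T (Q s t)|)
    (integrable_finsetSum _ fun s _ => integrable_finsetSum _ fun t _ => (hP _).abs)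
    (continuous_topEig hQ).aestronglyMeasurable (Filter.Eventually.of_forall fun T => ?_)
  rw [Real.norm_of_nonneg (topEig_nonneg hQ T)]
  exact lambdaMaxPlus_le_sum_abs (isSymm_map_eval hQ T)

end TopEig

/-! ### The planted distribution -/

section Planted

variable {n k : ℕ}

theorem unif_eq : unif n k = stdG (Idx n k) := rfl

instance : IsProbabilityMeasure (unif n k) := by rw [unif_eq]; infer_instance

/-- The planted tensor with sign pattern `s` and noise `G`. -/
def plant (lam : ℝ) (s : Fin n → Bool) (G : Tensor n k) : Tensor n k :=
  lam • tensorPow k (signVec s) + G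

theorem measurable_plant (lam : ℝ) (s : Fin n → Bool) :
    Measurable (plant (k := k) lam s) := measurable_const_add _

theorem measurable_plant_uncurry (lam : ℝ) :
    Measurable fun p : (Fin n → Bool) × Tensor n k => lam • tensorPow k (signVec p.1) + p.2 :=
  measurable_from_prod_countable_right fun s => measurable_plant lam s

theorem lintegral_uniform_sign {f : (Fin n → Bool) → ℝ≥0∞} :
    ∫⁻ s, f s ∂(PMF.uniformOfFintype (Fin n → Bool)).toMeasure = ∑ s, f s * ((2 : ℝ≥0∞) ^ n)⁻¹ := by
  rw [lintegral_fintype]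
  refine Finset.sum_congr rfl fun s _ => ?_
  rw [PMF.toMeasure_apply_singleton _ _ (measurableSet_singleton s), PMF.uniformOfFintype_apply]
  simp

/-- As a finite mixture of shifted Gaussians, the planted law turns expectations into averages over
signs of Gaussian integrals. -/
theorem planted_eq_sum (lam : ℝ) :
    planted n k lam = ∑ s : Fin n → Bool,
      ((2 : ℝ≥0∞) ^ n)⁻¹ • (unif n k).map (plant lam s) := by
  ext A hA
  rw [planted, Measure.map_apply (measurable_plant_uncurry lam) hA,
    Measure.prod_apply (measurable_plant_uncurry lam hA), lintegral_uniform_sign,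
    Measure.finsetSum_apply]
  refine Finset.sum_congr rfl fun s _ => ?_
  rw [Measure.smul_apply, Measure.map_apply (measurable_plant lam s) hA, smul_eq_mul, mul_comm]
  rfl

instance (lam : ℝ) : IsProbabilityMeasure (planted n k lam) :=
  Measure.isProbabilityMeasure_map (measurable_plant_uncurry lam).aemeasurable

theorem integrable_eval_plant (lam : ℝ) (s : Fin n → Bool) (p : MvPolynomial (Idx n k) ℝ) :
    Integrable (fun G => MvPolynomial.eval (plant lam s G) p) (unif n k) := by
  have := integrable_mvEval (MvPolynomial.bind₁ (fun a : Idx n k =>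
    MvPolynomial.C (lam * tensorPow k (signVec s) a) + MvPolynomial.X a) p)
  rw [unif_eq]
  refine this.congr (Filter.Eventually.of_forall fun G => ?_)
  simp only
  rw [MvPolynomial.eval, MvPolynomial.eval₂Hom_bind₁]
  congr 2
  ext a
  simp [plant]

theorem integrable_planted {lam : ℝ} {f : Tensor n k → ℝ} (hf : Measurable f)
    (h : ∀ s, Integrable (fun G => f (plant lam s G)) (unif n k)) :
    Integrable f (planted n k lam) := by
  rw [planted_eq_sum, integrable_finsetSum_measure]
  intro s _
  refine Integrable.smul_measure ?_ (by simp)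
  rw [integrable_map_measure hf.aestronglyMeasurable (measurable_plant lam s).aemeasurable]
  exact h s

theorem integral_planted {lam : ℝ} {f : Tensor n k → ℝ} (hf : Measurable f)
    (h : ∀ s, Integrable (fun G => f (plant lam s G)) (unif n k)) :
    ∫ T, f T ∂(planted n k lam)
      = ((2 : ℝ) ^ n)⁻¹ * ∑ s, ∫ G, f (plant lam s G) ∂(unif n k) := by
  rw [planted_eq_sum, integral_finsetSum_measure, Finset.mul_sum]
  · refine Finset.sum_congr rfl fun s _ => ?_
    rw [integral_smul_measure, integral_map (measurable_plant lam s).aemeasurable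
      hf.aestronglyMeasurable]
    simp
  · intro s _
    refine Integrable.smul_measure ?_ (by simp)
    rw [integrable_map_measure hf.aestronglyMeasurable (measurable_plant lam s).aemeasurable]
    exact h s

theorem integrable_eval_planted (lam : ℝ) (p : MvPolynomial (Idx n k) ℝ) :
    Integrable (fun T => MvPolynomial.eval T p) (planted n k lam) :=
  integrable_planted (measurable_mvEval p) fun s => integrable_eval_plant lam s p

theorem card_support_le_totalDegree {ι : Type} (p : MvPolynomial ι ℝ) {e : ι →₀ ℕ}
    (he : e ∈ p.support) : e.support.card ≤ p.totalDegree := by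
  refine le_trans ?_ (MvPolynomial.le_totalDegree he)
  rw [Finset.card_eq_sum_ones]
  exact Finset.sum_le_sum fun a ha => Nat.one_le_iff_ne_zero.2 (Finsupp.mem_support_iff.1 ha)

/-- In the absence of a low-degree distinguisher, planted expectations of top eigenvalues are
controlled by null expectations. -/
theorem integral_topEig_planted_le {d m : ℕ} {lam R : ℝ}
    (hND : ∀ Q : Matrix (Tup n d) (Tup n d) (MvPolynomial (Idx n k) ℝ),
      HasInstDegreeLE Q m → ¬ Distinguishes lam R Q)
    {Q : Matrix (Tup n d) (Tup n d) (MvPolynomial (Idx n k) ℝ)} (hQ : Q.IsSymm)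
    (hdeg : ∀ s t, (Q s t).totalDegree ≤ m) :
    ∫ T, topEig Q T ∂(planted n k lam) ≤ R * ∫ T, topEig Q T ∂(unif n k) := by
  have h1 : Integrable (topEig Q) (planted n k lam) :=
    integrable_topEig hQ (integrable_eval_planted lam)
  have h2 : Integrable (topEig Q) (unif n k) := integrable_topEig hQ integrable_mvEval
  have h3 : 0 ≤ ∫ T, topEig Q T ∂(unif n k) := integral_nonneg (topEig_nonneg hQ)
  have h4 := hND Q ⟨hQ, fun s t e he => (card_support_le_totalDegree _ he).trans (hdeg s t)⟩
  rcases h3.eq_or_lt with h5 | h5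
  · have h6 : topEig Q =ᵐ[stdG (Idx n k)] 0 :=
      (integral_eq_zero_iff_of_nonneg (topEig_nonneg hQ) h2).1 h5.symm
    have h7 : topEig Q = 0 :=
      (Continuous.ae_eq_iff_eq _ (continuous_topEig hQ) continuous_const).1 h6
    simp [h7]
  · by_contra hc
    push Not at hc
    exact h4 ⟨h1, h2, h5, (le_div_iff₀ h5).2 hc.le⟩

/-- The empty tuple. -/
def emptyTup (n d : ℕ) : Tup n d := ⟨0, fun i => i.elim0⟩

/-- A scalar polynomial is tested by placing it in one diagonal entry of an otherwise zero matrix,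
whose `λ_max^+` is the positive part. -/
theorem integral_posPart_planted_le {d m : ℕ} {lam R : ℝ}
    (hND : ∀ Q : Matrix (Tup n d) (Tup n d) (MvPolynomial (Idx n k) ℝ),
      HasInstDegreeLE Q m → ¬ Distinguishes lam R Q)
    (p : MvPolynomial (Idx n k) ℝ) (hp : p.totalDegree ≤ m) :
    ∫ T, max (MvPolynomial.eval T p) 0 ∂(planted n k lam)
      ≤ R * ∫ T, max (MvPolynomial.eval T p) 0 ∂(unif n k) := by
  have h1 : ∀ T, topEig (Matrix.single (emptyTup n d) (emptyTup n d) p) T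
      = max (MvPolynomial.eval T p) 0 := by
    intro T
    rw [topEig, ← lambdaMaxPlus_single (emptyTup n d)]
    congr 1
    ext s t
    simp only [Matrix.map_apply, Matrix.single_apply]
    split_ifs <;> simp
  have h2 := integral_topEig_planted_le hND
    (Q := Matrix.single (emptyTup n d) (emptyTup n d) p) (by
      ext a b
      simp [Matrix.single_apply, and_comm]) (by
      intro s t
      simp only [Matrix.single_apply]
      split_ifs
      · exact hp
      · simp)
  simpa only [h1] using h2

theorem integral_sq_planted_le {d m : ℕ} {lam R : ℝ}
    (hND : ∀ Q : Matrix (Tup n d) (Tup n d) (MvPolynomial (Idx n k) ℝ),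
      HasInstDegreeLE Q m → ¬ Distinguishes lam R Q)
    (p : MvPolynomial (Idx n k) ℝ) (hp : 2 * p.totalDegree ≤ m) :
    ∫ T, MvPolynomial.eval T p ^ 2 ∂(planted n k lam)
      ≤ R * ∫ T, MvPolynomial.eval T p ^ 2 ∂(unif n k) := by
  have h1 := integral_posPart_planted_le hND (p ^ 2) ((MvPolynomial.totalDegree_pow _ _).trans hp)
  have h2 : ∀ T : Tensor n k, max (MvPolynomial.eval T (p ^ 2)) 0 = MvPolynomial.eval T p ^ 2 := by
    intro T
    rw [map_pow, max_eq_left (sq_nonneg _)]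
  simpa only [h2] using h1

end Planted

/-! ### Functions of low degree on the cube of signs -/

section Walsh

variable {n : ℕ}

/-- The sign `± 1` of a bit. -/
def sgn (b : Bool) : ℝ := if b then 1 else -1

theorem sgn_mul_self (b : Bool) : sgn b * sgn b = 1 := by cases b <;> simp [sgn]

theorem abs_sgn (b : Bool) : |sgn b| = 1 := by cases b <;> simp [sgn]

/-- The Walsh characters. -/
def walsh (A : Finset (Fin n)) (s : Fin n → Bool) : ℝ := ∏ i ∈ A, sgn (s i)

theorem abs_walsh (A : Finset (Fin n)) (s : Fin n → Bool) : |walsh A s| = 1 := by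
  rw [walsh, Finset.abs_prod]
  exact Finset.prod_eq_one fun i _ => abs_sgn _

theorem walsh_eq (A : Finset (Fin n)) (s : Fin n → Bool) :
    walsh A s = ∏ i, if i ∈ A then sgn (s i) else 1 := by
  rw [walsh, Finset.prod_ite_mem, Finset.univ_inter]

theorem sum_walsh_mul_walsh (A B : Finset (Fin n)) :
    ∑ s, walsh A s * walsh B s = if A = B then (2 : ℝ) ^ n else 0 := by
  have h1 : ∀ s : Fin n → Bool, walsh A s * walsh B s
      = ∏ i, (if i ∈ A then sgn (s i) else 1) * (if i ∈ B then sgn (s i) else 1) := by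
    intro s
    rw [walsh_eq, walsh_eq, Finset.prod_mul_distrib]
  simp_rw [h1]
  rw [← Fintype.prod_sum (fun (i : Fin n) (b : Bool) =>
    (if i ∈ A then sgn b else 1) * (if i ∈ B then sgn b else 1))]
  split_ifs with h
  · subst h
    have : ∀ i : Fin n, ∑ b : Bool, (if i ∈ A then sgn b else 1) * (if i ∈ A then sgn b else 1)
        = (2 : ℝ) := by
      intro i
      split_ifs <;> norm_num [sgn_mul_self]
    rw [Finset.prod_congr rfl fun i _ => this i]
    simp
  · obtain ⟨i, hi⟩ : ∃ i, ¬ (i ∈ A ↔ i ∈ B) := by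
      by_contra hc
      push Not at hc
      exact h (Finset.ext hc)
    refine Finset.prod_eq_zero (Finset.mem_univ i) ?_
    by_cases hA : i ∈ A <;> by_cases hB : i ∈ B <;> simp_all [sgn]

/-- Functions on the cube of signs that are combinations of Walsh characters of degree at most
`m`. -/
def WalshDegLE (m : ℕ) (F : (Fin n → Bool) → ℝ) : Prop :=
  ∃ c : Finset (Fin n) → ℝ, (∀ A, m < A.card → c A = 0) ∧ ∀ s, F s = ∑ A, c A * walsh A s

theorem WalshDegLE.add {m : ℕ} {F G : (Fin n → Bool) → ℝ} (hF : WalshDegLE m F)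
    (hG : WalshDegLE m G) : WalshDegLE m (fun s => F s + G s) := by
  obtain ⟨c, hc, hc'⟩ := hF
  obtain ⟨e, he, he'⟩ := hG
  refine ⟨fun A => c A + e A, fun A hA => by simp [hc A hA, he A hA], fun s => ?_⟩
  simp only [hc' s, he' s, add_mul, Finset.sum_add_distrib]

theorem WalshDegLE.const_mul {m : ℕ} {F : (Fin n → Bool) → ℝ} (hF : WalshDegLE m F) (a : ℝ) :
    WalshDegLE m (fun s => a * F s) := by
  obtain ⟨c, hc, hc'⟩ := hF
  refine ⟨fun A => a * c A, fun A hA => by simp [hc A hA], fun s => ?_⟩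
  simp only [hc' s, mul_assoc, Finset.mul_sum]

theorem WalshDegLE.sum {m : ℕ} {κ : Type*} (S : Finset κ) {F : κ → (Fin n → Bool) → ℝ}
    (hF : ∀ i ∈ S, WalshDegLE m (F i)) : WalshDegLE m (fun s => ∑ i ∈ S, F i s) := by
  classical
  induction S using Finset.induction_on with
  | empty => exact ⟨fun _ => 0, fun _ _ => rfl, fun s => by simp⟩
  | insert a S ha ih =>
    simp_rw [Finset.sum_insert ha]
    exact (hF a (Finset.mem_insert_self _ _)).add
      (ih fun i hi => hF i (Finset.mem_insert_of_mem hi))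

theorem walshDegLE_const (m : ℕ) (a : ℝ) : WalshDegLE m (fun _ : Fin n → Bool => a) := by
  refine ⟨fun A => if A = ∅ then a else 0, fun A hA => if_neg ?_, fun s => ?_⟩
  · rintro rfl; simp at hA
  · simp [walsh]

theorem WalshDegLE.mono {m m' : ℕ} (h : m ≤ m') {F : (Fin n → Bool) → ℝ} (hF : WalshDegLE m F) :
    WalshDegLE m' F := by
  obtain ⟨c, hc, hc'⟩ := hF
  exact ⟨c, fun A hA => hc A (h.trans_lt hA), hc'⟩

theorem sgn_mul_walsh (i : Fin n) (A : Finset (Fin n)) (s : Fin n → Bool) :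
    sgn (s i) * walsh (symmDiff A {i}) s = walsh A s := by
  by_cases hi : i ∈ A
  · have : symmDiff A {i} = A.erase i := by
      ext j; simp only [Finset.mem_symmDiff, Finset.mem_singleton, Finset.mem_erase]
      by_cases hj : j = i <;> simp_all
    rw [this, walsh, walsh, Finset.mul_prod_erase A (fun j => sgn (s j)) hi]
  · have : symmDiff A {i} = insert i A := by
      ext j; simp only [Finset.mem_symmDiff, Finset.mem_singleton, Finset.mem_insert]
      by_cases hj : j = i <;> simp_all
    rw [this, walsh, walsh, Finset.prod_insert hi, ← mul_assoc, sgn_mul_self, one_mul]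

/-- Multiplication by the sign of `i` permutes the characters by `A ↦ A ∆ {i}`, which changes the
cardinality by one. -/
theorem WalshDegLE.sgn_mul {m : ℕ} {F : (Fin n → Bool) → ℝ} (hF : WalshDegLE m F) (i : Fin n) :
    WalshDegLE (m + 1) (fun s => sgn (s i) * F s) := by
  obtain ⟨c, hc, hc'⟩ := hF
  have hinv : Function.Involutive fun A : Finset (Fin n) => symmDiff A {i} := fun A => by
    simp only [symmDiff_assoc, symmDiff_self]
    exact symmDiff_bot A
  refine ⟨fun A => c (symmDiff A {i}), fun A hA => hc _ ?_, fun s => ?_⟩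
  · have : A.card ≤ (symmDiff A {i}).card + 1 := by
      have h1 : A ⊆ insert i (symmDiff A {i}) := by
        intro j hj
        by_cases hji : j = i
        · exact Finset.mem_insert.2 (Or.inl hji)
        · refine Finset.mem_insert_of_mem ?_
          rw [Finset.mem_symmDiff]
          left
          exact ⟨hj, by simpa using hji⟩
      exact (Finset.card_le_card h1).trans (Finset.card_insert_le _ _)
    omega
  · change sgn (s i) * F s = ∑ A, c (symmDiff A {i}) * walsh A s
    rw [hc' s, Finset.mul_sum]
    rw [← Equiv.sum_comp hinv.toPerm (fun A => sgn (s i) * (c A * walsh A s))]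
    refine Finset.sum_congr rfl fun A _ => ?_
    simp only [Function.Involutive.coe_toPerm]
    rw [mul_left_comm, sgn_mul_walsh]

theorem signVec_apply (s : Fin n → Bool) (i : Fin n) : signVec s i = (√n)⁻¹ * sgn (s i) := by
  simp [signVec, sgn, div_eq_inv_mul]

theorem walshDegLE_prod {m : ℕ} (t : Fin m → Fin n) :
    WalshDegLE m (fun s => ∏ j, signVec s (t j)) := by
  induction m with
  | zero => simpa using walshDegLE_const 0 1
  | succ m ih =>
    simp_rw [Fin.prod_univ_succ, signVec_apply, mul_assoc]
    refine WalshDegLE.const_mul ?_ _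
    have := (ih fun j => t j.succ).sgn_mul (t 0)
    simpa only [signVec_apply] using this

/-- A set with at most `m` elements is the range of a map from `Fin m`, with the value `none` used
as padding. -/
theorem card_small_finsets_le (n m : ℕ) :
    ((Finset.univ : Finset (Finset (Fin n))).filter fun A => A.card ≤ m).card ≤ (n + 1) ^ m := by
  classical
  have h1 : (Finset.univ : Finset (Fin m → Option (Fin n))).card = (n + 1) ^ m := by
    simp
  rw [← h1]
  refine Finset.card_le_card_of_surjOn
    (fun f => (Finset.univ.image f).eraseNone) ?_
  intro A hA
  simp only [Finset.coe_filter, Finset.mem_univ, true_and, Set.mem_ofPred_eq] at hA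
  refine ⟨fun j => if h : (j : ℕ) < A.card then some (A.equivFin.symm ⟨j, h⟩ : Fin n) else none,
    by simp, ?_⟩
  ext i
  simp only [Finset.mem_eraseNone, Finset.mem_image, Finset.mem_univ, true_and]
  constructor
  · rintro ⟨j, hj⟩
    split_ifs at hj with h
    simp only [Option.some.injEq] at hj
    rw [← hj]
    exact (A.equivFin.symm ⟨j, h⟩).2
  · intro hi
    refine ⟨⟨A.equivFin ⟨i, hi⟩, (A.equivFin ⟨i, hi⟩).2.trans_le hA⟩, ?_⟩
    simp

/-- A function of low degree on the cube of signs is bounded pointwise in terms of its mean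
square. -/
theorem WalshDegLE.sq_le {m : ℕ} {F : (Fin n → Bool) → ℝ} (hF : WalshDegLE m F)
    (s : Fin n → Bool) :
    F s ^ 2 ≤ ((n : ℝ) + 1) ^ m * (((2 : ℝ) ^ n)⁻¹ * ∑ s', F s' ^ 2) := by
  obtain ⟨c, hc, hc'⟩ := hF
  -- Parseval for the Walsh characters.
  have h1 : ((2 : ℝ) ^ n)⁻¹ * ∑ s', F s' ^ 2 = ∑ A, c A ^ 2 := by
    have h2 : ∀ s', F s' ^ 2 = ∑ A, ∑ B, (c A * c B) * (walsh A s' * walsh B s') := by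
      intro s'
      rw [hc' s', pow_two, Finset.sum_mul_sum]
      refine Finset.sum_congr rfl fun A _ => Finset.sum_congr rfl fun B _ => by ring
    simp_rw [h2]
    rw [Finset.sum_comm]
    simp_rw [Finset.sum_comm (s := (Finset.univ : Finset (Fin n → Bool))), ← Finset.mul_sum,
      sum_walsh_mul_walsh]
    simp only [mul_ite, mul_zero, Finset.sum_ite_eq, Finset.mem_univ, if_true]
    rw [← Finset.sum_mul, mul_comm, mul_assoc, mul_inv_cancel₀ (by positivity), mul_one]
    simp_rw [pow_two]
  rw [h1]
  set L := (Finset.univ : Finset (Finset (Fin n))).filter fun A => A.card ≤ m with hL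
  have h3 : ∀ f : Finset (Fin n) → ℝ, (∀ A, c A = 0 → f A = 0) → ∑ A, f A = ∑ A ∈ L, f A := by
    intro f hf
    refine (Finset.sum_subset (Finset.subset_univ _) fun A _ hA => hf A (hc A ?_)).symm
    simpa [hL] using hA
  rw [hc' s, h3 _ fun A hA => by simp [hA], h3 _ fun A hA => by simp [hA]]
  -- Cauchy–Schwarz over the few characters of low degree, each of absolute value one.
  have h4 : (∑ A ∈ L, c A * walsh A s) ^ 2 ≤ (L.card : ℝ) * ∑ A ∈ L, (c A * walsh A s) ^ 2 :=
    sq_sum_le_card_mul_sum_sq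
  refine h4.trans ?_
  have h5 : ∀ A, (c A * walsh A s) ^ 2 = c A ^ 2 := by
    intro A; rw [mul_pow, ← sq_abs (walsh A s), abs_walsh]; ring
  simp_rw [h5]
  refine mul_le_mul_of_nonneg_right ?_ (Finset.sum_nonneg fun A _ => sq_nonneg _)
  exact_mod_cast card_small_finsets_le n m

end Walsh

/-! ### Monomial vectors -/

section Monomials

variable {n d k : ℕ}

/-- The vector `x^{≤ d}`. -/
def mvec (d : ℕ) (x : Fin n → ℝ) : Tup n d → ℝ := fun t => ∏ j, x (t.2 j)

theorem eval_tupMonomial (x : Fin n → ℝ) (t : Tup n d) :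
    MvPolynomial.eval x (tupMonomial t) = mvec d x t := by
  simp [tupMonomial, mvec, map_prod]

theorem eval_gramPoly (A : Matrix (Tup n d) (Tup n d) ℝ) (x : Fin n → ℝ) :
    MvPolynomial.eval x (gramPoly A) = quad A (mvec d x) := by
  simp [gramPoly, quad, map_sum, eval_tupMonomial]

theorem eval_objPoly (obj : ℝ) (T : Tensor n k) (x : Fin n → ℝ) :
    MvPolynomial.eval x (objPoly obj T) = (∑ a, T a * tensorPow k x a) - obj := by
  simp [objPoly, tensorPow, map_sum, map_prod]

theorem eval_spherePoly (x : Fin n → ℝ) :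
    MvPolynomial.eval x (spherePoly n) = (∑ i, x i ^ 2) - 1 := by
  simp [spherePoly, map_sum, map_pow]

theorem sum_prod_sq (m : ℕ) (x : Fin n → ℝ) :
    ∑ t : Fin m → Fin n, (∏ j, x (t j)) ^ 2 = (∑ i, x i ^ 2) ^ m := by
  rw [Fintype.sum_pow]
  simp_rw [Finset.prod_pow]

theorem sum_tensorPow_sq {x : Fin n → ℝ} (hx : ∑ i, x i ^ 2 = 1) :
    ∑ a, tensorPow k x a ^ 2 = 1 := by
  simp only [tensorPow]
  rw [sum_prod_sq, hx, one_pow]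

theorem sum_mvec_sq {x : Fin n → ℝ} (hx : ∑ i, x i ^ 2 = 1) :
    ∑ t, mvec d x t ^ 2 = d + 1 := by
  rw [Fintype.sum_sigma]
  simp only [mvec]
  simp_rw [sum_prod_sq, hx, one_pow]
  simp

theorem sum_signVec_sq (hn : 0 < n) (s : Fin n → Bool) : ∑ i, signVec s i ^ 2 = 1 := by
  have : ∀ i, signVec s i ^ 2 = (n : ℝ)⁻¹ := by
    intro i
    rw [signVec_apply, mul_pow, pow_two (sgn _), sgn_mul_self, inv_pow,
      Real.sq_sqrt (Nat.cast_nonneg n), mul_one]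
  simp_rw [this]
  have : (n : ℝ) ≠ 0 := by positivity
  simp [this]

theorem walshDegLE_quad (C : Matrix (Tup n d) (Tup n d) ℝ) :
    WalshDegLE (2 * d) (fun s => quad C (mvec d (signVec s))) := by
  refine WalshDegLE.sum _ fun t _ => WalshDegLE.sum _ fun t' _ => WalshDegLE.const_mul ?_ _
  have h := walshDegLE_prod (Fin.append t.2 t'.2)
  simp only [mvec]
  simp_rw [Fin.prod_univ_add, Fin.append_left, Fin.append_right] at h
  refine h.mono ?_
  have := t.1.2
  have := t'.1.2
  omega

theorem walshDegLE_tensor (hk : k ≤ 2 * d) (β : Tensor n k) :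
    WalshDegLE (2 * d) (fun s => ∑ a, β a * tensorPow k (signVec s) a) :=
  WalshDegLE.sum _ fun a _ => ((walshDegLE_prod a).mono hk).const_mul _

theorem abs_sum_mul_tensorPow_le {x : Fin n → ℝ} (hx : ∑ i, x i ^ 2 = 1) (T : Tensor n k) :
    |∑ a, T a * tensorPow k x a| ≤ √(∑ a, T a ^ 2) := by
  refine Real.abs_le_sqrt ?_
  refine (Finset.sum_mul_sq_le_sq_mul_sq _ _ _).trans ?_
  rw [sum_tensorPow_sq hx, mul_one]

end Monomials

/-! ### Flattening tensors into matrices -/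

section Flatten

variable {n d k₁ k₂ : ℕ}

/-- The first `k₁` positions of an index, as a tuple. -/
def tupL (h₁ : k₁ ≤ d) (a : Idx n (k₁ + k₂)) : Tup n d :=
  ⟨⟨k₁, Nat.lt_succ_of_le h₁⟩, fun j => a (Fin.castAdd k₂ j)⟩

/-- The last `k₂` positions of an index, as a tuple. -/
def tupR (h₂ : k₂ ≤ d) (a : Idx n (k₁ + k₂)) : Tup n d :=
  ⟨⟨k₂, Nat.lt_succ_of_le h₂⟩, fun j => a (Fin.natAdd k₁ j)⟩

theorem mvec_tupL_mul_tupR (h₁ : k₁ ≤ d) (h₂ : k₂ ≤ d) (x : Fin n → ℝ) (a : Idx n (k₁ + k₂)) :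
    mvec d x (tupL h₁ a) * mvec d x (tupR h₂ a) = tensorPow (k₁ + k₂) x a := by
  simp only [mvec, tupL, tupR, tensorPow]
  rw [Fin.prod_univ_add]
  rfl

/-- The weight of a tuple: half the number of the two flattening lengths that it has. -/
def lenWt (k₁ k₂ : ℕ) (t : Tup n d) : ℝ :=
  ((if (t.1 : ℕ) = k₁ then 1 else 0) + (if (t.1 : ℕ) = k₂ then 1 else 0)) / 2

theorem lenWt_nonneg (t : Tup n d) : 0 ≤ lenWt k₁ k₂ t := by
  unfold lenWt; split_ifs <;> norm_num

theorem lenWt_le_one (t : Tup n d) : lenWt k₁ k₂ t ≤ 1 := by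
  unfold lenWt; split_ifs <;> norm_num

theorem sum_level (m : ℕ) (hm : m ≤ d) (f : Tup n d → ℝ) :
    ∑ t : Tup n d, (if (t.1 : ℕ) = m then f t else 0)
      = ∑ u : Fin m → Fin n, f ⟨⟨m, Nat.lt_succ_of_le hm⟩, u⟩ := by
  rw [Fintype.sum_sigma, Finset.sum_eq_single (⟨m, Nat.lt_succ_of_le hm⟩ : Fin (d + 1))]
  · simp
  · intro b _ hb
    refine Finset.sum_eq_zero fun u _ => if_neg ?_
    intro h
    exact hb (Fin.ext h)
  · simp

theorem sum_lenWt_mul_sq (h₁ : k₁ ≤ d) (h₂ : k₂ ≤ d) (z : Tup n d → ℝ) :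
    ∑ t, lenWt k₁ k₂ t * z t ^ 2
      = ((∑ u : Fin k₁ → Fin n, z ⟨⟨k₁, Nat.lt_succ_of_le h₁⟩, u⟩ ^ 2)
        + ∑ u : Fin k₂ → Fin n, z ⟨⟨k₂, Nat.lt_succ_of_le h₂⟩, u⟩ ^ 2) / 2 := by
  rw [← sum_level k₁ h₁ (fun t => z t ^ 2), ← sum_level k₂ h₂ (fun t => z t ^ 2),
    ← Finset.sum_add_distrib, Finset.sum_div]
  refine Finset.sum_congr rfl fun t _ => ?_
  unfold lenWt
  split_ifs <;> ring

theorem sum_lenWt_mvec (h₁ : k₁ ≤ d) (h₂ : k₂ ≤ d) {x : Fin n → ℝ} (hx : ∑ i, x i ^ 2 = 1) :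
    ∑ t : Tup n d, lenWt k₁ k₂ t * mvec d x t ^ 2 = 1 := by
  rw [sum_lenWt_mul_sq h₁ h₂]
  simp only [mvec]
  simp [sum_prod_sq, hx]

/-- The left side is the product of the norms of the slices of `z` of lengths `k₁` and `k₂`, so this
is the arithmetic–geometric mean inequality. It is the reason for the weights `lenWt`: they dominate
the flattening and yet sum to one on `x^{≤ d}`. -/
theorem sum_flatten_sq (h₁ : k₁ ≤ d) (h₂ : k₂ ≤ d) (z : Tup n d → ℝ) :
    √(∑ a : Idx n (k₁ + k₂), (z (tupL h₁ a) * z (tupR h₂ a)) ^ 2)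
      ≤ ∑ t, lenWt k₁ k₂ t * z t ^ 2 := by
  have h3 : ∑ a : Idx n (k₁ + k₂), (z (tupL h₁ a) * z (tupR h₂ a)) ^ 2
      = (∑ u : Fin k₁ → Fin n, z ⟨⟨k₁, Nat.lt_succ_of_le h₁⟩, u⟩ ^ 2)
        * ∑ u : Fin k₂ → Fin n, z ⟨⟨k₂, Nat.lt_succ_of_le h₂⟩, u⟩ ^ 2 := by
    rw [Finset.sum_mul_sum, ← Fintype.sum_prod_type',
      ← Equiv.sum_comp (Fin.appendEquiv k₁ k₂)]
    refine Finset.sum_congr rfl fun p _ => ?_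
    have e1 : tupL h₁ (Fin.appendEquiv k₁ k₂ p) = (⟨⟨k₁, Nat.lt_succ_of_le h₁⟩, p.1⟩ : Tup n d) := by
      simp [tupL, Fin.appendEquiv]
    have e2 : tupR h₂ (Fin.appendEquiv k₁ k₂ p) = (⟨⟨k₂, Nat.lt_succ_of_le h₂⟩, p.2⟩ : Tup n d) := by
      simp [tupR, Fin.appendEquiv]
    rw [e1, e2, mul_pow]
  rw [h3, sum_lenWt_mul_sq h₁ h₂]
  set p := ∑ u : Fin k₁ → Fin n, z ⟨⟨k₁, Nat.lt_succ_of_le h₁⟩, u⟩ ^ 2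
  set q := ∑ u : Fin k₂ → Fin n, z ⟨⟨k₂, Nat.lt_succ_of_le h₂⟩, u⟩ ^ 2
  have hp : 0 ≤ p := Finset.sum_nonneg fun _ _ => sq_nonneg _
  have hq : 0 ≤ q := Finset.sum_nonneg fun _ _ => sq_nonneg _
  refine Real.sqrt_le_iff.2 ⟨by positivity, ?_⟩
  nlinarith [sq_nonneg (p - q)]

/-- The coefficient of the tensor entry `a` in the symmetrised flattening. -/
def flatCoeff (h₁ : k₁ ≤ d) (h₂ : k₂ ≤ d) (a : Idx n (k₁ + k₂)) (s t : Tup n d) : ℝ :=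
  ((if tupL h₁ a = s ∧ tupR h₂ a = t then 1 else 0)
    + (if tupR h₂ a = s ∧ tupL h₁ a = t then 1 else 0)) / 2

theorem flatCoeff_comm (h₁ : k₁ ≤ d) (h₂ : k₂ ≤ d) (a : Idx n (k₁ + k₂)) (s t : Tup n d) :
    flatCoeff h₁ h₂ a s t = flatCoeff h₁ h₂ a t s := by
  unfold flatCoeff
  rw [add_comm]
  simp only [and_comm]

theorem flatCoeff_nonneg (h₁ : k₁ ≤ d) (h₂ : k₂ ≤ d) (a : Idx n (k₁ + k₂)) (s t : Tup n d) :
    0 ≤ flatCoeff h₁ h₂ a s t := by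
  unfold flatCoeff; split_ifs <;> norm_num

theorem sum_flatCoeff_mul (h₁ : k₁ ≤ d) (h₂ : k₂ ≤ d) (a : Idx n (k₁ + k₂)) (z : Tup n d → ℝ) :
    ∑ s, ∑ t, flatCoeff h₁ h₂ a s t * (z s * z t) = z (tupL h₁ a) * z (tupR h₂ a) := by
  have h : ∀ u w : Tup n d, ∑ s, ∑ t, (if u = s ∧ w = t then (1 : ℝ) else 0) * (z s * z t)
      = z u * z w := by
    intro u w
    rw [Finset.sum_eq_single u, Finset.sum_eq_single w]
    · simp
    · intro b _ hb; simp [hb.symm]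
    · simp
    · intro b _ hb; simp [hb.symm]
    · simp
  have h3 : ∀ s t, flatCoeff h₁ h₂ a s t * (z s * z t)
      = ((if tupL h₁ a = s ∧ tupR h₂ a = t then (1 : ℝ) else 0) * (z s * z t)
        + (if tupR h₂ a = s ∧ tupL h₁ a = t then (1 : ℝ) else 0) * (z s * z t)) / 2 := by
    intro s t; unfold flatCoeff; ring
  simp_rw [h3, ← Finset.sum_div, Finset.sum_add_distrib, h]
  ring

/-- The matrix `A + κ b W + Fl(β)`, with `W` the diagonal matrix of weights. -/
def combine (h₁ : k₁ ≤ d) (h₂ : k₂ ≤ d) (κ : ℝ) (A : Matrix (Tup n d) (Tup n d) ℝ) (b : ℝ)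
    (β : Tensor n (k₁ + k₂)) : Matrix (Tup n d) (Tup n d) ℝ :=
  fun s t => A s t + κ * (if s = t then lenWt k₁ k₂ s else 0) * b
    + ∑ a, flatCoeff h₁ h₂ a s t * β a

theorem combine_isSymm (h₁ : k₁ ≤ d) (h₂ : k₂ ≤ d) (κ : ℝ) {A : Matrix (Tup n d) (Tup n d) ℝ}
    (hA : A.IsSymm) (b : ℝ) (β : Tensor n (k₁ + k₂)) : (combine h₁ h₂ κ A b β).IsSymm := by
  ext s t
  simp only [Matrix.transpose_apply, combine]
  rw [hA.apply]
  simp_rw [flatCoeff_comm h₁ h₂ _ s t]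
  congr 3
  by_cases h : s = t
  · subst h; rfl
  · rw [if_neg h, if_neg (Ne.symm h)]

theorem quad_combine (h₁ : k₁ ≤ d) (h₂ : k₂ ≤ d) (κ : ℝ) (A : Matrix (Tup n d) (Tup n d) ℝ)
    (b : ℝ) (β : Tensor n (k₁ + k₂)) (z : Tup n d → ℝ) :
    quad (combine h₁ h₂ κ A b β) z = quad A z + κ * b * ∑ t, lenWt k₁ k₂ t * z t ^ 2
      + ∑ a, β a * (z (tupL h₁ a) * z (tupR h₂ a)) := by
  simp only [quad, combine, add_mul, Finset.sum_add_distrib]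
  congr 1
  · congr 1
    rw [Finset.mul_sum]
    refine Finset.sum_congr rfl fun s _ => ?_
    rw [Finset.sum_eq_single s]
    · simp; ring
    · intro t _ ht; simp [ht.symm]
    · simp
  · simp_rw [← sum_flatCoeff_mul h₁ h₂ _ z, Finset.mul_sum, Finset.sum_mul]
    rw [Finset.sum_congr rfl fun s _ => Finset.sum_comm, Finset.sum_comm]
    exact Finset.sum_congr rfl fun a _ => Finset.sum_congr rfl fun s _ =>
      Finset.sum_congr rfl fun t _ => by ring

/-- Each tensor entry enters the symmetrised flattening with total weight one, so errors in `β` are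
not amplified. -/
theorem sum_abs_combine_sub_le (h₁ : k₁ ≤ d) (h₂ : k₂ ≤ d) {κ : ℝ} (hκ : 0 ≤ κ)
    (A A' : Matrix (Tup n d) (Tup n d) ℝ) (b b' : ℝ) (β β' : Tensor n (k₁ + k₂)) :
    ∑ s, ∑ t, |combine h₁ h₂ κ A b β s t - combine h₁ h₂ κ A' b' β' s t|
      ≤ (∑ s, ∑ t, |A s t - A' s t|) + κ * Fintype.card (Tup n d) * |b - b'|
        + ∑ a, |β a - β' a| := by
  have hfl : ∀ a : Idx n (k₁ + k₂), ∑ s : Tup n d, ∑ t, flatCoeff h₁ h₂ a s t = 1 := by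
    intro a
    simpa using sum_flatCoeff_mul h₁ h₂ a (fun _ : Tup n d => 1)
  have hpt : ∀ s t, |combine h₁ h₂ κ A b β s t - combine h₁ h₂ κ A' b' β' s t|
      ≤ |A s t - A' s t| + κ * (if s = t then 1 else 0) * |b - b'|
        + ∑ a, flatCoeff h₁ h₂ a s t * |β a - β' a| := by
    intro s t
    have e : combine h₁ h₂ κ A b β s t - combine h₁ h₂ κ A' b' β' s t
        = (A s t - A' s t) + κ * (if s = t then lenWt k₁ k₂ s else 0) * (b - b')
          + ∑ a, flatCoeff h₁ h₂ a s t * (β a - β' a) := by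
      simp only [combine, mul_sub, Finset.sum_sub_distrib]; ring
    rw [e]
    refine (abs_add_le _ _).trans (add_le_add ((abs_add_le _ _).trans (add_le_add le_rfl ?_)) ?_)
    · rw [abs_mul, abs_mul, abs_of_nonneg hκ]
      refine mul_le_mul_of_nonneg_right (mul_le_mul_of_nonneg_left ?_ hκ) (abs_nonneg _)
      split_ifs
      · rw [abs_of_nonneg (lenWt_nonneg s)]; exact lenWt_le_one s
      · simp
    · refine (Finset.abs_sum_le_sum_abs _ _).trans (Finset.sum_le_sum fun a _ => ?_)
      rw [abs_mul, abs_of_nonneg (flatCoeff_nonneg h₁ h₂ a s t)]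
  refine (Finset.sum_le_sum fun s _ => Finset.sum_le_sum fun t _ => hpt s t).trans ?_
  simp only [Finset.sum_add_distrib]
  refine add_le_add (add_le_add le_rfl ?_) ?_
  · simp only [mul_ite, mul_one, mul_zero, ite_mul, zero_mul, Finset.sum_ite_eq, Finset.mem_univ,
      if_true, Finset.sum_const, Finset.card_univ, nsmul_eq_mul]
    exact le_of_eq (by ring)
  · rw [Finset.sum_congr rfl fun s _ => Finset.sum_comm, Finset.sum_comm]
    refine Finset.sum_le_sum fun a _ => ?_
    simp_rw [← Finset.sum_mul]
    rw [hfl, one_mul]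

end Flatten

/-! ### Averages of bounded functions under the Ornstein–Uhlenbeck operator -/

section Level

variable {ι : Type} [Fintype ι] {ρ σ : ℝ}

theorem posPart_le_exp {κ u : ℝ} (hκ : 1 ≤ κ) : max u 0 ≤ Real.exp (κ * u) := by
  rcases le_total u 0 with h | h
  · rw [max_eq_right h]; exact (Real.exp_pos _).le
  · rw [max_eq_left h]
    calc u ≤ u + 1 := by linarith
      _ ≤ Real.exp u := Real.add_one_le_exp u
      _ ≤ _ := Real.exp_le_exp.2 (by nlinarith)

/-- The exponent tilts by exactly `κ`, the optimal Chernoff parameter for a unit Gaussian exceeding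
`κ`. -/
theorem integral_exp_linear_sub_le {κ : ℝ} {w : ι → ℝ} (hw : ∑ a, w a ^ 2 ≤ 1) :
    ∫ G, Real.exp (κ * (∑ a, w a * G a - κ)) ∂(stdG ι) ≤ Real.exp (-(κ ^ 2 / 2)) := by
  have h : ∀ G : ι → ℝ, Real.exp (κ * (∑ a, w a * G a - κ))
      = Real.exp (-κ ^ 2) * Real.exp (∑ a, (κ * w a) * G a) := by
    intro G
    rw [← Real.exp_add]
    congr 1
    simp_rw [mul_assoc]
    rw [← Finset.mul_sum]; ring
  simp_rw [h]
  rw [integral_const_mul, integral_exp_linear, ← Real.exp_add]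
  refine Real.exp_le_exp.2 ?_
  simp_rw [mul_pow]
  rw [← Finset.mul_sum]
  nlinarith [sq_nonneg κ]

theorem integrable_exp_linear_sub (κ : ℝ) (w : ι → ℝ) :
    Integrable (fun G => Real.exp (κ * (∑ a, w a * G a - κ))) (stdG ι) := by
  have h : ∀ G : ι → ℝ, Real.exp (κ * (∑ a, w a * G a - κ))
      = Real.exp (-κ ^ 2) * Real.exp (∑ a, (κ * w a) * G a) := by
    intro G
    rw [← Real.exp_add]
    congr 1
    simp_rw [mul_assoc]
    rw [← Finset.mul_sum]; ring
  simp_rw [h]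
  exact (integrable_exp_linear _).const_mul _

theorem integrable_coord (a : ι) : Integrable (fun G : ι → ℝ => G a) (stdG ι) := by
  simpa using integrable_mvEval (MvPolynomial.X a : MvPolynomial ι ℝ)

theorem integrable_linear (w : ι → ℝ) : Integrable (fun G : ι → ℝ => ∑ a, w a * G a) (stdG ι) :=
  integrable_finsetSum _ fun a _ => (integrable_coord a).const_mul _

/-- The degree-one Gaussian coefficients of a bounded nonnegative function. -/
theorem integral_mul_linear_le {g : (ι → ℝ) → ℝ} (hg : Measurable g) {Bd κ : ℝ} (hκ : 1 ≤ κ)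
    (h0 : ∀ G, 0 ≤ g G) (hB : ∀ G, g G ≤ Bd) (w : ι → ℝ) :
    ∫ G, g G * ∑ a, w a * G a ∂(stdG ι)
      ≤ (κ * ∫ G, g G ∂(stdG ι) + Bd * Real.exp (-(κ ^ 2 / 2))) * √(∑ a, w a ^ 2) := by
  have hBd : 0 ≤ Bd := (h0 0).trans (hB 0)
  have hgi : Integrable g (stdG ι) := Integrable.mono' (integrable_const Bd) hg.aestronglyMeasurable
    (Filter.Eventually.of_forall fun G => by rw [Real.norm_of_nonneg (h0 G)]; exact hB G)
  have hgl : ∀ w : ι → ℝ, Integrable (fun G => g G * ∑ a, w a * G a) (stdG ι) := fun w =>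
    (integrable_linear w).bdd_mul (c := Bd) hg.aestronglyMeasurable
      (Filter.Eventually.of_forall fun G => by rw [Real.norm_of_nonneg (h0 G)]; exact hB G)
  -- For a linear form `ℓ` of norm at most one, `g ℓ ≤ κ g + Bd (ℓ - κ)⁺`: below the level `κ` the
  -- mean of `g` is used, above it the Gaussian tail. The general case follows by scaling.
  have unit : ∀ w : ι → ℝ, ∑ a, w a ^ 2 ≤ 1 → ∫ G, g G * ∑ a, w a * G a ∂(stdG ι)
      ≤ κ * ∫ G, g G ∂(stdG ι) + Bd * Real.exp (-(κ ^ 2 / 2)) := by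
    intro w hw
    calc ∫ G, g G * ∑ a, w a * G a ∂(stdG ι)
        ≤ ∫ G, (κ * g G + Bd * Real.exp (κ * (∑ a, w a * G a - κ))) ∂(stdG ι) := by
          refine integral_mono (hgl w) ((hgi.const_mul κ).add
            ((integrable_exp_linear_sub κ w).const_mul Bd)) fun G => ?_
          have h1 : ∑ a, w a * G a - κ ≤ max (∑ a, w a * G a - κ) 0 := le_max_left _ _
          have h2 := posPart_le_exp (u := ∑ a, w a * G a - κ) hκ
          have h3 : 0 ≤ max (∑ a, w a * G a - κ) 0 := le_max_right _ _
          have h4 : g G * (∑ a, w a * G a - κ) ≤ Bd * Real.exp (κ * (∑ a, w a * G a - κ)) :=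
            calc g G * (∑ a, w a * G a - κ) ≤ g G * max (∑ a, w a * G a - κ) 0 :=
                  mul_le_mul_of_nonneg_left h1 (h0 G)
              _ ≤ Bd * max (∑ a, w a * G a - κ) 0 := mul_le_mul_of_nonneg_right (hB G) h3
              _ ≤ _ := mul_le_mul_of_nonneg_left h2 hBd
          simp only
          linarith
      _ = κ * ∫ G, g G ∂(stdG ι)
          + Bd * ∫ G, Real.exp (κ * (∑ a, w a * G a - κ)) ∂(stdG ι) := by
          rw [integral_add (hgi.const_mul κ) ((integrable_exp_linear_sub κ w).const_mul Bd),
            integral_const_mul, integral_const_mul]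
      _ ≤ _ := add_le_add le_rfl (mul_le_mul_of_nonneg_left (integral_exp_linear_sub_le hw) hBd)
  rcases (Real.sqrt_nonneg (∑ a, w a ^ 2)).eq_or_lt with h | h
  · have hs : ∑ a, w a ^ 2 = 0 := by
      rwa [eq_comm, Real.sqrt_eq_zero (Finset.sum_nonneg fun a _ => sq_nonneg _)] at h
    have hw : ∀ a, w a = 0 := by
      intro a
      have := (Finset.sum_eq_zero_iff_of_nonneg fun a _ => sq_nonneg (w a)).1 hs a
        (Finset.mem_univ a)
      simpa using this
    simp [hw]
  · set N := √(∑ a, w a ^ 2) with hN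
    have h1 := unit (fun a => w a / N) (by
      simp_rw [div_pow]
      rw [← Finset.sum_div, hN, Real.sq_sqrt (Finset.sum_nonneg fun a _ => sq_nonneg _)]
      exact div_self_le_one _)
    have h2 : ∀ G : ι → ℝ, g G * ∑ a, w a * G a = N * (g G * ∑ a, w a / N * G a) := by
      intro G
      have : ∑ a, w a / N * G a = (∑ a, w a * G a) / N := by
        rw [Finset.sum_div]; exact Finset.sum_congr rfl fun a _ => by ring
      rw [this]; field_simp
    simp_rw [h2]
    rw [integral_const_mul, mul_comm]
    exact mul_le_mul_of_nonneg_right h1 h.le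

end Level

/-! ### The spectral matrix `Q` and its top eigenvalue under the null. -/

section NullSide

variable {n d k₁ k₂ D : ℕ} {ρ σ κ Bd : ℝ}
  {A : Tensor n (k₁ + k₂) → Matrix (Tup n d) (Tup n d) ℝ} {b : Tensor n (k₁ + k₂) → ℝ}

theorem memLp_of_abs_le {ι : Type} [Fintype ι] {f : (ι → ℝ) → ℝ} (hf : Measurable f) {c : ℝ}
    (h : ∀ T, |f T| ≤ c) : MemLp f 2 (stdG ι) :=
  MemLp.of_bound hf.aestronglyMeasurable c (Filter.Eventually.of_forall h)

theorem l2_le_of_abs_le {ι : Type} [Fintype ι] {f : (ι → ℝ) → ℝ} {c : ℝ}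
    (h : ∀ T, |f T| ≤ c) : l2 (stdG ι) f ≤ c := by
  have hc : 0 ≤ c := (abs_nonneg _).trans (h 0)
  have := l2_mono (μ := stdG ι) (memLp_const c) h
  rwa [l2_const, abs_of_nonneg hc] at this

theorem memLp_coord {ι : Type} [Fintype ι] (a : ι) :
    MemLp (fun T : ι → ℝ => T a) 2 (stdG ι) := by
  simpa using memLp_mvEval (MvPolynomial.X a : MvPolynomial ι ℝ)

theorem l2_coord {ι : Type} [Fintype ι] (a : ι) : l2 (stdG ι) (fun T : ι → ℝ => T a) = 1 := by
  have h : ∫ T : ι → ℝ, T a ^ 2 ∂(stdG ι) = 1 := by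
    rw [integral_comp_eval (μ := fun _ : ι => gaussianReal 0 1) (i := a) (f := fun x : ℝ => x ^ 2)
      (by fun_prop)]
    have := integral_He_mul_He 1 1
    simp only [He_succ, He_zero] at this
    simpa [pow_two] using this
  rw [l2, h, Real.sqrt_one]

theorem memLp_mul_coord {ι : Type} [Fintype ι] {f : (ι → ℝ) → ℝ} (hf : Measurable f) {c : ℝ}
    (h : ∀ T, |f T| ≤ c) (a : ι) : MemLp (fun T => f T * T a) 2 (stdG ι) := by
  refine ((memLp_coord a).const_mul c).mono (by fun_prop)
    (Filter.Eventually.of_forall fun T => ?_)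
  have hc : 0 ≤ c := (abs_nonneg _).trans (h 0)
  rw [Real.norm_eq_abs, Real.norm_eq_abs, abs_mul, abs_mul, abs_of_nonneg hc]
  exact mul_le_mul_of_nonneg_right (h T) (abs_nonneg _)

theorem l2_mul_coord_le {ι : Type} [Fintype ι] {f : (ι → ℝ) → ℝ} {c : ℝ}
    (h : ∀ T, |f T| ≤ c) (a : ι) : l2 (stdG ι) (fun T => f T * T a) ≤ c := by
  have hc : 0 ≤ c := (abs_nonneg _).trans (h 0)
  have := l2_mono (μ := stdG ι) (f := fun T => f T * T a) ((memLp_coord a).abs.const_mul c)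
    (fun T => by
      simp only [Pi.abs_apply]
      rw [abs_mul]; exact mul_le_mul_of_nonneg_right (h T) (abs_nonneg _))
  refine this.trans (le_of_eq ?_)
  simp only [Pi.abs_apply]
  rw [l2_const_mul, l2_abs, l2_coord, abs_of_nonneg hc, mul_one]

/-- The low-degree part of the cross terms. -/
def lowCross (ρ : ℝ) (D : ℕ) (b : Tensor n (k₁ + k₂) → ℝ) (a : Idx n (k₁ + k₂)) :
    MvPolynomial (Idx n (k₁ + k₂)) ℝ :=
  lowOU ρ D (fun T => b T * T a) - MvPolynomial.C ρ * MvPolynomial.X a * lowOU ρ D b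

/-- The cross terms themselves. -/
def cross (ρ σ : ℝ) (b : Tensor n (k₁ + k₂) → ℝ) (T : Tensor n (k₁ + k₂)) :
    Tensor n (k₁ + k₂) :=
  fun a => ouU ρ σ (fun T => b T * T a) T - ρ * T a * ouU ρ σ b T

/-- The entrywise average of a matrix-valued function. -/
def ouMat (ρ σ : ℝ) (A : Tensor n (k₁ + k₂) → Matrix (Tup n d) (Tup n d) ℝ)
    (T : Tensor n (k₁ + k₂)) : Matrix (Tup n d) (Tup n d) ℝ :=
  Matrix.of fun s t => ouU ρ σ (fun T => A T s t) T

/-- The entrywise low-degree part of a matrix-valued function. -/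
def lowMat (ρ : ℝ) (D : ℕ) (A : Tensor n (k₁ + k₂) → Matrix (Tup n d) (Tup n d) ℝ)
    (T : Tensor n (k₁ + k₂)) : Matrix (Tup n d) (Tup n d) ℝ :=
  Matrix.of fun s t => MvPolynomial.eval T (lowOU ρ D (fun T => A T s t))

theorem ouMat_isSymm (hA : ∀ T, (A T).IsSymm) (T : Tensor n (k₁ + k₂)) :
    (ouMat ρ σ A T).IsSymm :=
  Matrix.IsSymm.ext fun s t => by
    simp only [ouMat, Matrix.of_apply]
    simp_rw [fun T => (hA T).apply s t]

theorem lowMat_isSymm (hA : ∀ T, (A T).IsSymm) (T : Tensor n (k₁ + k₂)) :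
    (lowMat ρ D A T).IsSymm :=
  Matrix.IsSymm.ext fun s t => by
    simp only [lowMat, Matrix.of_apply]
    simp_rw [fun T => (hA T).apply s t]

/-- The low-degree matrix of polynomials built from matrices `A(T)` and numbers `b(T)`. -/
def lowQ (h₁ : k₁ ≤ d) (h₂ : k₂ ≤ d) (ρ κ : ℝ) (D : ℕ)
    (A : Tensor n (k₁ + k₂) → Matrix (Tup n d) (Tup n d) ℝ) (b : Tensor n (k₁ + k₂) → ℝ) :
    Matrix (Tup n d) (Tup n d) (MvPolynomial (Idx n (k₁ + k₂)) ℝ) :=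
  fun s t => -(lowOU ρ D (fun T => A T s t)
    + MvPolynomial.C (κ * (if s = t then lenWt k₁ k₂ s else 0)) * lowOU ρ D b
    + ∑ a, MvPolynomial.C (flatCoeff h₁ h₂ a s t) * lowCross ρ D b a)

theorem lowQ_map_eval (h₁ : k₁ ≤ d) (h₂ : k₂ ≤ d) (T : Tensor n (k₁ + k₂)) :
    (lowQ h₁ h₂ ρ κ D A b).map (MvPolynomial.eval T)
      = -combine h₁ h₂ κ (lowMat ρ D A T)
        (MvPolynomial.eval T (lowOU ρ D b)) (fun a => MvPolynomial.eval T (lowCross ρ D b a)) := by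
  ext s t
  simp only [Matrix.map_apply, lowQ, Matrix.neg_apply, combine, lowMat, Matrix.of_apply, map_neg, map_add, map_sum,
    MvPolynomial.eval_mul, MvPolynomial.eval_C]

theorem lowQ_isSymm (h₁ : k₁ ≤ d) (h₂ : k₂ ≤ d) (hA : ∀ T, (A T).IsSymm) :
    (lowQ h₁ h₂ ρ κ D A b).IsSymm := by
  ext s t : 1
  simp only [Matrix.transpose_apply, lowQ]
  simp_rw [fun T => (hA T).apply s t, flatCoeff_comm h₁ h₂ _ s t]
  congr 3
  by_cases h : s = t
  · subst h; rfl
  · rw [if_neg h, if_neg (Ne.symm h)]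

theorem totalDegree_C_mul_le {ι : Type} (c : ℝ) (p : MvPolynomial ι ℝ) :
    (MvPolynomial.C c * p).totalDegree ≤ p.totalDegree := by
  rw [← MvPolynomial.smul_eq_C_mul]
  exact MvPolynomial.totalDegree_smul_le _ _

theorem totalDegree_lowCross (hD : 1 ≤ D) (a : Idx n (k₁ + k₂)) :
    (lowCross ρ D b a).totalDegree ≤ D := by
  refine (MvPolynomial.totalDegree_sub _ _).trans (max_le ?_ ?_)
  · exact (totalDegree_lowOU _ _).trans (Nat.sub_le _ _)
  · rw [mul_assoc]
    refine (totalDegree_C_mul_le _ _).trans ((MvPolynomial.totalDegree_mul _ _).trans ?_)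
    rw [MvPolynomial.totalDegree_X]
    have := totalDegree_lowOU (ρ := ρ) D b
    omega

theorem totalDegree_lowQ (h₁ : k₁ ≤ d) (h₂ : k₂ ≤ d) (hD : 1 ≤ D) (s t : Tup n d) :
    (lowQ h₁ h₂ ρ κ D A b s t).totalDegree ≤ D := by
  rw [lowQ, MvPolynomial.totalDegree_neg]
  refine (MvPolynomial.totalDegree_add _ _).trans (max_le
    ((MvPolynomial.totalDegree_add _ _).trans (max_le ?_ ?_)) ?_)
  · exact (totalDegree_lowOU _ _).trans (Nat.sub_le _ _)
  · exact (totalDegree_C_mul_le _ _).trans ((totalDegree_lowOU _ _).trans (Nat.sub_le _ _))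
  · exact MvPolynomial.totalDegree_finsetSum_le fun a _ =>
      (totalDegree_C_mul_le _ _).trans (totalDegree_lowCross hD a)

theorem measurable_noise {ι : Type} (ρ σ : ℝ) (T : ι → ℝ) :
    Measurable fun G : ι → ℝ => fun a => ρ * T a + σ * G a := by fun_prop

/-- The averaged certificate is positive semidefinite up to a small error. -/
theorem quad_neg_combine_le (h₁ : k₁ ≤ d) (h₂ : k₂ ≤ d) (hσ0 : 0 ≤ σ) (hσ1 : σ ≤ 1)
    (hAm : ∀ s t, Measurable fun T => A T s t) (hbm : Measurable b)
    (hA : ∀ T, (A T).PosSemidef) (hAB : ∀ T s t, |A T s t| ≤ Bd)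
    (hb0 : ∀ T, 0 ≤ b T) (hbB : ∀ T, b T ≤ Bd) (hκ : 1 ≤ κ)
    (T : Tensor n (k₁ + k₂)) (z : Tup n d → ℝ) :
    quad (-combine h₁ h₂ κ (ouMat ρ σ A T) (ouU ρ σ b T)
      (cross ρ σ b T)) z ≤ Bd * Real.exp (-(κ ^ 2 / 2)) * ∑ t, z t ^ 2 := by
  have hBd : 0 ≤ Bd := (hb0 0).trans (hbB 0)
  have hN := measurable_noise ρ σ T
  set N : Tensor n (k₁ + k₂) → Tensor n (k₁ + k₂) := fun G a => ρ * T a + σ * G a with hNdef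
  have hneg : ∀ M : Matrix (Tup n d) (Tup n d) ℝ, quad (-M) z = - quad M z := by
    intro M; simp [quad, Finset.sum_neg_distrib]
  rw [hneg, quad_combine]
  have hbi : Integrable (fun G => b (N G)) (stdG (Idx n (k₁ + k₂))) :=
    Integrable.mono' (integrable_const Bd) (hbm.comp hN).aestronglyMeasurable
      (Filter.Eventually.of_forall fun G => by
        rw [Real.norm_of_nonneg (hb0 _)]; exact hbB _)
  have hbG : ∀ a, Integrable (fun G => b (N G) * G a) (stdG (Idx n (k₁ + k₂))) := fun a =>
    (integrable_coord a).bdd_mul (c := Bd) (hbm.comp hN).aestronglyMeasurable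
      (Filter.Eventually.of_forall fun G => by
        rw [Real.norm_of_nonneg (hb0 _)]; exact hbB _)
  have hquad : 0 ≤ quad (ouMat ρ σ A T) z := by
    have hint : ∀ s t, Integrable (fun G => A (N G) s t * (z s * z t))
        (stdG (Idx n (k₁ + k₂))) := fun s t =>
      (Integrable.mono' (integrable_const Bd) ((hAm s t).comp hN).aestronglyMeasurable
        (Filter.Eventually.of_forall fun G => hAB _ s t)).mul_const _
    have : quad (ouMat ρ σ A T) z
        = ∫ G, quad (A (N G)) z ∂(stdG (Idx n (k₁ + k₂))) := by
      simp only [quad, ouMat, ouU, Matrix.of_apply]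
      rw [integral_finsetSum _ fun s _ => integrable_finsetSum _ fun t _ => hint s t]
      refine Finset.sum_congr rfl fun s _ => ?_
      rw [integral_finsetSum _ fun t _ => hint s t]
      refine Finset.sum_congr rfl fun t _ => ?_
      rw [integral_mul_const]
    rw [this]
    exact integral_nonneg fun G => (posSemidef_iff_quad.1 (hA _)).2 z
  -- Of the two parts of the noisy entry `ρ T_a + σ G_a`, the first cancels in the definition of
  -- `cross`; what remains is a degree-one Gaussian coefficient of `b ∘ N`.
  have hcross : ∀ a, cross ρ σ b T a = σ * ∫ G, b (N G) * G a ∂(stdG (Idx n (k₁ + k₂))) := by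
    intro a
    have e : ∀ G, b (N G) * N G a = ρ * T a * b (N G) + σ * (b (N G) * G a) := by
      intro G; simp only [hNdef]; ring
    simp only [cross, ouU]
    change ∫ G, b (N G) * (ρ * T a + σ * G a) ∂(stdG (Idx n (k₁ + k₂)))
      - ρ * T a * ∫ G, b (N G) ∂(stdG (Idx n (k₁ + k₂))) = _
    have e2 : ∫ G, b (N G) * (ρ * T a + σ * G a) ∂(stdG (Idx n (k₁ + k₂)))
        = ρ * T a * ∫ G, b (N G) ∂(stdG (Idx n (k₁ + k₂)))
          + σ * ∫ G, b (N G) * G a ∂(stdG (Idx n (k₁ + k₂))) := by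
      rw [← integral_const_mul, ← integral_const_mul,
        ← integral_add (hbi.const_mul _) ((hbG a).const_mul _)]
      exact integral_congr_ae (Filter.Eventually.of_forall e)
    rw [e2]; ring
  set W : Tensor n (k₁ + k₂) := fun a => z (tupL h₁ a) * z (tupR h₂ a) with hW
  have hlin : -∑ a, cross ρ σ b T a * W a
      = σ * ∫ G, b (N G) * ∑ a, (-W a) * G a ∂(stdG (Idx n (k₁ + k₂))) := by
    have e3 : ∀ G, b (N G) * ∑ a, (-W a) * G a = ∑ a, (-W a) * (b (N G) * G a) := by
      intro G; rw [Finset.mul_sum]; exact Finset.sum_congr rfl fun a _ => by ring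
    simp_rw [e3]
    rw [integral_finsetSum _ fun a _ => (hbG a).const_mul _, Finset.mul_sum,
      ← Finset.sum_neg_distrib]
    refine Finset.sum_congr rfl fun a _ => ?_
    rw [integral_const_mul, hcross]; ring
  have hlevel := integral_mul_linear_le (hbm.comp hN) hκ (fun G => hb0 (N G))
    (fun G => hbB (N G)) (fun a => -W a)
  simp only [Function.comp, neg_sq] at hlevel
  have hflat := sum_flatten_sq h₁ h₂ z
  set w := ∑ t, lenWt k₁ k₂ t * z t ^ 2 with hw
  have hU : ouU ρ σ b T = ∫ G, b (N G) ∂(stdG (Idx n (k₁ + k₂))) := rfl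
  have hU0 : 0 ≤ ouU ρ σ b T := integral_nonneg fun G => hb0 _
  rw [← hU] at hlevel
  set τ₁ := Bd * Real.exp (-(κ ^ 2 / 2)) with hτ
  have hτ0 : 0 ≤ τ₁ := by positivity
  have hwz : w ≤ ∑ t, z t ^ 2 := Finset.sum_le_sum fun t _ =>
    mul_le_of_le_one_left (sq_nonneg _) (lenWt_le_one t)
  have hw0 : 0 ≤ w := Finset.sum_nonneg fun t _ => mul_nonneg (lenWt_nonneg t) (sq_nonneg _)
  have hc0 : 0 ≤ κ * ouU ρ σ b T + τ₁ := by positivity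
  -- The level-one bound, with `‖W‖` at most the weighted norm `w`. Its main part `κ (U b) w` is
  -- exactly cancelled by the diagonal term of `combine`.
  have h5 : -∑ a, cross ρ σ b T a * W a ≤ (κ * ouU ρ σ b T + τ₁) * w := by
    rw [hlin]
    calc σ * ∫ G, b (N G) * ∑ a, (-W a) * G a ∂(stdG (Idx n (k₁ + k₂)))
        ≤ σ * ((κ * ouU ρ σ b T + τ₁) * w) := mul_le_mul_of_nonneg_left
          (hlevel.trans (mul_le_mul_of_nonneg_left hflat hc0)) hσ0
      _ ≤ _ := mul_le_of_le_one_left (by positivity) hσ1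
  have h6 : τ₁ * w ≤ τ₁ * ∑ t, z t ^ 2 := mul_le_mul_of_nonneg_left hwz hτ0
  linarith [add_mul (κ * ouU ρ σ b T) τ₁ w]

/-- The top eigenvalue of the low-degree matrix is small on average under the null. -/
theorem integral_topEig_lowQ_le (h₁ : k₁ ≤ d) (h₂ : k₂ ≤ d) (h : ρ ^ 2 + σ ^ 2 = 1)
    (hρ0 : 0 ≤ ρ) (hσ0 : 0 ≤ σ)
    (hAm : ∀ s t, Measurable fun T => A T s t) (hbm : Measurable b)
    (hA : ∀ T, (A T).PosSemidef) (hAB : ∀ T s t, |A T s t| ≤ Bd)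
    (hb0 : ∀ T, 0 ≤ b T) (hbB : ∀ T, b T ≤ Bd) (hκ : 1 ≤ κ) :
    ∫ T, topEig (lowQ h₁ h₂ ρ κ D A b) T ∂(unif n (k₁ + k₂))
      ≤ Bd * Real.exp (-(κ ^ 2 / 2)) + ((Fintype.card (Tup n d) : ℝ) ^ 2
        + κ * Fintype.card (Tup n d) + 2 * (n : ℝ) ^ (k₁ + k₂)) * (ρ ^ D * Bd) := by
  have hBd : 0 ≤ Bd := (hb0 0).trans (hbB 0)
  have hσ1 : σ ≤ 1 := by nlinarith [sq_nonneg ρ]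
  have hρ1 : ρ ≤ 1 := by nlinarith [sq_nonneg σ]
  have hbabs : ∀ T, |b T| ≤ Bd := fun T => by rw [abs_of_nonneg (hb0 T)]; exact hbB T
  have hsymm : ∀ T, (A T).IsSymm := fun T => (posSemidef_iff_quad.1 (hA T)).1
  have hδ : 0 ≤ ρ ^ D := pow_nonneg hρ0 D
  have hAL : ∀ s t, MemLp (fun T => A T s t) 2 (stdG (Idx n (k₁ + k₂))) := fun s t =>
    memLp_of_abs_le (hAm s t) fun T => hAB T s t
  have hbL : MemLp b 2 (stdG (Idx n (k₁ + k₂))) := memLp_of_abs_le hbm hbabs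
  have hcL : ∀ a, MemLp (fun T => b T * T a) 2 (stdG (Idx n (k₁ + k₂))) := fun a =>
    memLp_mul_coord hbm hbabs a
  have dL : ∀ f : Tensor n (k₁ + k₂) → ℝ, MemLp f 2 (stdG (Idx n (k₁ + k₂))) →
      MemLp (fun T => MvPolynomial.eval T (lowOU ρ D f) - ouU ρ σ f T) 2
        (stdG (Idx n (k₁ + k₂))) := fun f hf => (memLp_mvEval _).sub (memLp_ouU h hf)
  have dB : ∀ f : Tensor n (k₁ + k₂) → ℝ, MemLp f 2 (stdG (Idx n (k₁ + k₂))) →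
      l2 (stdG (Idx n (k₁ + k₂))) f ≤ Bd →
      l2 (stdG (Idx n (k₁ + k₂))) (fun T => MvPolynomial.eval T (lowOU ρ D f) - ouU ρ σ f T)
        ≤ ρ ^ D * Bd := by
    intro f hf hfB
    have e : l2 (stdG (Idx n (k₁ + k₂)))
        (fun T => MvPolynomial.eval T (lowOU ρ D f) - ouU ρ σ f T)
        = l2 (stdG (Idx n (k₁ + k₂)))
          (fun T => ouU ρ σ f T - MvPolynomial.eval T (lowOU ρ D f)) := by
      simp only [l2, sub_sq_comm]
    rw [e]
    exact (l2_ouU_sub_lowOU_le h hρ0 D hf).trans (mul_le_mul_of_nonneg_left hfB hδ)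
  have hAB2 : ∀ s t, l2 (stdG (Idx n (k₁ + k₂))) (fun T => A T s t) ≤ Bd := fun s t =>
    l2_le_of_abs_le fun T => hAB T s t
  have hbB2 : l2 (stdG (Idx n (k₁ + k₂))) b ≤ Bd := l2_le_of_abs_le hbabs
  have hcB2 : ∀ a, l2 (stdG (Idx n (k₁ + k₂))) (fun T => b T * T a) ≤ Bd := fun a =>
    l2_mul_coord_le hbabs a
  set dA : Tup n d → Tup n d → Tensor n (k₁ + k₂) → ℝ := fun s t T =>
    MvPolynomial.eval T (lowOU ρ D (fun T => A T s t)) - ouU ρ σ (fun T => A T s t) T with hdA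
  set db : Tensor n (k₁ + k₂) → ℝ := fun T => MvPolynomial.eval T (lowOU ρ D b) - ouU ρ σ b T
    with hdb
  set dc : Idx n (k₁ + k₂) → Tensor n (k₁ + k₂) → ℝ := fun a T =>
    MvPolynomial.eval T (lowOU ρ D (fun T => b T * T a)) - ouU ρ σ (fun T => b T * T a) T with hdc
  -- Compare with the matrix before truncation, which is nearly negative semidefinite. The
  -- difference is an entrywise sum of truncation errors, each at most `ρ ^ D * Bd` in `L²`; a cross
  -- term has two of them, one multiplied by the unit-norm coordinate `T a`.
  have hpt : ∀ T, topEig (lowQ h₁ h₂ ρ κ D A b) T ≤ Bd * Real.exp (-(κ ^ 2 / 2))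
      + ((∑ s, ∑ t, |dA s t T|) + κ * Fintype.card (Tup n d) * |db T|
        + ∑ a, (|dc a T| + |T a * db T|)) := by
    intro T
    rw [topEig, lowQ_map_eval]
    have sy1 : (-combine h₁ h₂ κ (lowMat ρ D A T)
        (MvPolynomial.eval T (lowOU ρ D b))
        (fun a => MvPolynomial.eval T (lowCross ρ D b a))).IsSymm :=
       (combine_isSymm h₁ h₂ κ (lowMat_isSymm hsymm T) _ _).neg
    have sy2 : (-combine h₁ h₂ κ (ouMat ρ σ A T) (ouU ρ σ b T)
        (cross ρ σ b T)).IsSymm :=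
       (combine_isSymm h₁ h₂ κ (ouMat_isSymm hsymm T) _ _).neg
    refine (lambdaMaxPlus_le_add sy1 sy2).trans (add_le_add ?_ ?_)
    · rw [lambdaMaxPlus_le_iff sy2]
      exact ⟨by positivity, quad_neg_combine_le h₁ h₂ hσ0 hσ1 hAm hbm hA hAB hb0 hbB hκ T⟩
    · simp only [Matrix.neg_apply, neg_sub_neg]
      simp_rw [abs_sub_comm (combine h₁ h₂ κ (ouMat ρ σ A T) _ _ _ _)]
      refine (sum_abs_combine_sub_le h₁ h₂ (by linarith) _ _ _ _ _ _).trans ?_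
      refine add_le_add le_rfl (Finset.sum_le_sum fun a _ => ?_)
      have e : MvPolynomial.eval T (lowCross ρ D b a) - cross ρ σ b T a
          = dc a T - ρ * (T a * db T) := by
        simp only [lowCross, cross, hdc, hdb, map_sub, MvPolynomial.eval_mul, MvPolynomial.eval_C,
          MvPolynomial.eval_X]
        ring
      rw [e]
      refine (abs_sub _ _).trans (add_le_add le_rfl ?_)
      rw [abs_mul, abs_of_nonneg hρ0]
      exact mul_le_of_le_one_left (abs_nonneg _) hρ1
  have iA : ∀ s t, Integrable (fun T => |dA s t T|) (stdG (Idx n (k₁ + k₂))) := fun s t =>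
    ((dL _ (hAL s t)).integrable (by norm_num)).abs
  have ib : Integrable (fun T => |db T|) (stdG (Idx n (k₁ + k₂))) :=
    ((dL _ hbL).integrable (by norm_num)).abs
  have ic : ∀ a, Integrable (fun T => |dc a T|) (stdG (Idx n (k₁ + k₂))) := fun a =>
    ((dL _ (hcL a)).integrable (by norm_num)).abs
  have icb : ∀ a, Integrable (fun T => |T a * db T|) (stdG (Idx n (k₁ + k₂))) := fun a =>
    ((memLp_coord a).integrable_mul (dL _ hbL)).abs
  have isA : Integrable (fun T => ∑ s, ∑ t, |dA s t T|) (stdG (Idx n (k₁ + k₂))) :=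
    integrable_finsetSum _ fun s _ => integrable_finsetSum _ fun t _ => iA s t
  have isb : Integrable (fun T => κ * Fintype.card (Tup n d) * |db T|)
    (stdG (Idx n (k₁ + k₂))) := ib.const_mul _
  have isc : Integrable (fun T => ∑ a, (|dc a T| + |T a * db T|)) (stdG (Idx n (k₁ + k₂))) :=
    integrable_finsetSum _ fun a _ => (ic a).add (icb a)
  have icc : ∀ a, Integrable (fun T => |dc a T| + |T a * db T|) (stdG (Idx n (k₁ + k₂))) :=
    fun a => (ic a).add (icb a)
  have isAb : Integrable (fun T => (∑ s, ∑ t, |dA s t T|)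
    + κ * Fintype.card (Tup n d) * |db T|) (stdG (Idx n (k₁ + k₂))) := isA.add isb
  have isAbc : Integrable (fun T => (∑ s, ∑ t, |dA s t T|)
    + κ * Fintype.card (Tup n d) * |db T| + ∑ a, (|dc a T| + |T a * db T|))
    (stdG (Idx n (k₁ + k₂))) := isAb.add isc
  have hmono : ∫ T, topEig (lowQ h₁ h₂ ρ κ D A b) T ∂(stdG (Idx n (k₁ + k₂)))
      ≤ ∫ T, (Bd * Real.exp (-(κ ^ 2 / 2))
        + ((∑ s, ∑ t, |dA s t T|) + κ * Fintype.card (Tup n d) * |db T|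
          + ∑ a, (|dc a T| + |T a * db T|))) ∂(stdG (Idx n (k₁ + k₂))) :=
    integral_mono (μ := stdG (Idx n (k₁ + k₂)))
    (integrable_topEig (lowQ_isSymm (ρ := ρ) (κ := κ) (D := D) (b := b) h₁ h₂ hsymm)
      integrable_mvEval)
    ((integrable_const _).add isAbc) hpt
  refine hmono.trans ?_
  rw [integral_add (integrable_const _) isAbc, integral_const,
    integral_add isAb isc, integral_add isA isb,
    integral_finsetSum _ fun s _ => integrable_finsetSum _ fun t _ => iA s t,
    integral_const_mul, integral_finsetSum _ fun a _ => icc a]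
  rw [probReal_univ, one_smul]
  refine add_le_add le_rfl ?_
  have b1 : ∀ s ∈ (Finset.univ : Finset (Tup n d)),
      ∫ T, ∑ t, |dA s t T| ∂(stdG (Idx n (k₁ + k₂)))
        ≤ Fintype.card (Tup n d) * (ρ ^ D * Bd) := by
    intro s _
    rw [integral_finsetSum _ fun t _ => iA s t]
    refine (Finset.sum_le_card_nsmul _ _ (ρ ^ D * Bd) fun t _ => ?_).trans (by simp)
    exact (integral_abs_le_l2 (dL _ (hAL s t))).trans (dB _ (hAL s t) (hAB2 s t))
  have b1' := Finset.sum_le_card_nsmul _ _ _ b1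
  have b2 : ∫ T, |db T| ∂(stdG (Idx n (k₁ + k₂))) ≤ ρ ^ D * Bd :=
    (integral_abs_le_l2 (dL _ hbL)).trans (dB _ hbL hbB2)
  have b3 : ∀ a ∈ (Finset.univ : Finset (Idx n (k₁ + k₂))),
      ∫ T, (|dc a T| + |T a * db T|) ∂(stdG (Idx n (k₁ + k₂))) ≤ 2 * (ρ ^ D * Bd) := by
    intro a _
    rw [integral_add (ic a) (icb a), two_mul]
    refine add_le_add ((integral_abs_le_l2 (dL _ (hcL a))).trans (dB _ (hcL a) (hcB2 a))) ?_
    refine (integral_abs_mul_le (memLp_coord a) (dL _ hbL)).trans ?_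
    rw [l2_coord, one_mul]
    exact dB _ hbL hbB2
  have b3' := Finset.sum_le_card_nsmul _ _ _ b3
  have b2' := mul_le_mul_of_nonneg_left b2
    (show (0 : ℝ) ≤ κ * Fintype.card (Tup n d) by positivity)
  have hcard : ((Finset.univ : Finset (Idx n (k₁ + k₂))).card : ℝ) = (n : ℝ) ^ (k₁ + k₂) := by
    simp
  rw [nsmul_eq_mul, Finset.card_univ] at b1'
  rw [nsmul_eq_mul, hcard] at b3'
  nlinarith [b1', b2', b3']

end NullSide

/-! ### The refutation identity after noise and truncation. -/

section PlantedSide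

variable {n d k₁ k₂ D : ℕ} {ρ σ κ Bd obj lam R τ : ℝ}
  {A : Tensor n (k₁ + k₂) → Matrix (Tup n d) (Tup n d) ℝ} {b : Tensor n (k₁ + k₂) → ℝ}

/-- The value at the point `x` of `1 + ⟨x^{≤d} (x^{≤d})ᵀ, A⟩ + b (⟨x^{⊗k}, T⟩ - obj)`. -/
def defect (obj : ℝ) (A : Tensor n (k₁ + k₂) → Matrix (Tup n d) (Tup n d) ℝ)
    (b : Tensor n (k₁ + k₂) → ℝ) (x : Fin n → ℝ) (T : Tensor n (k₁ + k₂)) : ℝ :=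
  1 + quad (A T) (mvec d x) + b T * ((∑ a, T a * tensorPow (k₁ + k₂) x a) - obj)

theorem defect_eq (x : Fin n → ℝ) (T : Tensor n (k₁ + k₂)) :
    defect obj A b x T = (1 + ∑ s, ∑ t, (mvec d x s * mvec d x t) * A T s t)
      + ((∑ a, tensorPow (k₁ + k₂) x a * (b T * T a)) + (-obj) * b T) := by
  have h1 : ∑ s, ∑ t, (mvec d x s * mvec d x t) * A T s t = quad (A T) (mvec d x) := by
    simp only [quad, mul_comm]
  have h2 : ∑ a, tensorPow (k₁ + k₂) x a * (b T * T a)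
      = b T * ∑ a, T a * tensorPow (k₁ + k₂) x a := by
    rw [Finset.mul_sum]
    exact Finset.sum_congr rfl fun a _ => by ring
  rw [h1, h2, defect]; ring

theorem memLp_defect (hA : ∀ s t, MemLp (fun T => A T s t) 2 (stdG (Idx n (k₁ + k₂))))
    (hb : MemLp b 2 (stdG (Idx n (k₁ + k₂))))
    (hc : ∀ a, MemLp (fun T => b T * T a) 2 (stdG (Idx n (k₁ + k₂)))) (x : Fin n → ℝ) :
    MemLp (defect obj A b x) 2 (stdG (Idx n (k₁ + k₂))) := by
  have h : defect obj A b x = fun T => (1 + ∑ s, ∑ t, (mvec d x s * mvec d x t) * A T s t)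
      + ((∑ a, tensorPow (k₁ + k₂) x a * (b T * T a)) + (-obj) * b T) := funext (defect_eq x)
  have i1 : ∀ s, MemLp (fun T => ∑ t, (mvec d x s * mvec d x t) * A T s t) 2
      (stdG (Idx n (k₁ + k₂))) := fun s =>
    memLp_finsetSum Finset.univ fun t _ => (hA s t).const_mul (mvec d x s * mvec d x t)
  have i2 : MemLp (fun T => ∑ s, ∑ t, (mvec d x s * mvec d x t) * A T s t) 2
      (stdG (Idx n (k₁ + k₂))) := memLp_finsetSum Finset.univ fun s _ => i1 s
  have i0 : ∀ a, MemLp (fun T => tensorPow (k₁ + k₂) x a * (b T * T a)) 2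
      (stdG (Idx n (k₁ + k₂))) := fun a => (hc a).const_mul (tensorPow (k₁ + k₂) x a)
  have i3 : MemLp (fun T => ∑ a, tensorPow (k₁ + k₂) x a * (b T * T a)) 2
      (stdG (Idx n (k₁ + k₂))) := memLp_finsetSum Finset.univ fun a _ => i0 a
  have i4 : MemLp (fun T => (-obj) * b T) 2 (stdG (Idx n (k₁ + k₂))) := hb.const_mul (-obj)
  have i5 : MemLp (fun _ => (1 : ℝ)) 2 (stdG (Idx n (k₁ + k₂))) := memLp_const 1
  have i6 : MemLp (fun T => 1 + ∑ s, ∑ t, (mvec d x s * mvec d x t) * A T s t) 2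
      (stdG (Idx n (k₁ + k₂))) := i5.add i2
  have i7 : MemLp (fun T => (∑ a, tensorPow (k₁ + k₂) x a * (b T * T a)) + (-obj) * b T) 2
      (stdG (Idx n (k₁ + k₂))) := i3.add i4
  rw [h]
  exact i6.add i7

theorem eval_lowOU_defect (hD : 0 < D)
    (hA : ∀ s t, MemLp (fun T => A T s t) 2 (stdG (Idx n (k₁ + k₂))))
    (hb : MemLp b 2 (stdG (Idx n (k₁ + k₂))))
    (hc : ∀ a, MemLp (fun T => b T * T a) 2 (stdG (Idx n (k₁ + k₂)))) (x : Fin n → ℝ)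
    (T : Tensor n (k₁ + k₂)) :
    MvPolynomial.eval T (lowOU ρ D (defect obj A b x))
      = 1 + quad (lowMat ρ D A T) (mvec d x)
        + ((∑ a, MvPolynomial.eval T (lowOU ρ D (fun T => b T * T a))
          * tensorPow (k₁ + k₂) x a) + (-obj) * MvPolynomial.eval T (lowOU ρ D b)) := by
  have h : defect obj A b x = fun T => (1 + ∑ s, ∑ t, (mvec d x s * mvec d x t) * A T s t)
      + ((∑ a, tensorPow (k₁ + k₂) x a * (b T * T a)) + (-obj) * b T) := funext (defect_eq x)
  have i1 : ∀ s, MemLp (fun T => ∑ t, (mvec d x s * mvec d x t) * A T s t) 2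
      (stdG (Idx n (k₁ + k₂))) := fun s =>
    memLp_finsetSum Finset.univ fun t _ => (hA s t).const_mul (mvec d x s * mvec d x t)
  have i2 : MemLp (fun T => ∑ s, ∑ t, (mvec d x s * mvec d x t) * A T s t) 2
      (stdG (Idx n (k₁ + k₂))) := memLp_finsetSum Finset.univ fun s _ => i1 s
  have i0 : ∀ a, MemLp (fun T => tensorPow (k₁ + k₂) x a * (b T * T a)) 2
      (stdG (Idx n (k₁ + k₂))) := fun a => (hc a).const_mul (tensorPow (k₁ + k₂) x a)
  have i3 : MemLp (fun T => ∑ a, tensorPow (k₁ + k₂) x a * (b T * T a)) 2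
      (stdG (Idx n (k₁ + k₂))) := memLp_finsetSum Finset.univ fun a _ => i0 a
  have i4 : MemLp (fun T => (-obj) * b T) 2 (stdG (Idx n (k₁ + k₂))) := hb.const_mul (-obj)
  have i5 : MemLp (fun _ => (1 : ℝ)) 2 (stdG (Idx n (k₁ + k₂))) := memLp_const 1
  have i6 : MemLp (fun T => 1 + ∑ s, ∑ t, (mvec d x s * mvec d x t) * A T s t) 2
      (stdG (Idx n (k₁ + k₂))) := i5.add i2
  have i7 : MemLp (fun T => (∑ a, tensorPow (k₁ + k₂) x a * (b T * T a)) + (-obj) * b T) 2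
      (stdG (Idx n (k₁ + k₂))) := i3.add i4
  have j1 : ∀ s, lowOU ρ D (fun T => ∑ t, (mvec d x s * mvec d x t) * A T s t)
      = ∑ t, MvPolynomial.C (mvec d x s * mvec d x t) * lowOU ρ D (fun T => A T s t) := by
    intro s
    rw [lowOU_sum D Finset.univ _ fun t _ => (hA s t).const_mul (mvec d x s * mvec d x t)]
    exact Finset.sum_congr rfl fun t _ => lowOU_const_mul D _ _
  rw [h, lowOU_add D i6 i7, lowOU_add D i5 i2, lowOU_add D i3 i4, lowOU_one hD,
    lowOU_sum D Finset.univ _ fun s _ => i1 s, lowOU_sum D Finset.univ _ fun a _ => i0 a,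
    lowOU_const_mul]
  simp_rw [j1, lowOU_const_mul]
  simp only [map_add, map_sum, MvPolynomial.eval_mul, MvPolynomial.eval_C, map_one, quad, lowMat,
    Matrix.of_apply]
  simp only [mul_comm]

theorem walshDegLE_lowOU_defect (hk : k₁ + k₂ ≤ 2 * d) (hD : 0 < D)
    (hA : ∀ s t, MemLp (fun T => A T s t) 2 (stdG (Idx n (k₁ + k₂))))
    (hb : MemLp b 2 (stdG (Idx n (k₁ + k₂))))
    (hc : ∀ a, MemLp (fun T => b T * T a) 2 (stdG (Idx n (k₁ + k₂))))
    (T : Tensor n (k₁ + k₂)) :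
    WalshDegLE (2 * d)
      fun s => MvPolynomial.eval T (lowOU ρ D (defect obj A b (signVec s))) := by
  simp_rw [eval_lowOU_defect hD hA hb hc]
  exact ((walshDegLE_const _ _).add (walshDegLE_quad _)).add
    ((walshDegLE_tensor hk _).add (walshDegLE_const _ _))

/-- Truncated noise is linear, so it can be applied to the defect at a fixed `x`. Replacing the
image of `b T_a` by `ρ T_a` times that of `b` creates the cross terms of `Q`, and the diagonal term
contributes exactly `κ` because the weights of `x^{≤ d}` sum to one on the sphere. -/
theorem quad_lowQ_mvec (h₁ : k₁ ≤ d) (h₂ : k₂ ≤ d) (hD : 0 < D)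
    (hA : ∀ s t, MemLp (fun T => A T s t) 2 (stdG (Idx n (k₁ + k₂))))
    (hb : MemLp b 2 (stdG (Idx n (k₁ + k₂))))
    (hc : ∀ a, MemLp (fun T => b T * T a) 2 (stdG (Idx n (k₁ + k₂)))) {x : Fin n → ℝ}
    (hx : ∑ i, x i ^ 2 = 1) (T : Tensor n (k₁ + k₂)) :
    1 = quad ((lowQ h₁ h₂ ρ κ D A b).map (MvPolynomial.eval T)) (mvec d x)
      + MvPolynomial.eval T (lowOU ρ D (defect obj A b x))
      - MvPolynomial.eval T (lowOU ρ D b)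
        * (ρ * (∑ a, T a * tensorPow (k₁ + k₂) x a) - obj - κ) := by
  have hneg : ∀ M : Matrix (Tup n d) (Tup n d) ℝ, quad (-M) (mvec d x) = - quad M (mvec d x) := by
    intro M; simp [quad, Finset.sum_neg_distrib]
  rw [lowQ_map_eval, hneg, quad_combine, sum_lenWt_mvec h₁ h₂ hx, eval_lowOU_defect hD hA hb hc]
  have e : ∑ a, MvPolynomial.eval T (lowCross ρ D b a)
        * (mvec d x (tupL h₁ a) * mvec d x (tupR h₂ a))
      = (∑ a, MvPolynomial.eval T (lowOU ρ D (fun T => b T * T a)) * tensorPow (k₁ + k₂) x a)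
        - ρ * MvPolynomial.eval T (lowOU ρ D b) * ∑ a, T a * tensorPow (k₁ + k₂) x a := by
    rw [Finset.mul_sum, ← Finset.sum_sub_distrib]
    refine Finset.sum_congr rfl fun a _ => ?_
    rw [mvec_tupL_mul_tupR]
    simp only [lowCross, map_sub, MvPolynomial.eval_mul, MvPolynomial.eval_C, MvPolynomial.eval_X]
    ring
  rw [e]; ring

end PlantedSide

/-! ### Averages over the planted tensor. -/

section Averages

variable {n k : ℕ}

theorem sum_plant_mul_tensorPow (hn : 0 < n) (lam : ℝ) (s : Fin n → Bool) (G : Tensor n k) :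
    ∑ a, plant lam s G a * tensorPow k (signVec s) a
      = lam + ∑ a, tensorPow k (signVec s) a * G a := by
  have h := sum_tensorPow_sq (k := k) (sum_signVec_sq hn s)
  calc ∑ a, plant lam s G a * tensorPow k (signVec s) a
      = lam * ∑ a, tensorPow k (signVec s) a ^ 2 + ∑ a, tensorPow k (signVec s) a * G a := by
        rw [Finset.mul_sum, ← Finset.sum_add_distrib]
        refine Finset.sum_congr rfl fun a _ => ?_
        simp only [plant, Pi.add_apply, Pi.smul_apply, smul_eq_mul]; ring
    _ = _ := by rw [h, mul_one]

theorem tensorPow_signVec_sq (s : Fin n → Bool) (a : Idx n k) :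
    tensorPow k (signVec s) a ^ 2 = ((n : ℝ) ^ k)⁻¹ := by
  have h : ∀ j, signVec s (a j) ^ 2 = (n : ℝ)⁻¹ := by
    intro j
    rw [signVec_apply, mul_pow, pow_two (sgn _), sgn_mul_self, inv_pow,
      Real.sq_sqrt (Nat.cast_nonneg n), mul_one]
  simp only [tensorPow]
  rw [← Finset.prod_pow, Finset.prod_congr rfl fun j _ => h j]
  simp

/-- The planted signal is not too strong if low-degree polynomials do not distinguish. -/
theorem lam_sq_le {d m : ℕ} {lam R : ℝ} (hn : 0 < n) (hm : 2 ≤ m)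
    (hND : ∀ Q : Matrix (Tup n d) (Tup n d) (MvPolynomial (Idx n k) ℝ),
      HasInstDegreeLE Q m → ¬ Distinguishes lam R Q) : lam ^ 2 ≤ R * (n : ℝ) ^ k := by
  have hn' : (0 : ℝ) < n := by exact_mod_cast hn
  set a : Idx n k := fun _ => ⟨0, hn⟩
  -- A single squared entry is already a test: its mean is `1` under the null and `lam² / n ^ k + 1`
  -- under the planted law.
  have h := integral_sq_planted_le hND (MvPolynomial.X a) (by rw [MvPolynomial.totalDegree_X]; omega)
  simp only [MvPolynomial.eval_X] at h
  have hone : ∫ T : Tensor n k, T a ^ 2 ∂(unif n k) = 1 := by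
    have := l2_coord (ι := Idx n k) a
    rw [l2, Real.sqrt_eq_one] at this
    exact this
  have hi : ∀ s, Integrable (fun G : Tensor n k => plant lam s G a ^ 2) (unif n k) := by
    intro s
    have := integrable_eval_plant lam s ((MvPolynomial.X a) ^ 2 : MvPolynomial (Idx n k) ℝ)
    simpa using this
  have hzero : ∫ T : Tensor n k, T a ∂(unif n k) = 0 := by
    rw [unif_eq, integral_comp_eval (μ := fun _ : Idx n k => gaussianReal 0 1) (i := a)
      (f := fun x : ℝ => x) (by fun_prop)]
    exact integral_id_gaussianReal
  have hpl : ∀ s, ∫ G : Tensor n k, plant lam s G a ^ 2 ∂(unif n k)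
      = lam ^ 2 * ((n : ℝ) ^ k)⁻¹ + 1 := by
    intro s
    have i1 : Integrable (fun G : Tensor n k => G a) (unif n k) := integrable_coord a
    have i2 : Integrable (fun G : Tensor n k => G a ^ 2) (unif n k) := (memLp_coord a).integrable_sq
    have e : ∀ G : Tensor n k, plant lam s G a ^ 2 = lam ^ 2 * ((n : ℝ) ^ k)⁻¹
        + (2 * lam * tensorPow k (signVec s) a * G a + G a ^ 2) := by
      intro G
      rw [← tensorPow_signVec_sq s a]
      simp only [plant, Pi.add_apply, Pi.smul_apply, smul_eq_mul]; ring
    have i3 : Integrable (fun G : Tensor n k => 2 * lam * tensorPow k (signVec s) a * G a + G a ^ 2)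
      (unif n k) := (i1.const_mul _).add i2
    simp_rw [e]
    rw [integral_add (integrable_const _) i3, integral_const,
      integral_add (i1.const_mul _) i2, integral_const_mul, hzero, hone]
    simp
  rw [integral_planted (by fun_prop) hi, hone] at h
  simp_rw [hpl] at h
  have h2 : lam ^ 2 * ((n : ℝ) ^ k)⁻¹ + 1 ≤ R := by
    rw [Finset.sum_const, Finset.card_univ, nsmul_eq_mul, ← mul_assoc] at h
    simpa using h
  have h3 : lam ^ 2 * ((n : ℝ) ^ k)⁻¹ ≤ R := by linarith
  rwa [← div_eq_mul_inv, div_le_iff₀ (by positivity)] at h3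

/-- Integrability that only uses moments of polynomials is transferred to each fixed planted sign
pattern separately. -/
theorem integrable_plant_of_planted {lam : ℝ} {f : Tensor n k → ℝ} (hf : Measurable f)
    (h : ∀ P : Measure (Tensor n k),
      (∀ p : MvPolynomial (Idx n k) ℝ, Integrable (fun T => MvPolynomial.eval T p) P) →
        Integrable f P) (s : Fin n → Bool) :
    Integrable (fun G => f (plant lam s G)) (unif n k) := by
  have := h ((unif n k).map (plant lam s)) fun p => by
    rw [integrable_map_measure (measurable_mvEval p).aestronglyMeasurable
      (measurable_plant lam s).aemeasurable]
    exact integrable_eval_plant lam s p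
  rwa [integrable_map_measure hf.aestronglyMeasurable
    (measurable_plant lam s).aemeasurable] at this

end Averages

theorem sq_posPart_le_exp {κ u : ℝ} (hκ : 2 ≤ κ) : max (|u| - κ) 0 ^ 2
    ≤ Real.exp (κ * (u - κ)) + Real.exp (κ * (-u - κ)) := by
  have h1 : ∀ v : ℝ, 0 ≤ v → v ^ 2 ≤ Real.exp (κ * v) := by
    intro v hv
    have h2 : v ≤ Real.exp v := by linarith [Real.add_one_le_exp v]
    calc v ^ 2 ≤ Real.exp v ^ 2 := pow_le_pow_left₀ hv h2 2
      _ = Real.exp (2 * v) := by rw [← Real.exp_nat_mul]; norm_num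
      _ ≤ _ := Real.exp_le_exp.2 (mul_le_mul_of_nonneg_right hκ hv)
  have p1 := Real.exp_pos (κ * (u - κ))
  have p2 := Real.exp_pos (κ * (-u - κ))
  rcases le_total (|u| - κ) 0 with h | h
  · rw [max_eq_right h]; simp; linarith
  · rw [max_eq_left h]
    have h3 := h1 _ h
    rcases abs_cases u with ⟨hu, _⟩ | ⟨hu, _⟩ <;> rw [hu] at h3 ⊢ <;> linarith

/-- The linear term is nonnegative up to small errors. -/
theorem neg_mul_shift_le {β lam m₀ κ ρ Z : ℝ} (hρ0 : 0 ≤ ρ) (hρ1 : ρ ≤ 1) (hm : κ ≤ m₀)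
    (hm' : m₀ ≤ lam) :
    -(β * (m₀ + ρ * Z)) ≤ 2 * lam * max (-β) 0 + |β| * max (|Z| - κ) 0 := by
  have hw1 : |Z| - κ ≤ max (|Z| - κ) 0 := le_max_left _ _
  have hw0 : 0 ≤ max (|Z| - κ) 0 := le_max_right _ _
  have hZ : |ρ * Z| ≤ |Z| := by
    rw [abs_mul, abs_of_nonneg hρ0]; exact mul_le_of_le_one_left (abs_nonneg _) hρ1
  obtain ⟨hZ1, hZ2⟩ := abs_le.1 hZ
  set w := max (|Z| - κ) 0
  rcases le_total 0 β with h | h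
  · rw [abs_of_nonneg h, max_eq_right (by linarith)]
    nlinarith [mul_nonneg h (show (0 : ℝ) ≤ w + m₀ + ρ * Z by linarith)]
  · rw [abs_of_nonpos h, max_eq_left (by linarith)]
    nlinarith [mul_nonneg (neg_nonneg.2 h) (show (0 : ℝ) ≤ 2 * lam + w - m₀ - ρ * Z by linarith)]

theorem integral_avg_const (n : ℕ) (c : ℝ) :
    ((2 : ℝ) ^ n)⁻¹ * ∑ _s : Fin n → Bool, c = c := by
  rw [Finset.sum_const, Finset.card_univ, nsmul_eq_mul, ← mul_assoc]
  simp

/-! ### The inequality forced by the absence of a distinguisher. -/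

section Core

variable {n d k₁ k₂ D : ℕ} {ρ σ κ Bd obj lam R τ : ℝ}
  {A : Tensor n (k₁ + k₂) → Matrix (Tup n d) (Tup n d) ℝ} {b : Tensor n (k₁ + k₂) → ℝ}

/-- Bounded certificates for the null distribution that are approximately valid lead to an
inequality if low-degree matrices do not distinguish. -/
theorem half_le_of_not_distinguishes (hn : 0 < n) (h₁ : k₁ ≤ d) (h₂ : k₂ ≤ d) (hD : 1 ≤ D)
    (h : ρ ^ 2 + σ ^ 2 = 1) (hρ0 : 0 ≤ ρ) (hσ0 : 0 ≤ σ)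
    (hAm : ∀ s t, Measurable fun T => A T s t) (hbm : Measurable b)
    (hA : ∀ T, (A T).PosSemidef) (hAB : ∀ T s t, |A T s t| ≤ Bd)
    (hb0 : ∀ T, 0 ≤ b T) (hbB : ∀ T, b T ≤ Bd) (hκ : 2 ≤ κ) (hR : 0 < R) (hBd : 0 < Bd)
    (hobj : 0 ≤ obj) (hm : κ ≤ ρ * lam - obj - κ) (hlam : 0 ≤ lam)
    (hND : ∀ Q : Matrix (Tup n d) (Tup n d) (MvPolynomial (Idx n (k₁ + k₂)) ℝ),
      HasInstDegreeLE Q (2 * D) → ¬ Distinguishes lam R Q)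
    (hτ : ∀ s, ∫ T, defect obj A b (signVec s) T ^ 2 ∂(unif n (k₁ + k₂)) ≤ τ) :
    1 / 2 ≤ (d + 1) * (R * (Bd * Real.exp (-(κ ^ 2 / 2)) + ((Fintype.card (Tup n d) : ℝ) ^ 2
        + κ * Fintype.card (Tup n d) + 2 * (n : ℝ) ^ (k₁ + k₂)) * (ρ ^ D * Bd)))
      + 2 * lam * (R * (ρ ^ D * Bd)) + 2 * (R * Bd ^ 2) * Real.exp (-(κ ^ 2 / 2))
      + ((n : ℝ) + 1) ^ (2 * d) * (R * τ) := by
  have hρ1 : ρ ≤ 1 := by nlinarith [sq_nonneg σ]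
  have hbabs : ∀ T, |b T| ≤ Bd := fun T => by rw [abs_of_nonneg (hb0 T)]; exact hbB T
  have hsymm : ∀ T, (A T).IsSymm := fun T => (posSemidef_iff_quad.1 (hA T)).1
  have hAL : ∀ s t, MemLp (fun T => A T s t) 2 (stdG (Idx n (k₁ + k₂))) := fun s t =>
    memLp_of_abs_le (hAm s t) fun T => hAB T s t
  have hbL : MemLp b 2 (stdG (Idx n (k₁ + k₂))) := memLp_of_abs_le hbm hbabs
  have hcL : ∀ a, MemLp (fun T => b T * T a) 2 (stdG (Idx n (k₁ + k₂))) := fun a =>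
    memLp_mul_coord hbm hbabs a
  set Q := lowQ h₁ h₂ ρ κ D A b with hQdef
  have hQs : Q.IsSymm := lowQ_isSymm h₁ h₂ hsymm
  set Y : (Fin n → Bool) → MvPolynomial (Idx n (k₁ + k₂)) ℝ := fun s =>
    lowOU ρ D (defect obj A b (signVec s)) with hY
  set β := lowOU ρ D b with hβ
  -- Young's parameter: as `E_μ β² ≤ R Bd²`, the term `α β²` costs at most `1 / 4`. The bound `Y ≤ 1
  -- / 4 + Y²` costs another `1 / 4`, which leaves `1 / 2` in the conclusion.
  set α : ℝ := 1 / (4 * (R * Bd ^ 2)) with hα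
  have hα0 : 0 < α := by positivity
  set K : ℝ := ((n : ℝ) + 1) ^ (2 * d) with hK
  set w : (Fin n → Bool) → Tensor n (k₁ + k₂) → ℝ := fun s G =>
    ∑ a, tensorPow (k₁ + k₂) (signVec s) a * G a with hw
  set w' : (Fin n → Bool) → Tensor n (k₁ + k₂) → ℝ := fun s G =>
    ∑ a, (-tensorPow (k₁ + k₂) (signVec s) a) * G a with hw'
  have hww : ∀ s G, w' s G = - w s G := by
    intro s G; simp only [hw, hw', neg_mul, Finset.sum_neg_distrib]
  have hpt : ∀ s G, 1 ≤ (d + 1) * topEig Q (plant lam s G)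
      + (2 * lam * max (MvPolynomial.eval (plant lam s G) (-β)) 0
      + (α * MvPolynomial.eval (plant lam s G) β ^ 2
      + (R * Bd ^ 2 * (Real.exp (κ * (w s G - κ)) + Real.exp (κ * (w' s G - κ)))
      + (1 / 4 + K * (((2 : ℝ) ^ n)⁻¹
        * ∑ s', MvPolynomial.eval (plant lam s G) (Y s') ^ 2))))) := by
    intro s G
    set T := plant lam s G with hT
    have hx := sum_signVec_sq hn s
    have e1 := quad_lowQ_mvec (ρ := ρ) (κ := κ) (obj := obj) h₁ h₂ hD hAL hbL hcL hx T
    rw [hT, sum_plant_mul_tensorPow hn, ← hT] at e1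
    have q1 := quad_le_lambdaMaxPlus (isSymm_map_eval hQs T) (mvec d (signVec s))
    rw [sum_mvec_sq hx] at q1
    have q2 := neg_mul_shift_le (β := MvPolynomial.eval T β) (lam := lam)
      (m₀ := ρ * lam - obj - κ) (Z := w s G) hρ0 hρ1 hm (by nlinarith)
    have q3 := sq_posPart_le_exp (u := w s G) hκ
    have q4 : |MvPolynomial.eval T β| * max (|w s G| - κ) 0
        ≤ α * MvPolynomial.eval T β ^ 2 + R * Bd ^ 2 * max (|w s G| - κ) 0 ^ 2 := by
      have hc : α * (4 * (R * Bd ^ 2)) = 1 := by rw [hα]; field_simp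
      rw [← sq_abs (MvPolynomial.eval T β)]
      set x := |MvPolynomial.eval T β|
      set y := max (|w s G| - κ) 0
      have h8 : 0 ≤ α * (x - 2 * (R * Bd ^ 2) * y) ^ 2 := by positivity
      have h9 : α * (x - 2 * (R * Bd ^ 2) * y) ^ 2
          = α * x ^ 2 - α * (4 * (R * Bd ^ 2)) * (x * y)
            + α * (4 * (R * Bd ^ 2)) * (R * Bd ^ 2 * y ^ 2) := by ring
      rw [h9, hc] at h8
      linarith
    have q5 : R * Bd ^ 2 * max (|w s G| - κ) 0 ^ 2 ≤ R * Bd ^ 2 *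
        (Real.exp (κ * (w s G - κ)) + Real.exp (κ * (w' s G - κ))) := by
      rw [hww]; exact mul_le_mul_of_nonneg_left q3 (by positivity)
    -- Decoupling: the defect is evaluated at the very signs planted in `T`, where moment comparison
    -- says nothing. Low degree in the signs replaces them by an average over all `s'` for this `T`.
    have q6 := (walshDegLE_lowOU_defect (ρ := ρ) (obj := obj) (by omega) hD hAL hbL hcL T).sq_le s
    have q7 : MvPolynomial.eval T (Y s) ≤ 1 / 4 + MvPolynomial.eval T (Y s) ^ 2 := by
      nlinarith [sq_nonneg (MvPolynomial.eval T (Y s) - 1 / 2)]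
    have q8 : MvPolynomial.eval T (-β) = - MvPolynomial.eval T β := map_neg _ _
    rw [q8]
    have q9 : -(MvPolynomial.eval T β * (ρ * (lam + w s G) - obj - κ))
        = -(MvPolynomial.eval T β * (ρ * lam - obj - κ + ρ * w s G)) := by ring
    have e2 : (1 : ℝ) = quad (Q.map (MvPolynomial.eval T)) (mvec d (signVec s))
      + MvPolynomial.eval T (Y s) - MvPolynomial.eval T β * (ρ * (lam + w s G) - obj - κ) := e1
    have q10 : MvPolynomial.eval T (Y s) ^ 2
      ≤ K * (((2 : ℝ) ^ n)⁻¹ * ∑ s', MvPolynomial.eval T (Y s') ^ 2) := q6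
    have q11 : quad (Q.map (MvPolynomial.eval T)) (mvec d (signVec s)) ≤ (d + 1) * topEig Q T := by
      rw [mul_comm]; exact q1
    linarith
  have mtop : Measurable (topEig Q) := (continuous_topEig hQs).measurable
  have itop : ∀ s, Integrable (fun G => topEig Q (plant lam s G)) (unif n (k₁ + k₂)) :=
    integrable_plant_of_planted mtop fun P hP => integrable_topEig hQs hP
  have ipos : ∀ s, Integrable (fun G => max (MvPolynomial.eval (plant lam s G) (-β)) 0)
      (unif n (k₁ + k₂)) := fun s => (integrable_eval_plant lam s (-β)).pos_part
  have isq : ∀ s (p : MvPolynomial (Idx n (k₁ + k₂)) ℝ),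
      Integrable (fun G => MvPolynomial.eval (plant lam s G) p ^ 2) (unif n (k₁ + k₂)) := by
    intro s p
    have := integrable_eval_plant lam s (p ^ 2)
    simpa only [map_pow] using this
  have iexp : ∀ s, Integrable (fun G => Real.exp (κ * (w s G - κ))) (unif n (k₁ + k₂)) :=
    fun s => integrable_exp_linear_sub κ _
  have iexp' : ∀ s, Integrable (fun G => Real.exp (κ * (w' s G - κ))) (unif n (k₁ + k₂)) :=
    fun s => integrable_exp_linear_sub κ _
  have bexp : ∀ s, ∫ G, Real.exp (κ * (w s G - κ)) ∂(unif n (k₁ + k₂))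
      ≤ Real.exp (-(κ ^ 2 / 2)) := fun s =>
    integral_exp_linear_sub_le (sum_tensorPow_sq (sum_signVec_sq hn s)).le
  have bexp' : ∀ s, ∫ G, Real.exp (κ * (w' s G - κ)) ∂(unif n (k₁ + k₂))
      ≤ Real.exp (-(κ ^ 2 / 2)) := fun s =>
    integral_exp_linear_sub_le (by
      simp only [neg_sq]; exact (sum_tensorPow_sq (sum_signVec_sq hn s)).le)
  have hint : ∀ s, 1 ≤ (d + 1) * ∫ G, topEig Q (plant lam s G) ∂(unif n (k₁ + k₂))
      + (2 * lam * ∫ G, max (MvPolynomial.eval (plant lam s G) (-β)) 0 ∂(unif n (k₁ + k₂))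
      + (α * ∫ G, MvPolynomial.eval (plant lam s G) β ^ 2 ∂(unif n (k₁ + k₂))
      + (R * Bd ^ 2 * (2 * Real.exp (-(κ ^ 2 / 2)))
      + (1 / 4 + K * (((2 : ℝ) ^ n)⁻¹
        * ∑ s', ∫ G, MvPolynomial.eval (plant lam s G) (Y s') ^ 2 ∂(unif n (k₁ + k₂))))))) := by
    intro s
    have j1 : Integrable (fun G => (d + 1) * topEig Q (plant lam s G)) (unif n (k₁ + k₂)) :=
      (itop s).const_mul _
    have j2 : Integrable (fun G => 2 * lam * max (MvPolynomial.eval (plant lam s G) (-β)) 0)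
      (unif n (k₁ + k₂)) := (ipos s).const_mul _
    have j3 : Integrable (fun G => α * MvPolynomial.eval (plant lam s G) β ^ 2)
      (unif n (k₁ + k₂)) := (isq s β).const_mul _
    have j4 : Integrable (fun G => R * Bd ^ 2 * (Real.exp (κ * (w s G - κ))
      + Real.exp (κ * (w' s G - κ)))) (unif n (k₁ + k₂)) := ((iexp s).add (iexp' s)).const_mul _
    have j5 : Integrable (fun G => ∑ s', MvPolynomial.eval (plant lam s G) (Y s') ^ 2)
      (unif n (k₁ + k₂)) := integrable_finsetSum _ fun s' _ => isq s (Y s')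
    have j6 : Integrable (fun G => 1 / 4 + K * (((2 : ℝ) ^ n)⁻¹
        * ∑ s', MvPolynomial.eval (plant lam s G) (Y s') ^ 2)) (unif n (k₁ + k₂)) :=
      (integrable_const _).add ((j5.const_mul _).const_mul _)
    have j46 := j4.add j6
    have j36 := j3.add j46
    have j26 := j2.add j36
    have hmono : ∫ _G : Tensor n (k₁ + k₂), (1 : ℝ) ∂(unif n (k₁ + k₂)) ≤ _ :=
      integral_mono (integrable_const 1) (j1.add j26) (hpt s)
    rw [integral_const, probReal_univ, one_smul, integral_add' j1 j26, integral_add' j2 j36,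
      integral_add' j3 j46, integral_add' j4 j6,
      integral_add (integrable_const _) ((j5.const_mul _).const_mul _), integral_const_mul,
      integral_const_mul, integral_const_mul, integral_const_mul, integral_const_mul,
      integral_const_mul, integral_finsetSum _ fun s' _ => isq s (Y s'),
      integral_add (iexp s) (iexp' s), integral_const, probReal_univ, one_smul] at hmono
    have := mul_le_mul_of_nonneg_left (add_le_add (bexp s) (bexp' s))
      (show (0 : ℝ) ≤ R * Bd ^ 2 by positivity)
    rw [← two_mul] at this
    linarith
  have hsum := mul_le_mul_of_nonneg_left
    (Finset.sum_le_sum fun s (_ : s ∈ Finset.univ) => hint s)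
    (show (0 : ℝ) ≤ ((2 : ℝ) ^ n)⁻¹ by positivity)
  have psq : ∀ p : MvPolynomial (Idx n (k₁ + k₂)) ℝ,
      ((2 : ℝ) ^ n)⁻¹ * ∑ s, ∫ G, MvPolynomial.eval (plant lam s G) p ^ 2 ∂(unif n (k₁ + k₂))
        = ∫ T, MvPolynomial.eval T p ^ 2 ∂(planted n (k₁ + k₂) lam) := fun p =>
    (integral_planted ((measurable_mvEval p).pow_const 2) fun s => isq s p).symm
  have ptop := integral_planted mtop itop
  have ppos := integral_planted (lam := lam) (f := fun T => max (MvPolynomial.eval T (-β)) 0)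
    ((measurable_mvEval (-β)).max measurable_const) ipos
  simp only [Finset.sum_add_distrib, mul_add, integral_avg_const] at hsum
  simp only [← Finset.mul_sum] at hsum
  have r1 := integral_topEig_planted_le hND hQs fun s t =>
    (totalDegree_lowQ (ρ := ρ) (κ := κ) (A := A) (b := b) h₁ h₂ hD s t).trans (by omega : D ≤ 2 * D)
  have r1' := integral_topEig_lowQ_le (D := D) h₁ h₂ h hρ0 hσ0 hAm hbm hA hAB hb0 hbB
    (by linarith : (1 : ℝ) ≤ κ)
  have degβ : β.totalDegree ≤ D - 1 := totalDegree_lowOU _ _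
  have r2 := integral_posPart_planted_le hND (-β) (by rw [MvPolynomial.totalDegree_neg]; omega)
  -- The untruncated average of `b` is nonnegative, so the truncation is negative only by its error.
  have r2' : ∫ T, max (MvPolynomial.eval T (-β)) 0 ∂(unif n (k₁ + k₂)) ≤ ρ ^ D * Bd := by
    have dL : MemLp (fun T => ouU ρ σ b T - MvPolynomial.eval T β) 2
      (stdG (Idx n (k₁ + k₂))) := (memLp_ouU h hbL).sub (memLp_mvEval _)
    calc ∫ T, max (MvPolynomial.eval T (-β)) 0 ∂(unif n (k₁ + k₂))
        ≤ ∫ T, |ouU ρ σ b T - MvPolynomial.eval T β| ∂(stdG (Idx n (k₁ + k₂))) := by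
          refine integral_mono ((integrable_mvEval (-β)).pos_part)
            (dL.integrable (by norm_num)).abs fun T => ?_
          have hU0 : 0 ≤ ouU ρ σ b T := integral_nonneg fun G => hb0 _
          simp only [map_neg]
          exact max_le (by linarith [le_abs_self (ouU ρ σ b T - MvPolynomial.eval T β)])
            (abs_nonneg _)
      _ ≤ l2 (stdG (Idx n (k₁ + k₂))) _ := integral_abs_le_l2 dL
      _ ≤ ρ ^ D * l2 (stdG (Idx n (k₁ + k₂))) b := l2_ouU_sub_lowOU_le h hρ0 D hbL
      _ ≤ _ := mul_le_mul_of_nonneg_left (l2_le_of_abs_le hbabs) (pow_nonneg hρ0 D)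
  have sqle : ∀ (f : Tensor n (k₁ + k₂) → ℝ), MemLp f 2 (stdG (Idx n (k₁ + k₂))) →
      ∫ T, MvPolynomial.eval T (lowOU ρ D f) ^ 2 ∂(unif n (k₁ + k₂))
        ≤ ∫ T, f T ^ 2 ∂(unif n (k₁ + k₂)) := by
    intro f hf
    rw [unif_eq, ← l2_sq, ← l2_sq]
    exact pow_le_pow_left₀ (l2_nonneg _) (l2_lowOU_le h D hf) 2
  have r3 := integral_sq_planted_le hND β (by omega)
  have r3' : ∫ T, MvPolynomial.eval T β ^ 2 ∂(unif n (k₁ + k₂)) ≤ Bd ^ 2 := by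
    refine (sqle b hbL).trans ?_
    rw [unif_eq, ← l2_sq]
    exact pow_le_pow_left₀ (l2_nonneg _) (l2_le_of_abs_le hbabs) 2
  have r4 : ∀ s', ∫ T, MvPolynomial.eval T (Y s') ^ 2 ∂(planted n (k₁ + k₂) lam) ≤ R * τ := by
    intro s'
    have degY : (Y s').totalDegree ≤ D - 1 := totalDegree_lowOU _ _
    refine (integral_sq_planted_le hND (Y s') (by omega)).trans
      (mul_le_mul_of_nonneg_left ?_ hR.le)
    exact (sqle _ (memLp_defect hAL hbL hcL _)).trans (hτ s')
  -- After exchanging the averages, each fixed `s'` gives a polynomial integrated against the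
  -- planted law, to which the comparison with the null applies.
  have r4' : ((2 : ℝ) ^ n)⁻¹ * ∑ s, (((2 : ℝ) ^ n)⁻¹ * ∑ s', ∫ G,
      MvPolynomial.eval (plant lam s G) (Y s') ^ 2 ∂(unif n (k₁ + k₂))) ≤ R * τ := by
    rw [← Finset.mul_sum, Finset.sum_comm]
    calc ((2 : ℝ) ^ n)⁻¹ * (((2 : ℝ) ^ n)⁻¹ * ∑ s', ∑ s, ∫ G,
          MvPolynomial.eval (plant lam s G) (Y s') ^ 2 ∂(unif n (k₁ + k₂)))
        = ((2 : ℝ) ^ n)⁻¹ * ∑ s', ∫ T, MvPolynomial.eval T (Y s') ^ 2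
            ∂(planted n (k₁ + k₂) lam) := by
          rw [Finset.mul_sum]; simp_rw [psq]
      _ ≤ ((2 : ℝ) ^ n)⁻¹ * ∑ _s' : Fin n → Bool, R * τ :=
          mul_le_mul_of_nonneg_left (Finset.sum_le_sum fun s' _ => r4 s') (by positivity)
      _ = R * τ := integral_avg_const n _
  have s1 : (d + 1) * ∫ T, topEig Q T ∂(planted n (k₁ + k₂) lam)
      ≤ (d + 1) * (R * (Bd * Real.exp (-(κ ^ 2 / 2)) + ((Fintype.card (Tup n d) : ℝ) ^ 2
        + κ * Fintype.card (Tup n d) + 2 * (n : ℝ) ^ (k₁ + k₂)) * (ρ ^ D * Bd))) :=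
    mul_le_mul_of_nonneg_left (r1.trans (mul_le_mul_of_nonneg_left r1' hR.le)) (by positivity)
  have s2 : 2 * lam * ∫ T, max (MvPolynomial.eval T (-β)) 0 ∂(planted n (k₁ + k₂) lam)
      ≤ 2 * lam * (R * (ρ ^ D * Bd)) :=
    mul_le_mul_of_nonneg_left (r2.trans (mul_le_mul_of_nonneg_left r2' hR.le)) (by positivity)
  have s3 : α * ∫ T, MvPolynomial.eval T β ^ 2 ∂(planted n (k₁ + k₂) lam) ≤ 1 / 4 := by
    calc _ ≤ α * (R * Bd ^ 2) :=
          mul_le_mul_of_nonneg_left (r3.trans (mul_le_mul_of_nonneg_left r3' hR.le)) hα0.le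
      _ = 1 / 4 := by rw [hα]; field_simp
  have s4 := mul_le_mul_of_nonneg_left r4' (show (0 : ℝ) ≤ K by positivity)
  rw [ptop] at s1
  rw [ppos] at s2
  rw [← psq β] at s3
  simp only [← Finset.mul_sum] at s4
  nlinarith [s1, s2, s3, s4, hsum]

end Core

/-! ### Measurable choice of certificates. -/

section Cells

variable {n d k : ℕ} {Bd obj p : ℝ}

/-- The cell, of side `η`, of a tensor. -/
def cell (η : ℝ) (T : Tensor n k) : Idx n k → ℤ := fun a => ⌊T a / η⌋

theorem measurable_cell (η : ℝ) : Measurable (cell (n := n) (k := k) η) :=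
  measurable_pi_lambda _ fun a => by
    have h : Measurable fun T : Tensor n k => T a / η := by fun_prop
    exact Int.measurable_floor.comp h

theorem abs_sub_le_of_cell_eq {η : ℝ} (hη : 0 < η) {T T' : Tensor n k}
    (h : cell η T = cell η T') (a : Idx n k) : |T a - T' a| ≤ η := by
  have h1 : ⌊T a / η⌋ = ⌊T' a / η⌋ := congrFun h a
  have h2 := Int.abs_sub_lt_one_of_floor_eq_floor h1
  rw [← sub_div, abs_div, abs_of_pos hη, div_lt_one hη] at h2
  exact h2.le

/-- Bounded refutations of most instances can be chosen measurably, at the price of a small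
defect. -/
theorem exists_measurable_certificate (hBd : 0 ≤ Bd) (hp : 0 < p)
    (h : unif n k {T | ¬ RefutableWithin d obj Bd T} ≤ ENNReal.ofReal p) :
    ∃ (A : Tensor n k → Matrix (Tup n d) (Tup n d) ℝ) (b : Tensor n k → ℝ),
      (∀ s t, Measurable fun T => A T s t) ∧ Measurable b ∧ (∀ T, (A T).PosSemidef) ∧
      (∀ T s t, |A T s t| ≤ Bd) ∧ (∀ T, 0 ≤ b T) ∧ (∀ T, b T ≤ Bd) ∧
      ∀ x : Fin n → ℝ, ∑ i, x i ^ 2 = 1 →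
        ∫ T, (1 + quad (A T) (mvec d x) + b T * ((∑ a, T a * tensorPow k x a) - obj)) ^ 2
          ∂(unif n k) ≤ 2 * p := by
  classical
  -- The side of the cells is chosen so that moving `T` inside its cell changes the identity by at
  -- most `p` in square.
  obtain ⟨η, hη, hηp⟩ : ∃ η : ℝ, 0 < η ∧ Bd ^ 2 * (Fintype.card (Idx n k) * η ^ 2) ≤ p := by
    set M := Bd ^ 2 * (Fintype.card (Idx n k) : ℝ) with hM
    have hM0 : 0 ≤ M := by positivity
    refine ⟨√(p / (M + 1)), Real.sqrt_pos.2 (by positivity), ?_⟩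
    rw [Real.sq_sqrt (by positivity), ← mul_assoc, ← hM, mul_div_assoc', div_le_iff₀ (by positivity)]
    nlinarith
  -- One certificate is chosen per cell, from any refutable instance inside it. There are countably
  -- many cells, so the choice is measurable although no measurability of refutability is known.
  set good : (Idx n k → ℤ) → Prop := fun z =>
    ∃ T : Tensor n k, cell η T = z ∧ RefutableWithin d obj Bd T with hgood
  have hex : ∀ z, ∃ (A : Matrix (Tup n d) (Tup n d) ℝ) (b : ℝ), A.PosSemidef ∧
      (∀ s t, |A s t| ≤ Bd) ∧ 0 ≤ b ∧ b ≤ Bd ∧ (good z → ∃ T : Tensor n k, cell η T = z ∧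
        ∀ x : Fin n → ℝ, ∑ i, x i ^ 2 = 1 →
          1 + quad A (mvec d x) + b * ((∑ a, T a * tensorPow k x a) - obj) = 0) ∧
        (¬ good z → A = 0 ∧ b = 0) := by
    intro z
    by_cases hz : good z
    · obtain ⟨T, hT, A, b, q, ⟨hA, hb, hq, he⟩, hAB, hbB, hqB⟩ := hz
      refine ⟨A, b, hA, hAB, hb, hbB, fun _ => ⟨T, hT, fun x hx => ?_⟩,
        fun hz' => absurd ⟨T, hT, A, b, q, ⟨hA, hb, hq, he⟩, hAB, hbB, hqB⟩ hz'⟩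
      have h1 := congrArg (MvPolynomial.eval x) he
      rw [map_add, map_add, MvPolynomial.eval_mul, MvPolynomial.eval_mul, MvPolynomial.eval_C,
        eval_gramPoly, eval_objPoly, eval_spherePoly, hx, map_neg, map_one] at h1
      linarith
    · exact ⟨0, 0, Matrix.PosSemidef.zero, fun s t => by simpa using hBd, le_rfl, hBd,
        fun hz' => absurd hz' hz, fun _ => ⟨rfl, rfl⟩⟩
  choose A b hA hAB hb0 hbB hg hng using hex
  have hcell := measurable_cell (n := n) (k := k) η
  refine ⟨fun T => A (cell η T), fun T => b (cell η T),
    fun s t => (measurable_of_countable fun z => A z s t).comp hcell,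
    (measurable_of_countable b).comp hcell, fun T => hA _, fun T => hAB _, fun T => hb0 _,
    fun T => hbB _, fun x hx => ?_⟩
  set B : Set (Tensor n k) := cell η ⁻¹' {z | ¬ good z} with hB
  have hBm : MeasurableSet B := hcell (Set.to_countable _).measurableSet
  have hBle : (unif n k).real B ≤ p := by
    rw [measureReal_def]
    refine ENNReal.toReal_le_of_le_ofReal hp.le (le_trans (measure_mono ?_) h)
    intro T hT hR
    exact hT ⟨T, rfl, hR⟩
  have hpt : ∀ T : Tensor n k, (1 + quad (A (cell η T)) (mvec d x)
      + b (cell η T) * ((∑ a, T a * tensorPow k x a) - obj)) ^ 2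
      ≤ p + B.indicator (fun _ => (1 : ℝ)) T := by
    intro T
    by_cases hT : good (cell η T)
    · have hTB : T ∉ B := fun h => h hT
      rw [Set.indicator_of_notMem hTB, add_zero]
      obtain ⟨T₀, hT₀, he⟩ := hg _ hT
      -- The identity is exact at the representative `T₀`. On bad cells the certificate is zero and
      -- the defect is `1`, which is paid for by their probability.
      have e : 1 + quad (A (cell η T)) (mvec d x)
          + b (cell η T) * ((∑ a, T a * tensorPow k x a) - obj)
          = b (cell η T) * ∑ a, (T - T₀) a * tensorPow k x a := by
        have h2 := he x hx
        simp only [Pi.sub_apply, sub_mul, Finset.sum_sub_distrib]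
        linarith
      rw [e, mul_pow]
      have h3 : (∑ a, (T - T₀) a * tensorPow k x a) ^ 2 ≤ ∑ a, (T - T₀) a ^ 2 := by
        refine (Finset.sum_mul_sq_le_sq_mul_sq _ _ _).trans ?_
        rw [sum_tensorPow_sq hx, mul_one]
      have h4 : ∑ a, (T - T₀) a ^ 2 ≤ Fintype.card (Idx n k) * η ^ 2 := by
        refine (Finset.sum_le_card_nsmul _ _ (η ^ 2) fun a _ => ?_).trans (by simp)
        rw [← sq_abs]
        exact pow_le_pow_left₀ (abs_nonneg _) (abs_sub_le_of_cell_eq hη hT₀.symm a) 2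
      refine le_trans ?_ hηp
      exact mul_le_mul (pow_le_pow_left₀ (hb0 _) (hbB _) 2) (h3.trans h4) (sq_nonneg _)
        (sq_nonneg _)
    · have hTB : T ∈ B := hT
      rw [Set.indicator_of_mem hTB, (hng _ hT).1, (hng _ hT).2]
      have : quad (0 : Matrix (Tup n d) (Tup n d) ℝ) (mvec d x) = 0 := by simp [quad]
      rw [this]
      norm_num
      exact hp.le
  have hind : Integrable (B.indicator fun _ => (1 : ℝ)) (unif n k) :=
    (integrable_const 1).indicator hBm
  calc ∫ T, (1 + quad (A (cell η T)) (mvec d x)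
      + b (cell η T) * ((∑ a, T a * tensorPow k x a) - obj)) ^ 2 ∂(unif n k)
      ≤ ∫ T, (p + B.indicator (fun _ => (1 : ℝ)) T) ∂(unif n k) :=
        integral_mono_of_nonneg (Filter.Eventually.of_forall fun T => sq_nonneg _)
          ((integrable_const p).add hind) (Filter.Eventually.of_forall hpt)
    _ = p + (unif n k).real B := by
        rw [integral_add (integrable_const p) hind, integral_const, probReal_univ, one_smul,
          integral_indicator hBm, setIntegral_const, smul_eq_mul, mul_one]
    _ ≤ 2 * p := by linarith

end Cells

/-! ### Choice of parameters and the contradiction. -/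

section Distinguisher

variable {n d k D : ℕ} {obj lam ρ : ℝ}

theorem two_le_cast_pow (hn : 2 ≤ n) (hd : 1 ≤ d) : (2 : ℝ) ≤ (n : ℝ) ^ d := by
  have h2 : (2 : ℝ) ≤ n := by exact_mod_cast hn
  calc (2 : ℝ) = 2 ^ 1 := by norm_num
    _ ≤ 2 ^ d := pow_le_pow_right₀ (by norm_num) hd
    _ ≤ (n : ℝ) ^ d := pow_le_pow_left₀ (by norm_num) h2 d

theorem succ_le_cast_pow (hn : 2 ≤ n) (d : ℕ) : (d : ℝ) + 1 ≤ (n : ℝ) ^ d := by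
  have h2 : (2 : ℝ) ≤ n := by exact_mod_cast hn
  have h3 : (d : ℝ) + 1 ≤ 2 ^ d := by exact_mod_cast Nat.lt_two_pow_self (n := d)
  exact h3.trans (pow_le_pow_left₀ (by norm_num) h2 d)

theorem card_tup_le (hn : 2 ≤ n) (d : ℕ) : (Fintype.card (Tup n d) : ℝ) ≤ ((n : ℝ) ^ d) ^ 2 := by
  have h1 : (1 : ℝ) ≤ n := by exact_mod_cast (by omega : 1 ≤ n)
  have h : (Fintype.card (Tup n d) : ℝ) = ∑ m : Fin (d + 1), (n : ℝ) ^ (m : ℕ) := by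
    rw [Fintype.card_sigma]; push_cast; simp
  rw [h]
  calc ∑ m : Fin (d + 1), (n : ℝ) ^ (m : ℕ) ≤ ∑ _m : Fin (d + 1), (n : ℝ) ^ d :=
        Finset.sum_le_sum fun m _ => pow_le_pow_right₀ h1 (by omega)
    _ = ((d : ℝ) + 1) * (n : ℝ) ^ d := by simp
    _ ≤ _ := by
        rw [pow_two]
        exact mul_le_mul_of_nonneg_right (succ_le_cast_pow hn d) (by positivity)

theorem log_two_mul_le (hn : 2 ≤ n) (hd : 1 ≤ d) : (0.69 : ℝ) ≤ d * Real.log n := by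
  have h2 : (2 : ℝ) ≤ n := by exact_mod_cast hn
  have h3 : Real.log 2 ≤ Real.log n := Real.log_le_log (by norm_num) h2
  have h4 := Real.log_two_gt_d9
  have h5 : (1 : ℝ) ≤ d := by exact_mod_cast hd
  nlinarith

theorem exp_mul_log (hn : 2 ≤ n) (d m : ℕ) :
    Real.exp (m * (d * Real.log n)) = ((n : ℝ) ^ d) ^ m := by
  have h2 : (0 : ℝ) < n := by exact_mod_cast (by omega : 0 < n)
  rw [Real.exp_nat_mul, Real.exp_nat_mul, Real.exp_log h2]

/-- Bounded refutations of random instances give a low-degree spectral distinguisher. -/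
theorem exists_distinguisher (hn : 2 ≤ n) (hd : 1 ≤ d) (hk : k ≤ 2 * d) (hD : 1 ≤ D)
    (hρ0 : 0 ≤ ρ) (hρ1 : ρ ≤ 1) (hρD : ρ ^ D ≤ ((n : ℝ) ^ d)⁻¹ ^ 1000) (hobj : 0 ≤ obj)
    (hlam : 0 ≤ lam) (hm : 2 * √(600 * (d * Real.log n)) ≤ ρ * lam - obj)
    (h : unif n k {T | ¬ RefutableWithin d obj ((n : ℝ) ^ (100 * d)) T}
      ≤ ENNReal.ofReal (1 / (n : ℝ) ^ (8 * (100 * d)))) :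
    ∃ Q : Matrix (Tup n d) (Tup n d) (MvPolynomial (Idx n k) ℝ),
      HasInstDegreeLE Q (2 * D) ∧ Distinguishes lam ((n : ℝ) ^ (50 * d)) Q := by
  by_contra hcon
  push Not at hcon
  -- A balanced flattening, possible since `k ≤ 2 d`.
  obtain ⟨k₁, k₂, rfl, h₁, h₂⟩ : ∃ k₁ k₂, k = k₁ + k₂ ∧ k₁ ≤ d ∧ k₂ ≤ d :=
    ⟨k / 2, k - k / 2, by omega, by omega, by omega⟩
  have hn0 : (0 : ℝ) < n := by exact_mod_cast (by omega : 0 < n)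
  have hn2 : (2 : ℝ) ≤ n := by exact_mod_cast hn
  set x : ℝ := (n : ℝ) ^ d with hx
  have hx2 : 2 ≤ x := two_le_cast_pow hn hd
  have hx0 : 0 < x := by linarith
  have hx1 : 1 ≤ x := by linarith
  have hL := log_two_mul_le hn hd
  -- The factor `600` makes the Gaussian tail `exp (-κ² / 2)` equal to `x ^ (-300)`, enough to beat
  -- the factor `R Bd² = x ^ 250`.
  set κ := √(600 * (d * Real.log n)) with hκ
  have hκsq : κ ^ 2 = 600 * (d * Real.log n) := Real.sq_sqrt (by linarith)
  have hκ2 : 2 ≤ κ := Real.le_sqrt_of_sq_le (by linarith)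
  have hexp : Real.exp (-(κ ^ 2 / 2)) = x⁻¹ ^ 300 := by
    rw [Real.exp_neg, inv_pow, hx, ← exp_mul_log hn d 300, hκsq]
    congr 2; push_cast; ring
  have hκx : κ ≤ x ^ 12 := by
    have h1 : κ ≤ κ ^ 2 := by nlinarith
    have h3 : Real.log n ≤ n := (Real.log_le_sub_one_of_pos hn0).trans (by linarith)
    have h4 : (d : ℝ) ≤ x := by linarith [succ_le_cast_pow hn d]
    have h5 : (n : ℝ) ≤ x := by
      calc (n : ℝ) = (n : ℝ) ^ 1 := (pow_one _).symm
        _ ≤ _ := pow_le_pow_right₀ (by linarith) hd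
    have h6 : (d : ℝ) * Real.log n ≤ x * x :=
      mul_le_mul h4 (h3.trans h5) (Real.log_nonneg (by linarith)) hx0.le
    have h7 : (2 : ℝ) ^ 10 ≤ x ^ 10 := pow_le_pow_left₀ (by norm_num) hx2 10
    calc κ ≤ 600 * (d * Real.log n) := by rw [← hκsq]; exact h1
      _ ≤ x ^ 10 * (x * x) := mul_le_mul (by linarith) h6 (by linarith) (by positivity)
      _ = x ^ 12 := by ring
  have hR : (n : ℝ) ^ (50 * d) = x ^ 50 := by rw [hx, ← pow_mul, mul_comm]
  have hBd : (n : ℝ) ^ (100 * d) = x ^ 100 := by rw [hx, ← pow_mul, mul_comm]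
  have hp : 1 / (n : ℝ) ^ (8 * (100 * d)) = x⁻¹ ^ 800 := by
    rw [hx, inv_pow, ← pow_mul, one_div]; congr 2; ring
  have hnk : (n : ℝ) ^ (k₁ + k₂) ≤ x ^ 2 := by
    rw [hx, ← pow_mul]; exact pow_le_pow_right₀ (by linarith) (by omega)
  have hn1 : ((n : ℝ) + 1) ^ (2 * d) ≤ x ^ 4 := by
    have : (n : ℝ) + 1 ≤ (n : ℝ) ^ 2 := by nlinarith
    calc _ ≤ ((n : ℝ) ^ 2) ^ (2 * d) := pow_le_pow_left₀ (by positivity) this _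
      _ = x ^ 4 := by rw [hx, ← pow_mul, ← pow_mul]; congr 1; ring
  rw [hBd, hp] at h
  rw [hR] at hcon
  obtain ⟨A, b, hAm, hbm, hA, hAB, hb0, hbB, hdef⟩ :=
    exists_measurable_certificate (by positivity) (by positivity) h
  -- No upper bound on `lam` is assumed; a larger signal would already be detected by one entry.
  have hlam2 := lam_sq_le (by omega) (by omega : 2 ≤ 2 * D) hcon
  have hlamx : lam ≤ x ^ 26 := by
    refine le_of_sq_le_sq ?_ (by positivity)
    calc lam ^ 2 ≤ x ^ 50 * (n : ℝ) ^ (k₁ + k₂) := hlam2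
      _ ≤ x ^ 50 * x ^ 2 := mul_le_mul_of_nonneg_left hnk (by positivity)
      _ = (x ^ 26) ^ 2 := by ring
  have hmain := half_le_of_not_distinguishes (σ := √(1 - ρ ^ 2)) (by omega) h₁ h₂ hD
    (by rw [Real.sq_sqrt (by nlinarith)]; ring) hρ0 (Real.sqrt_nonneg _) hAm hbm hA hAB hb0 hbB hκ2
    (by positivity : (0 : ℝ) < x ^ 50) (by positivity) hobj (by linarith) hlam hcon
    (fun s => hdef _ (sum_signVec_sq (by omega) s))
  rw [hexp] at hmain
  set y := x⁻¹ with hy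
  have hy0 : 0 < y := by positivity
  have hxy : x * y = 1 := mul_inv_cancel₀ hx0.ne'
  have hyh : y ≤ 1 / 2 := by rw [hy, one_div]; exact inv_anti₀ (by norm_num) hx2
  -- From here on, every error term is a positive power of `x` times a larger power of `y = x⁻¹ ≤ 1
  -- / 2`, and together they stay below `1 / 2`.
  have hcancel : ∀ a c : ℕ, x ^ a * y ^ (a + c) = y ^ c := by
    intro a c; rw [pow_add, ← mul_assoc, ← mul_pow, hxy, one_pow, one_mul]
  have hsmall : ∀ c : ℕ, 10 ≤ c → y ^ c ≤ 1 / 1024 := by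
    intro c hc
    calc y ^ c ≤ y ^ 10 := pow_le_pow_of_le_one hy0.le (by linarith) hc
      _ ≤ (1 / 2) ^ 10 := pow_le_pow_left₀ hy0.le hyh 10
      _ = 1 / 1024 := by norm_num
  have hcomb : ∀ {u v : ℝ}, u ≤ 1 / 1024 → v ≤ 1 / 1024 → u + 4 * v ≤ 5 / 1024 := by
    intros; linarith
  have hdbl : ∀ {u : ℝ}, u ≤ 1 / 1024 → 2 * u ≤ 2 / 1024 := by intros; linarith
  have hδ0 : 0 ≤ ρ ^ D := pow_nonneg hρ0 D
  have hN := card_tup_le hn d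
  set N : ℝ := (Fintype.card (Tup n d) : ℝ)
  have hN0 : 0 ≤ N := Nat.cast_nonneg _
  have hpoly : N ^ 2 + κ * N + 2 * (n : ℝ) ^ (k₁ + k₂) ≤ 4 * x ^ 14 := by
    have g1 : N ^ 2 ≤ x ^ 14 := by
      calc N ^ 2 ≤ (x ^ 2) ^ 2 := pow_le_pow_left₀ hN0 hN 2
        _ = x ^ 4 := by ring
        _ ≤ x ^ 14 := pow_le_pow_right₀ hx1 (by norm_num)
    have g2 : κ * N ≤ x ^ 14 := by
      calc κ * N ≤ x ^ 12 * x ^ 2 := mul_le_mul hκx hN hN0 (by positivity)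
        _ = x ^ 14 := by ring
    have g3 : x ^ 2 ≤ x ^ 14 := pow_le_pow_right₀ hx1 (by norm_num)
    linarith
  have hd1 : (d : ℝ) + 1 ≤ x := succ_le_cast_pow hn d
  have t0 : ρ ^ D * x ^ 100 ≤ y ^ 900 := by
    calc ρ ^ D * x ^ 100 ≤ y ^ 1000 * x ^ 100 := mul_le_mul_of_nonneg_right hρD (by positivity)
      _ = y ^ 900 := by rw [mul_comm]; exact hcancel 100 900
  have t1 : ((d : ℝ) + 1) * (x ^ 50 * (x ^ 100 * y ^ 300
      + (N ^ 2 + κ * N + 2 * (n : ℝ) ^ (k₁ + k₂)) * (ρ ^ D * x ^ 100))) ≤ 5 / 1024 := by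
    calc _ ≤ x * (x ^ 50 * (x ^ 100 * y ^ 300 + 4 * x ^ 14 * y ^ 900)) := by gcongr
      _ = x ^ 151 * y ^ 300 + 4 * (x ^ 65 * y ^ 900) := by
          generalize y ^ 300 = u; generalize y ^ 900 = v; ring
      _ ≤ 5 / 1024 := by
          rw [hcancel 151 149, hcancel 65 835]; exact hcomb (hsmall 149 (by norm_num)) (hsmall 835 (by norm_num))
  have t2 : 2 * lam * (x ^ 50 * (ρ ^ D * x ^ 100)) ≤ 2 / 1024 := by
    calc _ ≤ 2 * x ^ 26 * (x ^ 50 * y ^ 900) :=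
          mul_le_mul (mul_le_mul_of_nonneg_left hlamx two_pos.le)
            (mul_le_mul_of_nonneg_left t0 (pow_nonneg hx0.le 50))
            (mul_nonneg (pow_nonneg hx0.le 50) (mul_nonneg hδ0 (pow_nonneg hx0.le 100)))
            (mul_nonneg two_pos.le (pow_nonneg hx0.le 26))
      _ = 2 * (x ^ 76 * y ^ 900) := by generalize y ^ 900 = v; ring
      _ ≤ 2 / 1024 := by rw [hcancel 76 824]; exact hdbl (hsmall 824 (by norm_num))
  have t3 : 2 * (x ^ 50 * (x ^ 100) ^ 2) * y ^ 300 ≤ 2 / 1024 := by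
    calc _ = 2 * (x ^ 250 * y ^ 300) := by generalize y ^ 300 = v; ring
      _ ≤ 2 / 1024 := by rw [hcancel 250 50]; exact hdbl (hsmall 50 (by norm_num))
  have t4 : ((n : ℝ) + 1) ^ (2 * d) * (x ^ 50 * (2 * y ^ 800)) ≤ 2 / 1024 := by
    calc _ ≤ x ^ 4 * (x ^ 50 * (2 * y ^ 800)) := by gcongr
      _ = 2 * (x ^ 54 * y ^ 800) := by generalize y ^ 800 = v; ring
      _ ≤ 2 / 1024 := by rw [hcancel 54 746]; exact hdbl (hsmall 746 (by norm_num))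
  linarith

end Distinguisher

/-! ### Homogenisation and division by `‖x‖² - 1`. -/

section Homogenisation

variable {n : ℕ}

/-- The polynomial `‖x‖²`. -/
def normSq (n : ℕ) : MvPolynomial (Fin n) ℝ := ∑ i, MvPolynomial.X i ^ 2

theorem spherePoly_eq : spherePoly n = normSq n - 1 := rfl

theorem eval_normSq (x : Fin n → ℝ) : MvPolynomial.eval x (normSq n) = ∑ i, x i ^ 2 := by
  simp [normSq, map_sum, map_pow]

theorem normSq_isHomogeneous : (normSq n).IsHomogeneous 2 :=
  MvPolynomial.IsHomogeneous.sum _ _ _ fun i _ => MvPolynomial.isHomogeneous_X_pow i 2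

/-- The homogenisation, of degree `r`, by powers of `‖x‖²` of the part of a polynomial whose degrees
have the parity of `r`. -/
def homog (r : ℕ) (p : MvPolynomial (Fin n) ℝ) : MvPolynomial (Fin n) ℝ :=
  ∑ m ∈ (Finset.range (r + 1)).filter (fun m => (r - m) % 2 = 0),
    normSq n ^ ((r - m) / 2) * MvPolynomial.homogeneousComponent m p

theorem homog_isHomogeneous (r : ℕ) (p : MvPolynomial (Fin n) ℝ) :
    (homog r p).IsHomogeneous r := by
  refine MvPolynomial.IsHomogeneous.sum _ _ _ fun m hm => ?_
  rw [Finset.mem_filter, Finset.mem_range] at hm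
  have := (normSq_isHomogeneous (n := n).pow ((r - m) / 2)).mul
    (MvPolynomial.homogeneousComponent_isHomogeneous m p)
  convert this using 1
  omega

theorem IsHomogeneous.eval_smul {p : MvPolynomial (Fin n) ℝ} {r : ℕ} (hp : p.IsHomogeneous r)
    (c : ℝ) (x : Fin n → ℝ) :
    MvPolynomial.eval (fun i => c * x i) p = c ^ r * MvPolynomial.eval x p := by
  rw [MvPolynomial.eval_eq', MvPolynomial.eval_eq', Finset.mul_sum]
  refine Finset.sum_congr rfl fun e he => ?_
  simp_rw [mul_pow, Finset.prod_mul_distrib, Finset.prod_pow_eq_pow_sum]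
  have : ∑ i, e i = r := by
    rw [hp.degree_eq_sum_deg_support he]
    exact (Finset.sum_subset (Finset.subset_univ _) fun i _ hi => by simpa using hi).symm
  rw [this]; ring

theorem sum_parity_range (r : ℕ) (f : ℕ → ℝ) :
    ∑ m ∈ (Finset.range (r + 1 + 1)).filter (fun m => (r + 1 - m) % 2 = 0), f m
      + ∑ m ∈ (Finset.range (r + 1)).filter (fun m => (r - m) % 2 = 0), f m
      = ∑ m ∈ Finset.range (r + 1 + 1), f m := by
  rw [← Finset.sum_filter_add_sum_filter_not (Finset.range (r + 1 + 1))
    (fun m => (r + 1 - m) % 2 = 0)]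
  congr 1
  refine Finset.sum_congr ?_ fun _ _ => rfl
  ext m
  simp only [Finset.mem_filter, Finset.mem_range]
  omega

theorem eval_homog {r : ℕ} (p : MvPolynomial (Fin n) ℝ) {x : Fin n → ℝ}
    (hx : ∑ i, x i ^ 2 = 1) :
    MvPolynomial.eval x (homog r p)
      = ∑ m ∈ (Finset.range (r + 1)).filter (fun m => (r - m) % 2 = 0),
        MvPolynomial.eval x (MvPolynomial.homogeneousComponent m p) := by
  rw [homog, map_sum]
  refine Finset.sum_congr rfl fun m _ => ?_
  rw [MvPolynomial.eval_mul, map_pow, eval_normSq, hx, one_pow, one_mul]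

/-- The components of degrees at most `r + 1` split by parity, and powers of `‖x‖²` are invisible on
the sphere. -/
theorem eval_homog_add {r : ℕ} {p : MvPolynomial (Fin n) ℝ} (hp : p.totalDegree ≤ r + 1)
    {x : Fin n → ℝ} (hx : ∑ i, x i ^ 2 = 1) :
    MvPolynomial.eval x (homog (r + 1) p) + MvPolynomial.eval x (homog r p)
      = MvPolynomial.eval x p := by
  rw [eval_homog p hx, eval_homog p hx, sum_parity_range]
  conv_rhs => rw [← MvPolynomial.sum_homogeneousComponent p, map_sum]
  refine (Finset.sum_subset (Finset.range_mono (by omega)) fun m _ hm => ?_).symm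
  rw [Finset.mem_range] at hm
  rw [MvPolynomial.homogeneousComponent_eq_zero m p (by omega), map_zero]

theorem eval_neg_homog (r : ℕ) (p : MvPolynomial (Fin n) ℝ) (x : Fin n → ℝ) :
    MvPolynomial.eval (fun i => -x i) (homog r p) = (-1) ^ r * MvPolynomial.eval x (homog r p) := by
  have := IsHomogeneous.eval_smul (homog_isHomogeneous r p) (-1) x
  simpa using this

theorem sum_neg_sq {x : Fin n → ℝ} (hx : ∑ i, x i ^ 2 = 1) : ∑ i, (-x i) ^ 2 = 1 := by
  simpa using hx

/-- Points are multiples of points of the sphere. -/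
theorem exists_sphere_smul (hn : 0 < n) (x : Fin n → ℝ) :
    ∃ u : Fin n → ℝ, ∑ i, u i ^ 2 = 1 ∧ ∀ i, x i = √(∑ i, x i ^ 2) * u i := by
  rcases (Real.sqrt_nonneg (∑ i, x i ^ 2)).eq_or_lt with h | h
  · refine ⟨signVec fun _ => true, sum_signVec_sq hn _, fun i => ?_⟩
    have hs : ∑ i, x i ^ 2 = 0 := by
      rwa [eq_comm, Real.sqrt_eq_zero (Finset.sum_nonneg fun a _ => sq_nonneg _)] at h
    have := (Finset.sum_eq_zero_iff_of_nonneg fun a _ => sq_nonneg (x a)).1 hs i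
      (Finset.mem_univ i)
    rw [← h, zero_mul]
    simpa using this
  · refine ⟨fun i => x i / √(∑ i, x i ^ 2), ?_, fun i => by field_simp⟩
    simp_rw [div_pow]
    rw [← Finset.sum_div, Real.sq_sqrt (Finset.sum_nonneg fun a _ => sq_nonneg _), div_self]
    intro h0
    rw [h0, Real.sqrt_zero] at h
    exact lt_irrefl _ h

theorem eq_zero_of_eval_sphere_eq_zero (hn : 0 < n) {r : ℕ} {p : MvPolynomial (Fin n) ℝ}
    (hp : p.IsHomogeneous r)
    (h : ∀ x : Fin n → ℝ, ∑ i, x i ^ 2 = 1 → MvPolynomial.eval x p = 0) : p = 0 := by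
  refine MvPolynomial.funext fun x => ?_
  obtain ⟨u, hu, hxu⟩ := exists_sphere_smul hn x
  rw [funext hxu, IsHomogeneous.eval_smul hp, h u hu, mul_zero, map_zero]

/-- Evaluation at `x` and `-x` separates the two parities, and a homogeneous polynomial that
vanishes on the sphere vanishes. -/
theorem homog_eq_zero (hn : 0 < n) {r : ℕ} {p : MvPolynomial (Fin n) ℝ}
    (hp : p.totalDegree ≤ r + 1)
    (h : ∀ x : Fin n → ℝ, ∑ i, x i ^ 2 = 1 → MvPolynomial.eval x p = 0) :
    homog (r + 1) p = 0 ∧ homog r p = 0 := by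
  have h1 : ∀ x : Fin n → ℝ, ∑ i, x i ^ 2 = 1 →
      MvPolynomial.eval x (homog (r + 1) p) = 0 ∧ MvPolynomial.eval x (homog r p) = 0 := by
    intro x hx
    have e1 := eval_homog_add hp hx
    have e2 := eval_homog_add hp (sum_neg_sq hx)
    rw [h x hx] at e1
    rw [h _ (sum_neg_sq hx), eval_neg_homog, eval_neg_homog, pow_succ] at e2
    rcases neg_one_pow_eq_or ℝ r with hr | hr <;> rw [hr] at e2 <;> constructor <;> linarith
  exact ⟨eq_zero_of_eval_sphere_eq_zero hn (homog_isHomogeneous _ _) fun x hx => (h1 x hx).1,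
    eq_zero_of_eval_sphere_eq_zero hn (homog_isHomogeneous _ _) fun x hx => (h1 x hx).2⟩

/-- The quotient by `‖x‖² - 1` of a polynomial of degree at most `r + 1` that vanishes on the
sphere. -/
def sphereQuot (r : ℕ) (p : MvPolynomial (Fin n) ℝ) : MvPolynomial (Fin n) ℝ :=
  -∑ j ∈ Finset.range (r + 2), ∑ i ∈ Finset.range ((r + 1 - j) / 2),
    normSq n ^ i * MvPolynomial.homogeneousComponent j p

/-- Both homogenisations of `p` vanish, so `p` is the sum of `p_j - ‖x‖^(2 i) p_j` over its
components, with `i = (r + 1 - j) / 2`, and each summand is divisible by `1 - ‖x‖²` through a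
geometric sum. Rounding in the division by two makes one formula serve both parities. -/
theorem sphereQuot_mul (hn : 0 < n) {r : ℕ} {p : MvPolynomial (Fin n) ℝ}
    (hp : p.totalDegree ≤ r + 1)
    (h : ∀ x : Fin n → ℝ, ∑ i, x i ^ 2 = 1 → MvPolynomial.eval x p = 0) :
    sphereQuot r p * spherePoly n = p := by
  obtain ⟨h1, h2⟩ := homog_eq_zero hn hp h
  have h3 : ∑ j ∈ Finset.range (r + 2),
      normSq n ^ ((r + 1 - j) / 2) * MvPolynomial.homogeneousComponent j p = 0 := by
    rw [← Finset.sum_filter_add_sum_filter_not (Finset.range (r + 2))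
      (fun m => (r + 1 - m) % 2 = 0)]
    have h4 : ∑ m ∈ (Finset.range (r + 2)).filter (fun m => ¬ (r + 1 - m) % 2 = 0),
        normSq n ^ ((r + 1 - m) / 2) * MvPolynomial.homogeneousComponent m p = homog r p := by
      rw [homog]
      refine Finset.sum_congr ?_ fun m hm => ?_
      · ext m
        simp only [Finset.mem_filter, Finset.mem_range]
        omega
      · simp only [Finset.mem_filter, Finset.mem_range] at hm
        congr 2
        omega
    have h5 : ∑ m ∈ (Finset.range (r + 2)).filter (fun m => (r + 1 - m) % 2 = 0),
        normSq n ^ ((r + 1 - m) / 2) * MvPolynomial.homogeneousComponent m p = homog (r + 1) p :=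
      rfl
    rw [h4, h5, h1, h2, add_zero]
  have h6 : ∑ j ∈ Finset.range (r + 2), MvPolynomial.homogeneousComponent j p = p := by
    conv_rhs => rw [← MvPolynomial.sum_homogeneousComponent p]
    refine (Finset.sum_subset (Finset.range_mono (by omega)) fun m _ hm => ?_).symm
    rw [Finset.mem_range] at hm
    exact MvPolynomial.homogeneousComponent_eq_zero m p (by omega)
  have h7 : sphereQuot r p * spherePoly n = ∑ j ∈ Finset.range (r + 2),
      (MvPolynomial.homogeneousComponent j p
        - normSq n ^ ((r + 1 - j) / 2) * MvPolynomial.homogeneousComponent j p) := by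
    rw [sphereQuot, neg_mul, Finset.sum_mul, ← Finset.sum_neg_distrib]
    refine Finset.sum_congr rfl fun j _ => ?_
    rw [← Finset.sum_mul, spherePoly_eq]
    linear_combination (-MvPolynomial.homogeneousComponent j p)
      * geom_sum_mul (normSq n) ((r + 1 - j) / 2)
  rw [h7, Finset.sum_sub_distrib, h3, h6, sub_zero]

theorem totalDegree_sphereQuot {r : ℕ} (hr : 1 ≤ r) (p : MvPolynomial (Fin n) ℝ) :
    (sphereQuot r p).totalDegree ≤ r - 1 := by
  rw [sphereQuot, MvPolynomial.totalDegree_neg]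
  refine MvPolynomial.totalDegree_finsetSum_le fun j hj =>
    MvPolynomial.totalDegree_finsetSum_le fun i hi => ?_
  rw [Finset.mem_range] at hi hj
  have := ((normSq_isHomogeneous (n := n).pow i).mul
    (MvPolynomial.homogeneousComponent_isHomogeneous j p)).totalDegree_le
  omega

end Homogenisation

/-! ### Degree and coefficient bounds. -/

section Coefficients

variable {n : ℕ}

theorem abs_coeff_normSq_mul_le {p : MvPolynomial (Fin n) ℝ} {M : ℝ}
    (h : ∀ m, |p.coeff m| ≤ M) (m : Fin n →₀ ℕ) : |(normSq n * p).coeff m| ≤ n * M := by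
  have hM : 0 ≤ M := (abs_nonneg _).trans (h 0)
  rw [normSq, Finset.sum_mul, MvPolynomial.coeff_sum]
  refine (Finset.abs_sum_le_sum_abs _ _).trans
    ((Finset.sum_le_card_nsmul _ _ M fun i _ => ?_).trans (by simp))
  rw [mul_comm, MvPolynomial.X_pow_eq_monomial, MvPolynomial.coeff_mul_monomial', mul_one]
  split_ifs
  · exact h _
  · simpa using hM

theorem abs_coeff_normSq_pow_mul_le {p : MvPolynomial (Fin n) ℝ} {M : ℝ}
    (h : ∀ m, |p.coeff m| ≤ M) (i : ℕ) (m : Fin n →₀ ℕ) :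
    |(normSq n ^ i * p).coeff m| ≤ (n : ℝ) ^ i * M := by
  induction i generalizing m with
  | zero => simpa using h m
  | succ i ih =>
    rw [pow_succ', mul_assoc, pow_succ', mul_assoc]
    exact abs_coeff_normSq_mul_le ih m

theorem abs_coeff_homogeneousComponent_le {p : MvPolynomial (Fin n) ℝ} {M : ℝ}
    (h : ∀ m, |p.coeff m| ≤ M) (j : ℕ) (m : Fin n →₀ ℕ) :
    |(MvPolynomial.homogeneousComponent j p).coeff m| ≤ M := by
  have hM : 0 ≤ M := (abs_nonneg _).trans (h 0)
  rw [MvPolynomial.coeff_homogeneousComponent]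
  split_ifs
  · exact h _
  · simpa using hM

theorem abs_coeff_sphereQuot_le (hn : 0 < n) {p : MvPolynomial (Fin n) ℝ} {M : ℝ}
    (h : ∀ m, |p.coeff m| ≤ M) (r : ℕ) (m : Fin n →₀ ℕ) :
    |(sphereQuot r p).coeff m| ≤ ((r : ℝ) + 2) * ((r + 1) * ((n : ℝ) ^ (r / 2) * M)) := by
  have hM : 0 ≤ M := (abs_nonneg _).trans (h 0)
  have hn1 : (1 : ℝ) ≤ n := by exact_mod_cast hn
  rw [sphereQuot, MvPolynomial.coeff_neg, abs_neg, MvPolynomial.coeff_sum]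
  refine (Finset.abs_sum_le_sum_abs _ _).trans
    ((Finset.sum_le_card_nsmul _ _ ((r + 1) * ((n : ℝ) ^ (r / 2) * M)) fun j _ => ?_).trans
      (by simp))
  rw [MvPolynomial.coeff_sum]
  refine (Finset.abs_sum_le_sum_abs _ _).trans
    ((Finset.sum_le_card_nsmul _ _ ((n : ℝ) ^ (r / 2) * M) fun i hi => ?_).trans ?_)
  · refine (abs_coeff_normSq_pow_mul_le (abs_coeff_homogeneousComponent_le h j) i m).trans ?_
    refine mul_le_mul_of_nonneg_right (pow_le_pow_right₀ hn1 ?_) hM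
    rw [Finset.mem_range] at hi
    omega
  · rw [nsmul_eq_mul, Finset.card_range]
    refine mul_le_mul_of_nonneg_right ?_ (by positivity)
    exact_mod_cast (by omega : (r + 1 - j) / 2 ≤ r + 1)

/-- The exponents of a tuple. -/
def tupExp {m : ℕ} (t : Fin m → Fin n) : Fin n →₀ ℕ := ∑ j, Finsupp.single (t j) 1

theorem prod_X_eq_monomial {m : ℕ} (t : Fin m → Fin n) :
    ∏ j, (MvPolynomial.X (t j) : MvPolynomial (Fin n) ℝ)
      = MvPolynomial.monomial (tupExp t) 1 := by
  rw [tupExp, MvPolynomial.monomial_sum_one]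
  rfl

theorem abs_coeff_gramPoly_le {d : ℕ} {A : Matrix (Tup n d) (Tup n d) ℝ} {M : ℝ}
    (h : ∀ s t, |A s t| ≤ M) (m : Fin n →₀ ℕ) :
    |(gramPoly A).coeff m| ≤ (Fintype.card (Tup n d) : ℝ) ^ 2 * M := by
  have hM : 0 ≤ M := (abs_nonneg _).trans (h (emptyTup n d) (emptyTup n d))
  rw [gramPoly, MvPolynomial.coeff_sum]
  refine (Finset.abs_sum_le_sum_abs _ _).trans
    ((Finset.sum_le_card_nsmul _ _ (Fintype.card (Tup n d) * M) fun s _ => ?_).trans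
      (le_of_eq (by rw [nsmul_eq_mul, Finset.card_univ]; ring)))
  rw [MvPolynomial.coeff_sum]
  refine (Finset.abs_sum_le_sum_abs _ _).trans
    ((Finset.sum_le_card_nsmul _ _ M fun t _ => ?_).trans
      (le_of_eq (by rw [nsmul_eq_mul, Finset.card_univ])))
  rw [MvPolynomial.coeff_C_mul, tupMonomial, tupMonomial, prod_X_eq_monomial, prod_X_eq_monomial,
    MvPolynomial.monomial_mul, MvPolynomial.coeff_monomial]
  split_ifs
  · simpa using h s t
  · simpa using hM

theorem abs_coeff_objPoly_le {k : ℕ} (obj : ℝ) (T : Tensor n k) (m : Fin n →₀ ℕ) :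
    |(objPoly obj T).coeff m| ≤ (∑ a, |T a|) + |obj| := by
  rw [objPoly, MvPolynomial.coeff_sub, MvPolynomial.coeff_sum]
  refine (abs_sub _ _).trans (add_le_add ((Finset.abs_sum_le_sum_abs _ _).trans
    (Finset.sum_le_sum fun a _ => ?_)) ?_)
  · rw [MvPolynomial.coeff_C_mul, prod_X_eq_monomial, MvPolynomial.coeff_monomial]
    split_ifs <;> simp
  · rw [MvPolynomial.coeff_C]
    split_ifs <;> simp

theorem totalDegree_prod_X_le {m : ℕ} (t : Fin m → Fin n) :
    (∏ j, (MvPolynomial.X (t j) : MvPolynomial (Fin n) ℝ)).totalDegree ≤ m := by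
  refine (MvPolynomial.totalDegree_finsetProd _ _).trans ?_
  simp [MvPolynomial.totalDegree_X]

theorem totalDegree_gramPoly_le {d : ℕ} (A : Matrix (Tup n d) (Tup n d) ℝ) :
    (gramPoly A).totalDegree ≤ 2 * d := by
  refine MvPolynomial.totalDegree_finsetSum_le fun s _ =>
    MvPolynomial.totalDegree_finsetSum_le fun t _ => (totalDegree_C_mul_le _ _).trans
      ((MvPolynomial.totalDegree_mul _ _).trans ?_)
  have h1 := totalDegree_prod_X_le s.2
  have h2 := totalDegree_prod_X_le t.2
  have := s.1.2
  have := t.1.2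
  simp only [tupMonomial]
  omega

theorem totalDegree_objPoly_le {k : ℕ} (obj : ℝ) (T : Tensor n k) :
    (objPoly obj T).totalDegree ≤ k := by
  refine (MvPolynomial.totalDegree_sub _ _).trans (max_le ?_ (by simp))
  exact MvPolynomial.totalDegree_finsetSum_le fun a _ => (totalDegree_C_mul_le _ _).trans
    (totalDegree_prod_X_le a)

end Coefficients

/-! ### Coefficients from values on the sphere, by Gaussian integration. -/

section GaussianCoefficients

variable {n : ℕ}

theorem sum_eq_of_mem_support {r : ℕ} {p : MvPolynomial (Fin n) ℝ} (hp : p.IsHomogeneous r)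
    {e : Fin n →₀ ℕ} (he : e ∈ p.support) : ∑ i, e i = r := by
  rw [hp.degree_eq_sum_deg_support he]
  exact (Finset.sum_subset (Finset.subset_univ _) fun i _ hi => by simpa using hi).symm

/-- Coefficients of homogeneous polynomials are Gaussian inner products with Hermite
polynomials. -/
theorem integral_mul_mvHe {r : ℕ} {p : MvPolynomial (Fin n) ℝ} (hp : p.IsHomogeneous r)
    {e : Fin n →₀ ℕ} (he : ∑ i, e i = r) :
    ∫ g, MvPolynomial.eval g p * MvPolynomial.eval g (mvHe e) ∂(stdG (Fin n))
      = p.coeff e * ∏ i, ((e i).factorial : ℝ) := by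
  classical
  have hmono : ∀ e' : Fin n →₀ ℕ, ∀ g : Fin n → ℝ,
      (∏ i, g i ^ e' i) * MvPolynomial.eval g (mvHe e)
        = ∏ i, (g i ^ e' i * (He (e i)).eval (g i)) := by
    intro e' g
    rw [eval_mvHe, Finset.prod_mul_distrib]
  have hint : ∀ e' : Fin n →₀ ℕ, Integrable (fun g : Fin n → ℝ =>
      p.coeff e' * ((∏ i, g i ^ e' i) * MvPolynomial.eval g (mvHe e))) (stdG (Fin n)) := by
    intro e'
    have := integrable_mvEval (MvPolynomial.monomial e' (p.coeff e') * mvHe e)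
    refine this.congr (Filter.Eventually.of_forall fun g => ?_)
    simp only [MvPolynomial.eval_mul, MvPolynomial.eval_monomial]
    rw [Finsupp.prod_fintype _ _ (by simp), mul_assoc]
  have hval : ∀ e' : Fin n →₀ ℕ, ∑ i, e' i = r →
      ∫ g : Fin n → ℝ, (∏ i, g i ^ e' i) * MvPolynomial.eval g (mvHe e) ∂(stdG (Fin n))
        = if e' = e then ∏ i, ((e i).factorial : ℝ) else 0 := by
    intro e' he'
    simp_rw [hmono]
    rw [integral_fintype_prod_eq_prod (fun i x => x ^ e' i * (He (e i)).eval x)]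
    split_ifs with h
    · subst h
      exact Finset.prod_congr rfl fun i _ => integral_He_mul_pow _
    -- Distinct exponents of equal total degree: in some coordinate the power is lower than the
    -- Hermite degree, and that factor integrates to zero. Homogeneity is essential here.
    · obtain ⟨i, hi⟩ : ∃ i, e' i < e i := by
        by_contra hcon
        push Not at hcon
        refine h (Finsupp.ext fun i => ?_)
        have := (Finset.sum_eq_sum_iff_of_le fun i (_ : i ∈ Finset.univ) => hcon i).1
          (he.trans he'.symm) i (Finset.mem_univ i)
        exact this.symm
      exact Finset.prod_eq_zero (Finset.mem_univ i) (integral_He_mul_pow_of_lt hi)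
  simp_rw [MvPolynomial.eval_eq' _ p, Finset.sum_mul, mul_assoc]
  rw [integral_finsetSum _ fun e' _ => hint e']
  simp_rw [integral_const_mul]
  rw [Finset.sum_congr rfl fun e' he' => by rw [hval e' (sum_eq_of_mem_support hp he')]]
  simp only [mul_ite, mul_zero, Finset.sum_ite_eq']
  split_ifs with h
  · rfl
  · rw [MvPolynomial.notMem_support_iff.1 h, zero_mul]

/-- Cauchy–Schwarz against the Hermite polynomial with exponents `e`, whose squared norm is the
product of factorials. -/
theorem coeff_sq_mul_factorial_le {r : ℕ} {p : MvPolynomial (Fin n) ℝ} (hp : p.IsHomogeneous r)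
    {e : Fin n →₀ ℕ} (he : ∑ i, e i = r) :
    p.coeff e ^ 2 * ∏ i, ((e i).factorial : ℝ)
      ≤ ∫ g, MvPolynomial.eval g p ^ 2 ∂(stdG (Fin n)) := by
  have h1 := abs_integral_mul_le (memLp_mvEval p) (memLp_mvEval (mvHe fun i => e i))
  have h2 : l2 (stdG (Fin n)) (fun g => MvPolynomial.eval g (mvHe fun i => e i)) ^ 2
      = ∏ i, ((e i).factorial : ℝ) := by
    rw [l2_sq]
    have := integral_mvHe_mul (fun i => e i) (fun i => e i)
    rw [if_pos rfl] at this
    simpa only [pow_two] using this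
  have h3 := integral_mul_mvHe hp he
  rw [h3] at h1
  set F := ∏ i, ((e i).factorial : ℝ) with hF
  have hF0 : 0 < F := Finset.prod_pos fun i _ => by exact_mod_cast Nat.factorial_pos _
  have h4 := pow_le_pow_left₀ (abs_nonneg _) h1 2
  rw [sq_abs, mul_pow, mul_pow, h2, l2_sq] at h4
  have h5 : p.coeff e ^ 2 * F * F ≤ (∫ g, MvPolynomial.eval g p ^ 2 ∂(stdG (Fin n))) * F := by
    nlinarith
  exact le_of_mul_le_mul_right h5 hF0

/-- Bound the power by `r!` times an exponential of `‖g‖² / (4 n)`; at this scale the exponential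
moment is at most `2` in every dimension, by Bernoulli's inequality. -/
theorem integral_normSq_pow_le (hn : 0 < n) (r : ℕ) :
    ∫ g : Fin n → ℝ, (∑ i, g i ^ 2) ^ r ∂(stdG (Fin n)) ≤ 2 * (r.factorial * (4 * (n : ℝ)) ^ r) := by
  have hn1 : (1 : ℝ) ≤ n := by exact_mod_cast hn
  have hn0 : (0 : ℝ) < n := by linarith
  set s : ℝ := 1 / (4 * n) with hs
  have hs' : s < 1 / 2 := by
    rw [hs, div_lt_div_iff₀ (by positivity) (by norm_num)]; linarith
  have hpt : ∀ g : Fin n → ℝ, (∑ i, g i ^ 2) ^ r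
      ≤ (r.factorial * (4 * (n : ℝ)) ^ r) * Real.exp (s * ∑ i, g i ^ 2) := by
    intro g
    set z := ∑ i, g i ^ 2 with hz
    have hz0 : 0 ≤ z := Finset.sum_nonneg fun i _ => sq_nonneg _
    have h := Real.pow_div_factorial_le_exp (s * z) (by positivity) r
    rw [div_le_iff₀ (by positivity)] at h
    calc z ^ r = (4 * (n : ℝ)) ^ r * (s * z) ^ r := by
          rw [← mul_pow, hs]; congr 1; field_simp
      _ ≤ (4 * (n : ℝ)) ^ r * (Real.exp (s * z) * r.factorial) :=
          mul_le_mul_of_nonneg_left h (by positivity)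
      _ = _ := by ring
  have hint : Integrable (fun g : Fin n → ℝ => (∑ i, g i ^ 2) ^ r) (stdG (Fin n)) := by
    have := integrable_mvEval (normSq n ^ r)
    simpa only [map_pow, eval_normSq] using this
  have h1 := integral_mono hint ((integrable_exp_sq hs').const_mul _) hpt
  rw [integral_const_mul, integral_exp_sq hs', Fintype.card_fin] at h1
  have hq : (1 : ℝ) / 2 ≤ (1 - 2 * s) ^ n := by
    have := one_add_mul_le_pow (a := -(2 * s)) (by linarith) n
    have e : 1 + (n : ℝ) * -(2 * s) = 1 / 2 := by rw [hs]; field_simp; norm_num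
    rw [e] at this
    rwa [sub_eq_add_neg]
  have h2 : √(1 / (1 - 2 * s)) ^ n ≤ 2 := by
    have hpos : 0 < 1 - 2 * s := by linarith
    refine le_of_sq_le_sq ?_ (by norm_num)
    rw [← pow_mul, mul_comm n 2, pow_mul, Real.sq_sqrt (by positivity), div_pow, one_pow,
      div_le_iff₀ (by positivity)]
    linarith
  calc _ ≤ _ := h1
    _ ≤ (r.factorial * (4 * (n : ℝ)) ^ r) * 2 := mul_le_mul_of_nonneg_left h2 (by positivity)
    _ = _ := by ring

/-- A multinomial coefficient is at most the sum `n ^ r` of all of them. -/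
theorem factorial_le_pow_mul {r : ℕ} {e : Fin n → ℕ} (he : ∑ i, e i = r) :
    (r.factorial : ℝ) ≤ (n : ℝ) ^ r * ∏ i, ((e i).factorial : ℝ) := by
  have h1 := Nat.multinomial_spec Finset.univ e
  have h2 : Nat.multinomial Finset.univ e ≤ n ^ r := by
    have h := Finset.sum_pow_eq_sum_piAntidiag (Finset.univ : Finset (Fin n)) (fun _ => 1) r
    simp only [Finset.sum_const, Finset.card_univ, Fintype.card_fin, smul_eq_mul, mul_one, one_pow,
      Finset.prod_const_one, Nat.cast_id] at h
    rw [h]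
    exact Finset.single_le_sum (f := fun k => Nat.multinomial Finset.univ k)
      (fun _ _ => Nat.zero_le _) (by simp [Finset.mem_piAntidiag, he])
  rw [he] at h1
  rw [← h1]
  push_cast
  rw [mul_comm]
  exact mul_le_mul_of_nonneg_right (by exact_mod_cast h2) (by positivity)

/-- Homogeneous polynomials whose sum of squares is bounded on the sphere have bounded
coefficients. -/
theorem sum_coeff_sq_le (hn : 0 < n) {κ : Type} [Fintype κ] {r : ℕ}
    {p : κ → MvPolynomial (Fin n) ℝ} (hp : ∀ i, (p i).IsHomogeneous r) {C : ℝ}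
    (hC : ∀ x : Fin n → ℝ, ∑ i, x i ^ 2 = 1 → ∑ i, MvPolynomial.eval x (p i) ^ 2 ≤ C)
    (e : Fin n →₀ ℕ) :
    ∑ i, (p i).coeff e ^ 2 ≤ C * (2 * (4 * (n : ℝ) ^ 2) ^ r) := by
  have hC0 : 0 ≤ C := le_trans (Finset.sum_nonneg fun i _ => sq_nonneg _)
    (hC _ (sum_signVec_sq hn fun _ => true))
  by_cases he : ∑ i, e i = r
  · have hsq : ∀ i, Integrable (fun g => MvPolynomial.eval g (p i) ^ 2) (stdG (Fin n)) :=
      fun i => (memLp_mvEval (p i)).integrable_sq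
    -- By homogeneity the bound on the sphere extends to the whole space. Summing over `i` before
    -- integrating keeps the bound independent of the number of squares.
    have hpt : ∀ g : Fin n → ℝ, ∑ i, MvPolynomial.eval g (p i) ^ 2 ≤ C * (∑ i, g i ^ 2) ^ r := by
      intro g
      obtain ⟨u, hu, hgu⟩ := exists_sphere_smul hn g
      set z := ∑ i, g i ^ 2 with hz
      have hz0 : 0 ≤ z := Finset.sum_nonneg fun i _ => sq_nonneg _
      have h1 : ∀ i, MvPolynomial.eval g (p i) ^ 2 = z ^ r * MvPolynomial.eval u (p i) ^ 2 := by
        intro i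
        rw [funext hgu, IsHomogeneous.eval_smul (hp i), mul_pow, ← pow_mul, mul_comm r 2, pow_mul,
          Real.sq_sqrt hz0]
      simp_rw [h1]
      rw [← Finset.mul_sum, mul_comm]
      exact mul_le_mul_of_nonneg_right (hC u hu) (by positivity)
    have hint : Integrable (fun g : Fin n → ℝ => (∑ i, g i ^ 2) ^ r) (stdG (Fin n)) := by
      have := integrable_mvEval (normSq n ^ r)
      simpa only [map_pow, eval_normSq] using this
    have h2 := integral_mono (integrable_finsetSum Finset.univ fun i _ => hsq i)
      (hint.const_mul C) hpt
    rw [integral_finsetSum _ fun i _ => hsq i, integral_const_mul] at h2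
    set F := ∏ i, ((e i).factorial : ℝ) with hF
    have hF0 : 0 < F := Finset.prod_pos fun i _ => by exact_mod_cast Nat.factorial_pos _
    have h3 : (∑ i, (p i).coeff e ^ 2) * F ≤ C * (2 * (r.factorial * (4 * (n : ℝ)) ^ r)) := by
      rw [Finset.sum_mul]
      exact (Finset.sum_le_sum fun i _ => coeff_sq_mul_factorial_le (hp i) he).trans
        (h2.trans (mul_le_mul_of_nonneg_left (integral_normSq_pow_le hn r) hC0))
    have h4 : (r.factorial : ℝ) * (4 * (n : ℝ)) ^ r ≤ (4 * (n : ℝ) ^ 2) ^ r * F := by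
      calc (r.factorial : ℝ) * (4 * (n : ℝ)) ^ r ≤ (n : ℝ) ^ r * F * (4 * (n : ℝ)) ^ r :=
            mul_le_mul_of_nonneg_right (factorial_le_pow_mul he) (by positivity)
        _ = (4 * (n : ℝ) ^ 2) ^ r * F := by
            rw [show 4 * (n : ℝ) ^ 2 = n * (4 * n) by ring, mul_pow (n : ℝ)]; ring
    refine le_of_mul_le_mul_right (h3.trans ?_) hF0
    have := mul_le_mul_of_nonneg_left h4 (show (0 : ℝ) ≤ C * 2 by positivity)
    linarith
  · have : ∀ i, (p i).coeff e = 0 := by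
      intro i
      by_contra hcon
      exact he (sum_eq_of_mem_support (hp i) (MvPolynomial.mem_support_iff.2 hcon))
    simp_rw [this]
    simp
    positivity

end GaussianCoefficients

/-! ### Gram matrices with bounded entries. -/

section GramBound

variable {n d : ℕ}

theorem exists_tupExp_eq (m : ℕ) (e : Fin n →₀ ℕ) (he : ∑ i, e i = m) :
    ∃ t : Fin m → Fin n, tupExp t = e := by
  induction m generalizing e with
  | zero =>
    refine ⟨fun j => j.elim0, ?_⟩
    ext i
    have := (Finset.sum_eq_zero_iff.1 he) i (Finset.mem_univ i)
    simp [tupExp, this]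
  | succ m ih =>
    obtain ⟨i, hi⟩ : ∃ i, e i ≠ 0 := by
      by_contra hcon
      push Not at hcon
      simp [hcon] at he
    have hle : Finsupp.single i 1 ≤ e := by
      rw [Finsupp.single_le_iff]; omega
    have hadd : e - Finsupp.single i 1 + Finsupp.single i 1 = e := tsub_add_cancel_of_le hle
    obtain ⟨t, ht⟩ := ih (e - Finsupp.single i 1) (by
      have h1 : ∑ j, e j = ∑ j, (e - Finsupp.single i 1 : Fin n →₀ ℕ) j
          + ∑ j, (Finsupp.single i 1 : Fin n →₀ ℕ) j := by
        rw [← Finset.sum_add_distrib]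
        refine Finset.sum_congr rfl fun j _ => ?_
        rw [← Finsupp.add_apply, hadd]
      have h2 : ∑ j, (Finsupp.single i 1 : Fin n →₀ ℕ) j = 1 := by
        classical
        simp [Finsupp.single_apply]
      rw [he, h2] at h1
      omega)
    refine ⟨Fin.cons i t, ?_⟩
    rw [tupExp, Fin.sum_univ_succ]
    simp only [Fin.cons_zero, Fin.cons_succ]
    rw [← tupExp, ht, add_comm, hadd]

theorem mvec_eq_prod (x : Fin n → ℝ) (t : Tup n d) : mvec d x t = ∏ i, x i ^ tupExp t.2 i := by
  rw [← eval_tupMonomial, tupMonomial, prod_X_eq_monomial, MvPolynomial.eval_monomial, one_mul,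
    Finsupp.prod_fintype _ _ (by simp)]

/-- The number of tuples with given exponents. -/
def tupCount (d : ℕ) (e : Fin n →₀ ℕ) : ℕ :=
  (Finset.univ.filter fun t : Tup n d => tupExp t.2 = e).card

/-- Different tuples may give the same monomial; its coefficient is shared equally among them. -/
theorem sum_coeff_mul_mvec {p : MvPolynomial (Fin n) ℝ} (hp : p.totalDegree ≤ d)
    (x : Fin n → ℝ) :
    ∑ t : Tup n d, p.coeff (tupExp t.2) / tupCount d (tupExp t.2) * mvec d x t
      = MvPolynomial.eval x p := by
  classical
  simp_rw [mvec_eq_prod]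
  rw [Finset.sum_comp (fun e : Fin n →₀ ℕ => p.coeff e / tupCount d e * ∏ i, x i ^ e i)
    (fun t : Tup n d => tupExp t.2), MvPolynomial.eval_eq']
  have hsub : p.support ⊆ Finset.univ.image fun t : Tup n d => tupExp t.2 := by
    intro e he
    have h1 : ∑ i, e i ≤ d := by
      refine le_trans (le_of_eq ?_) ((MvPolynomial.le_totalDegree he).trans hp)
      exact (Finset.sum_subset (Finset.subset_univ _) fun i _ hi => by simpa using hi).symm
    obtain ⟨t, ht⟩ := exists_tupExp_eq _ e rfl
    exact Finset.mem_image.2 ⟨⟨⟨∑ i, e i, by omega⟩, t⟩, Finset.mem_univ _, ht⟩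
  rw [Finset.sum_subset hsub fun e _ he => by rw [MvPolynomial.notMem_support_iff.1 he, zero_mul]]
  refine Finset.sum_congr rfl fun e he => ?_
  obtain ⟨t, -, ht⟩ := Finset.mem_image.1 he
  have hpos : (tupCount d e : ℝ) ≠ 0 := by
    have : 0 < tupCount d e := Finset.card_pos.2 ⟨t, by simpa using ht⟩
    positivity
  rw [nsmul_eq_mul, ← mul_assoc]
  congr 1
  change (tupCount d e : ℝ) * _ = _
  field_simp

theorem one_le_tupCount (t : Tup n d) : (1 : ℝ) ≤ tupCount d (tupExp t.2) := by
  have : 0 < tupCount d (tupExp t.2) := Finset.card_pos.2 ⟨t, by simp⟩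
  exact_mod_cast this

theorem quad_sum_vecMulVec {κ ι : Type} [Fintype κ] [Fintype ι] (v : κ → ι → ℝ) (z : ι → ℝ) :
    quad (∑ i, Matrix.vecMulVec (v i) (star (v i))) z = ∑ i, (∑ t, v i t * z t) ^ 2 := by
  simp only [quad, Matrix.sum_apply, Matrix.vecMulVec_apply, star_trivial,
    Finset.sum_mul]
  simp_rw [Finset.sum_comm (t := (Finset.univ : Finset κ))]
  refine Finset.sum_congr rfl fun i _ => ?_
  rw [pow_two, Finset.sum_mul_sum]
  exact Finset.sum_congr rfl fun s _ => Finset.sum_congr rfl fun t _ => by ring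

/-- A sum of squares that is bounded on the sphere has, on the sphere, a Gram matrix with bounded
entries. -/
theorem exists_bounded_gram (hn : 0 < n) (hd : 1 ≤ d) {A : Matrix (Tup n d) (Tup n d) ℝ}
    (hA : A.PosSemidef) {C : ℝ}
    (hC : ∀ x : Fin n → ℝ, ∑ i, x i ^ 2 = 1 → quad A (mvec d x) ≤ C) :
    ∃ A' : Matrix (Tup n d) (Tup n d) ℝ, A'.PosSemidef ∧
      (∀ x : Fin n → ℝ, ∑ i, x i ^ 2 = 1 → quad A' (mvec d x) = quad A (mvec d x)) ∧
      ∀ s t, |A' s t| ≤ 8 * C * (4 * (n : ℝ) ^ 2) ^ d := by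
  obtain ⟨r, rfl⟩ : ∃ r, d = r + 1 := ⟨d - 1, by omega⟩
  obtain ⟨m, v, rfl⟩ := Matrix.posSemidef_iff_eq_sum_vecMulVec.1 hA
  have hn1 : (1 : ℝ) ≤ n := by exact_mod_cast hn
  set p : Fin m → MvPolynomial (Fin n) ℝ := fun i =>
    ∑ t, MvPolynomial.C (v i t) * tupMonomial t with hp
  have hpe : ∀ i x, MvPolynomial.eval x (p i) = ∑ t, v i t * mvec (r + 1) x t := by
    intro i x
    simp only [hp, map_sum, MvPolynomial.eval_mul, MvPolynomial.eval_C, eval_tupMonomial]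
  have hpd : ∀ i, (p i).totalDegree ≤ r + 1 := by
    intro i
    refine MvPolynomial.totalDegree_finsetSum_le fun t _ => (totalDegree_C_mul_le _ _).trans
      ((totalDegree_prod_X_le t.2).trans ?_)
    have := t.1.2
    omega
  have hpC : ∀ x : Fin n → ℝ, ∑ i, x i ^ 2 = 1 → ∑ i, MvPolynomial.eval x (p i) ^ 2 ≤ C := by
    intro x hx
    have := hC x hx
    rw [quad_sum_vecMulVec] at this
    simpa only [hpe] using this
  have hC0 : 0 ≤ C := le_trans (Finset.sum_nonneg fun i _ => sq_nonneg _)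
    (hpC _ (sum_signVec_sq hn fun _ => true))
  -- Each square root is replaced by a polynomial with the same values on the sphere but with only
  -- two homogeneous components, of opposite parity.
  set S : Fin m → MvPolynomial (Fin n) ℝ := fun i => homog (r + 1) (p i) + homog r (p i) with hS
  have hSd : ∀ i, (S i).totalDegree ≤ r + 1 := fun i =>
    (MvPolynomial.totalDegree_add _ _).trans (max_le (homog_isHomogeneous _ _).totalDegree_le
      ((homog_isHomogeneous _ _).totalDegree_le.trans (Nat.le_succ r)))
  -- Averaging the bound over `x` and `-x` removes the product of the two components, so both
  -- satisfy the bound separately.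
  have hboth : ∀ x : Fin n → ℝ, ∑ i, x i ^ 2 = 1 →
      ∑ i, MvPolynomial.eval x (homog (r + 1) (p i)) ^ 2
        + ∑ i, MvPolynomial.eval x (homog r (p i)) ^ 2 ≤ C := by
    intro x hx
    have h1 := hpC x hx
    have h2 := hpC _ (sum_neg_sq hx)
    have h3 : ∀ i, MvPolynomial.eval x (p i) ^ 2
        + MvPolynomial.eval (fun i => -x i) (p i) ^ 2
        = 2 * (MvPolynomial.eval x (homog (r + 1) (p i)) ^ 2
          + MvPolynomial.eval x (homog r (p i)) ^ 2) := by
      intro i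
      rw [← eval_homog_add (hpd i) hx, ← eval_homog_add (hpd i) (sum_neg_sq hx), eval_neg_homog,
        eval_neg_homog, pow_succ (-1 : ℝ) r]
      rcases neg_one_pow_eq_or ℝ r with hr | hr <;> rw [hr] <;> ring
    have h4 := add_le_add h1 h2
    rw [← Finset.sum_add_distrib, Finset.sum_congr rfl fun i _ => h3 i, ← Finset.mul_sum,
      Finset.sum_add_distrib] at h4
    linarith
  have c1 := sum_coeff_sq_le hn (fun i => homog_isHomogeneous (r + 1) (p i)) (C := C)
    fun x hx => le_trans (le_add_of_nonneg_right (Finset.sum_nonneg fun i _ => sq_nonneg _))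
      (hboth x hx)
  have c2 := sum_coeff_sq_le hn (fun i => homog_isHomogeneous r (p i)) (C := C)
    fun x hx => le_trans (le_add_of_nonneg_left (Finset.sum_nonneg fun i _ => sq_nonneg _))
      (hboth x hx)
  set K : ℝ := (4 * (n : ℝ) ^ 2) ^ (r + 1) with hK
  have hKr : (4 * (n : ℝ) ^ 2) ^ r ≤ K := pow_le_pow_right₀ (by nlinarith) (Nat.le_succ r)
  have cS : ∀ e, ∑ i, (S i).coeff e ^ 2 ≤ 8 * C * K := by
    intro e
    have h1 : ∀ i, (S i).coeff e ^ 2 ≤ 2 * ((homog (r + 1) (p i)).coeff e ^ 2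
        + (homog r (p i)).coeff e ^ 2) := by
      intro i
      rw [hS, MvPolynomial.coeff_add]
      exact add_sq_le
    have h2 := Finset.sum_le_sum fun i (_ : i ∈ Finset.univ) => h1 i
    rw [← Finset.mul_sum, Finset.sum_add_distrib] at h2
    have h3 := mul_le_mul_of_nonneg_left hKr hC0
    linarith [c1 e, c2 e]
  set u : Fin m → Tup n (r + 1) → ℝ := fun i t =>
    (S i).coeff (tupExp t.2) / tupCount (r + 1) (tupExp t.2) with hu
  have hu2 : ∀ t, ∑ i, u i t ^ 2 ≤ 8 * C * K := by
    intro t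
    refine le_trans (Finset.sum_le_sum fun i _ => ?_) (cS (tupExp t.2))
    have h1 := one_le_tupCount t
    simp only [hu, div_pow]
    exact div_le_self (sq_nonneg _) (one_le_pow₀ h1)
  refine ⟨∑ i, Matrix.vecMulVec (u i) (star (u i)),
    Matrix.posSemidef_iff_eq_sum_vecMulVec.2 ⟨m, u, rfl⟩, fun x hx => ?_, fun s t => ?_⟩
  · rw [quad_sum_vecMulVec, quad_sum_vecMulVec]
    refine Finset.sum_congr rfl fun i _ => ?_
    rw [← hpe, ← eval_homog_add (hpd i) hx]
    simp only [hu]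
    rw [sum_coeff_mul_mvec (hSd i), hS, map_add]
  · simp only [Matrix.sum_apply, Matrix.vecMulVec_apply, star_trivial]
    have h1 := hu2 s
    have h2 := hu2 t
    refine (Finset.abs_sum_le_sum_abs _ _).trans ?_
    have h3 : ∀ i, |u i s * u i t| ≤ (u i s ^ 2 + u i t ^ 2) / 2 := by
      intro i
      rw [abs_mul]
      nlinarith [sq_nonneg (|u i s| - |u i t|), sq_abs (u i s), sq_abs (u i t)]
    refine (Finset.sum_le_sum fun i _ => h3 i).trans ?_
    rw [← Finset.sum_div, Finset.sum_add_distrib]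
    linarith

end GramBound

/-! ### Refutations with bounded numbers. -/

section WellConditioned

variable {n d k : ℕ} {obj : ℝ}

theorem quad_single (i : Tup n d) (z : Tup n d → ℝ) :
    quad (Matrix.single i i (1 : ℝ)) z = z i ^ 2 := by
  rw [quad, Finset.sum_eq_single i, Finset.sum_eq_single i]
  · simp [pow_two]
  · intro t _ ht; simp [ht.symm]
  · simp
  · intro s _ hs; simp [hs.symm]
  · simp

theorem quad_smul (c : ℝ) (M : Matrix (Tup n d) (Tup n d) ℝ) (z : Tup n d → ℝ) :
    quad (c • M) z = c * quad M z := by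
  simp only [quad, Matrix.smul_apply, smul_eq_mul, Finset.mul_sum, mul_assoc]

/-- A refutation for the slightly enlarged tensor gives a positive semidefinite matrix whose values
on the sphere are explicit. -/
theorem exists_gram_of_refutable_smul (hn : 0 < n) {η : ℝ} (hη : 0 < η) (hη1 : η < 1)
    (hobj : 0 < obj) {T : Tensor n k} (h : Refutable d obj ((1 - η)⁻¹ • T)) :
    ∃ A : Matrix (Tup n d) (Tup n d) ℝ, A.PosSemidef ∧ ∀ x : Fin n → ℝ, ∑ i, x i ^ 2 = 1 →
      quad A (mvec d x) = 1 / (η * obj) * (obj - ∑ a, T a * tensorPow k x a) - 1 := by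
  obtain ⟨A, b, q, hA, hb, -, he⟩ := h
  have hval : ∀ x : Fin n → ℝ, ∑ i, x i ^ 2 = 1 →
      1 + quad A (mvec d x) = b * (obj - (1 - η)⁻¹ * ∑ a, T a * tensorPow k x a) := by
    intro x hx
    have h1 := congrArg (MvPolynomial.eval x) he
    rw [map_add, map_add, MvPolynomial.eval_mul, MvPolynomial.eval_mul, MvPolynomial.eval_C,
      eval_gramPoly, eval_objPoly, eval_spherePoly, hx, map_neg, map_one] at h1
    have h2 : ∑ a, ((1 - η)⁻¹ • T) a * tensorPow k x a
        = (1 - η)⁻¹ * ∑ a, T a * tensorPow k x a := by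
      simp only [Pi.smul_apply, smul_eq_mul, Finset.mul_sum, mul_assoc]
    rw [h2] at h1
    linarith
  have hApos := (posSemidef_iff_quad.1 hA).2
  -- With `b = 0` the identity would equate `-1` with a nonnegative value on the sphere.
  have hb0 : 0 < b := by
    rcases hb.eq_or_lt with h0 | h0
    · have h1 := hval _ (sum_signVec_sq hn fun _ => true)
      rw [← h0, zero_mul] at h1
      linarith [hApos (mvec d (signVec fun _ => true))]
    · exact h0
  have h1η : 0 < 1 - η := by linarith
  -- On the sphere, `(1 - η) / b` times `1 + ⟨A, ·⟩` is `(1 - η) obj - ⟨T, x^{⊗ k}⟩`. After division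
  -- by `η obj`, the missing `η obj` is exactly the required `-1`, and the unknown `b` has
  -- disappeared.
  set c : ℝ := 1 / (η * obj) * ((1 - η) / b) with hc
  have hc0 : 0 ≤ c := by positivity
  refine ⟨c • (A + Matrix.single (emptyTup n d) (emptyTup n d) 1),
    posSemidef_iff_quad.2 ⟨?_, fun z => ?_⟩, fun x hx => ?_⟩
  · refine Matrix.IsSymm.smul (Matrix.IsSymm.add (posSemidef_iff_quad.1 hA).1 ?_) c
    exact Matrix.IsSymm.ext fun s t => by simp [Matrix.single_apply, and_comm]
  · rw [quad_smul, quad_add, quad_single]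
    have := hApos z
    positivity
  · have h1 : mvec d x (emptyTup n d) = 1 :=
      Finset.prod_eq_one fun j _ => Fin.elim0 j
    rw [quad_smul, quad_add, quad_single, h1, one_pow, add_comm, hval x hx, hc]
    field_simp
    ring

/-- Refutations for slightly enlarged tensors yield refutations with bounded numbers. -/
theorem refutableWithin_of_refutable_smul (hn : 2 ≤ n) (hd : 1 ≤ d) (hk : k ≤ 2 * d)
    (hobj : 1 ≤ obj) {T : Tensor n k} (hT : ∑ a, T a ^ 2 ≤ 6400 * ((n : ℝ) ^ d) ^ 2)
    (h : Refutable d obj ((1 - ((n : ℝ) ^ d)⁻¹ ^ 18)⁻¹ • T)) :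
    RefutableWithin d obj ((n : ℝ) ^ (100 * d)) T := by
  have hn0 : 0 < n := by omega
  have hn2 : (2 : ℝ) ≤ n := by exact_mod_cast hn
  set x : ℝ := (n : ℝ) ^ d with hx
  have hx2 : 2 ≤ x := two_le_cast_pow hn hd
  have hx0 : 0 < x := by linarith
  have hx1 : 1 ≤ x := by linarith
  have hR : (n : ℝ) ^ (100 * d) = x ^ 100 := by rw [hx, ← pow_mul, mul_comm]
  rw [hR]
  have hη0 : 0 < x⁻¹ ^ 18 := by positivity
  have hη1 : x⁻¹ ^ 18 < 1 := by
    rw [inv_pow]; exact inv_lt_one_of_one_lt₀ (one_lt_pow₀ (by linarith) (by norm_num))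
  obtain ⟨A, hA, hAv⟩ := exists_gram_of_refutable_smul hn0 hη0 hη1 (by linarith) h
  set b : ℝ := 1 / (x⁻¹ ^ 18 * obj) with hb
  have hbx : b * obj = x ^ 18 := by
    rw [hb, inv_pow]; field_simp
  have hb0 : 0 ≤ b := by positivity
  have hbB : b ≤ x ^ 18 := by rw [← hbx]; nlinarith
  have hpow : ∀ {i j : ℕ}, i ≤ j → x ^ i ≤ x ^ j := fun hij => pow_le_pow_right₀ hx1 hij
  have h128 : (128 : ℝ) ≤ x ^ 7 := by
    calc (128 : ℝ) = 2 ^ 7 := by norm_num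
      _ ≤ x ^ 7 := pow_le_pow_left₀ (by norm_num) hx2 7
  have h8 : (8 : ℝ) ≤ x ^ 3 := by
    calc (8 : ℝ) = 2 ^ 3 := by norm_num
      _ ≤ x ^ 3 := pow_le_pow_left₀ (by norm_num) hx2 3
  have h4 : (4 : ℝ) ≤ x ^ 2 := by
    calc (4 : ℝ) = 2 ^ 2 := by norm_num
      _ ≤ x ^ 2 := pow_le_pow_left₀ (by norm_num) hx2 2
  have hsqrt : √(∑ a, T a ^ 2) ≤ 80 * x := by
    refine Real.sqrt_le_iff.2 ⟨by positivity, hT.trans (le_of_eq (by ring))⟩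
  -- The values are `b (obj - ⟨T, y^{⊗ k}⟩) - 1` with `b obj = x ^ 18` and `|⟨T, y^{⊗ k}⟩| ≤ ‖T‖ ≤
  -- 80 x`.
  have hC : ∀ y : Fin n → ℝ, ∑ i, y i ^ 2 = 1 → quad A (mvec d y) ≤ x ^ 26 := by
    intro y hy
    rw [hAv y hy, mul_sub, hbx]
    have h1 := (abs_le.1 ((abs_sum_mul_tensorPow_le hy T).trans hsqrt)).1
    have h2 : b * (-∑ a, T a * tensorPow k y a) ≤ x ^ 18 * (80 * x) :=
      (mul_le_mul_of_nonneg_left (by linarith : _ ≤ 80 * x) hb0).trans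
        (mul_le_mul_of_nonneg_right hbB (by positivity))
    have h3 : x ^ 18 + x ^ 18 * (80 * x) ≤ x ^ 18 * (x ^ 7 * x) := by
      have : 1 + 80 * x ≤ x ^ 7 * x := by nlinarith
      calc x ^ 18 + x ^ 18 * (80 * x) = x ^ 18 * (1 + 80 * x) := by ring
        _ ≤ _ := mul_le_mul_of_nonneg_left this (by positivity)
    have h4 : x ^ 18 * (x ^ 7 * x) = x ^ 26 := by ring
    linarith
  obtain ⟨A', hA', hAA', hAB⟩ := exists_bounded_gram hn0 hd hA hC
  have hAB' : ∀ s t, |A' s t| ≤ x ^ 33 := by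
    intro s t
    have h1 : (4 * (n : ℝ) ^ 2) ^ d ≤ x ^ 4 := by
      calc (4 * (n : ℝ) ^ 2) ^ d ≤ ((n : ℝ) ^ 2 * (n : ℝ) ^ 2) ^ d := by
            refine pow_le_pow_left₀ (by positivity) (mul_le_mul_of_nonneg_right ?_ (by positivity)) d
            nlinarith
        _ = x ^ 4 := by rw [hx, ← pow_add, ← pow_mul, ← pow_mul, mul_comm]
    calc |A' s t| ≤ 8 * x ^ 26 * (4 * (n : ℝ) ^ 2) ^ d := hAB s t
      _ ≤ x ^ 3 * x ^ 26 * x ^ 4 := by gcongr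
      _ = x ^ 33 := by ring
  -- `A'` agrees with `A` only on the sphere, so the old multiplier `q` is useless; a new one is the
  -- quotient of `F` by `‖x‖² - 1`, bounded through the coefficients of `F`.
  set F : MvPolynomial (Fin n) ℝ := -1 - gramPoly A' - MvPolynomial.C b * objPoly obj T with hF
  have hFdeg : F.totalDegree ≤ (2 * d - 1) + 1 := by
    refine (MvPolynomial.totalDegree_sub _ _).trans (max_le
      ((MvPolynomial.totalDegree_sub _ _).trans (max_le ?_ ?_)) ?_)
    · rw [MvPolynomial.totalDegree_neg, MvPolynomial.totalDegree_one]; omega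
    · exact (totalDegree_gramPoly_le A').trans (by omega)
    · exact (totalDegree_C_mul_le _ _).trans ((totalDegree_objPoly_le _ _).trans (by omega))
  have hFz : ∀ y : Fin n → ℝ, ∑ i, y i ^ 2 = 1 → MvPolynomial.eval y F = 0 := by
    intro y hy
    rw [hF, map_sub, map_sub, MvPolynomial.eval_mul, MvPolynomial.eval_C, eval_gramPoly,
      eval_objPoly, map_neg, map_one, hAA' y hy, hAv y hy]
    ring
  have hcard : (Fintype.card (Tup n d) : ℝ) ^ 2 ≤ x ^ 4 := by
    calc _ ≤ (x ^ 2) ^ 2 := pow_le_pow_left₀ (Nat.cast_nonneg _) (card_tup_le hn d) 2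
      _ = x ^ 4 := by ring
  have hsumT : ∑ a, |T a| ≤ x ^ 10 := by
    have h1 : ∀ a, |T a| ≤ x ^ 8 := by
      intro a
      have h2 : |T a| ≤ √(∑ a, T a ^ 2) := Real.abs_le_sqrt
        (Finset.single_le_sum (f := fun a => T a ^ 2) (fun _ _ => sq_nonneg _) (Finset.mem_univ a))
      calc |T a| ≤ 80 * x := h2.trans hsqrt
        _ ≤ x ^ 7 * x := mul_le_mul_of_nonneg_right (by linarith) hx0.le
        _ = x ^ 8 := by ring
    have h3 : (n : ℝ) ^ k ≤ x ^ 2 := by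
      rw [hx, ← pow_mul]; exact pow_le_pow_right₀ (by linarith) (by omega)
    calc ∑ a, |T a| ≤ ∑ _a : Idx n k, x ^ 8 := Finset.sum_le_sum fun a _ => h1 a
      _ = (n : ℝ) ^ k * x ^ 8 := by simp
      _ ≤ x ^ 2 * x ^ 8 := mul_le_mul_of_nonneg_right h3 (by positivity)
      _ = x ^ 10 := by ring
  have hFc : ∀ m, |F.coeff m| ≤ x ^ 39 := by
    intro m
    rw [hF, MvPolynomial.coeff_sub, MvPolynomial.coeff_sub, MvPolynomial.coeff_C_mul]
    have h1 : |(-1 : MvPolynomial (Fin n) ℝ).coeff m| ≤ 1 := by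
      rw [MvPolynomial.coeff_neg, abs_neg, MvPolynomial.coeff_one]
      split_ifs <;> simp
    have h2 : |(gramPoly A').coeff m| ≤ x ^ 37 :=
      (abs_coeff_gramPoly_le hAB' m).trans ((mul_le_mul_of_nonneg_right hcard
        (by positivity)).trans (le_of_eq (by ring)))
    have h3 : |b * (objPoly obj T).coeff m| ≤ x ^ 28 + x ^ 18 := by
      rw [abs_mul, abs_of_nonneg hb0]
      refine (mul_le_mul_of_nonneg_left (abs_coeff_objPoly_le obj T m) hb0).trans ?_
      rw [abs_of_nonneg (by linarith : (0 : ℝ) ≤ obj), mul_add, hbx]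
      have : b * ∑ a, |T a| ≤ x ^ 18 * x ^ 10 := mul_le_mul hbB hsumT
        (Finset.sum_nonneg fun a _ => abs_nonneg _) (by positivity)
      have e : x ^ 18 * x ^ 10 = x ^ 28 := by ring
      linarith
    have h5 : (1 : ℝ) ≤ x ^ 37 := one_le_pow₀ hx1
    have h6 : x ^ 28 ≤ x ^ 37 := hpow (by norm_num)
    have h7 : x ^ 18 ≤ x ^ 37 := hpow (by norm_num)
    have h8 : 4 * x ^ 37 ≤ x ^ 39 := by
      calc 4 * x ^ 37 ≤ x ^ 2 * x ^ 37 := mul_le_mul_of_nonneg_right h4 (by positivity)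
        _ = x ^ 39 := by ring
    refine (abs_sub _ _).trans ((add_le_add ((abs_sub _ _).trans (add_le_add h1 h2)) h3).trans ?_)
    linarith
  have hq := sphereQuot_mul hn0 hFdeg hFz
  refine ⟨A', b, sphereQuot (2 * d - 1) F, ⟨hA', hb0, ?_, ?_⟩, fun s t =>
    (hAB' s t).trans (hpow (by norm_num)), hbB.trans (hpow (by norm_num)), fun m => ?_⟩
  · have := totalDegree_sphereQuot (n := n) (r := 2 * d - 1) (by omega) F
    omega
  · rw [hq, hF]; ring
  · refine (abs_coeff_sphereQuot_le hn0 hFc (2 * d - 1) m).trans ?_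
    have hd1 := succ_le_cast_pow hn d
    rw [← hx] at hd1
    have e1 : ((2 * d - 1 : ℕ) : ℝ) = 2 * d - 1 := by
      rw [Nat.cast_sub (by omega)]; push_cast; ring
    have h1 : ((2 * d - 1 : ℕ) : ℝ) + 2 ≤ x ^ 2 := by rw [e1]; nlinarith
    have h2 : ((2 * d - 1 : ℕ) : ℝ) + 1 ≤ x ^ 2 := by linarith
    have h3 : (n : ℝ) ^ ((2 * d - 1) / 2) ≤ x := pow_le_pow_right₀ (by linarith) (by omega)
    calc _ ≤ x ^ 2 * (x ^ 2 * (x * x ^ 39)) := by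
          refine mul_le_mul h1 (mul_le_mul h2 (mul_le_mul_of_nonneg_right h3 (by positivity))
            (by positivity) (by positivity)) (by positivity) (by positivity)
      _ = x ^ 44 := by ring
      _ ≤ x ^ 100 := hpow (by norm_num)

end WellConditioned

/-! ### Scaled Gaussian tensors and norm tails. -/

section Scaling

variable {ι : Type} [Fintype ι]

/-- The density of a scaled Gaussian with respect to the standard one. -/
def scaleDensity (c y : ℝ) : ℝ≥0∞ :=
  ENNReal.ofReal (c⁻¹ * Real.exp ((1 - (c ^ 2)⁻¹) * y ^ 2 / 2))

theorem measurable_scaleDensity (c : ℝ) : Measurable (scaleDensity c) := by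
  unfold scaleDensity; fun_prop

theorem gaussianReal_map_mul {c : ℝ} (hc : 0 < c) :
    (gaussianReal 0 1).map (fun y => c * y)
      = (gaussianReal 0 1).withDensity (scaleDensity c) := by
  rw [gaussianReal_map_const_mul, mul_zero, mul_one,
    gaussianReal_of_var_ne_zero _ (by
      intro h
      have := congrArg NNReal.toReal h
      simp at this
      exact hc.ne' this),
    gaussianReal_of_var_ne_zero _ one_ne_zero,
    ← withDensity_mul _ (measurable_gaussianPDF 0 1) (measurable_scaleDensity c)]
  congr 1
  funext y
  simp only [Pi.mul_apply, gaussianPDF, scaleDensity]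
  rw [← ENNReal.ofReal_mul (gaussianPDFReal_nonneg _ _ _)]
  congr 1
  simp only [gaussianPDFReal, NNReal.coe_mk, NNReal.coe_one, sub_zero, mul_one]
  rw [Real.sqrt_mul (by positivity), Real.sqrt_sq hc.le, mul_inv, mul_assoc, mul_assoc]
  congr 1
  rw [mul_left_comm, ← Real.exp_add]
  congr 2
  field_simp
  ring

theorem stdG_map_smul {c : ℝ} (hc : 0 < c) :
    (stdG ι).map (fun T a => c * T a)
      = (stdG ι).withDensity fun T => ∏ a, scaleDensity c (T a) := by
  have hm : ∀ a : ι, Measurable fun T : ι → ℝ => scaleDensity c (T a) := fun a =>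
    (measurable_scaleDensity c).comp (measurable_pi_apply a)
  have hpi : (stdG ι).map (fun T a => c * T a)
      = Measure.pi fun _ => (gaussianReal 0 1).withDensity (scaleDensity c) := by
    have h1 : ∀ _a : ι, IsProbabilityMeasure ((gaussianReal 0 1).map fun y => c * y) := fun _ =>
      Measure.isProbabilityMeasure_map (by fun_prop)
    have := Measure.pi_map_pi (μ := fun _ : ι => gaussianReal 0 1) (f := fun _ y => c * y)
      (fun _ => by fun_prop)
    simp_rw [gaussianReal_map_mul hc] at this
    exact this
  have h1 : ∀ _a : ι, IsProbabilityMeasure ((gaussianReal 0 1).withDensity (scaleDensity c)) :=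
    fun _ => by
      rw [← gaussianReal_map_mul hc]
      exact Measure.isProbabilityMeasure_map (by fun_prop)
  rw [hpi]
  refine (Measure.pi_eq fun s hs => ?_)
  rw [withDensity_apply _ (MeasurableSet.univ_pi hs), ← lintegral_indicator
    (MeasurableSet.univ_pi hs)]
  have hind : ∀ T : ι → ℝ, (Set.univ.pi s).indicator (fun T => ∏ a, scaleDensity c (T a)) T
      = ∏ a, (s a).indicator (scaleDensity c) (T a) := by
    intro T
    classical
    by_cases hT : ∀ a, T a ∈ s a
    · rw [Set.indicator_of_mem (by simpa using hT)]
      exact Finset.prod_congr rfl fun a _ => (Set.indicator_of_mem (hT a) _).symm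
    · rw [Set.indicator_of_notMem (by simpa using hT)]
      push Not at hT
      obtain ⟨a, ha⟩ := hT
      exact (Finset.prod_eq_zero (Finset.mem_univ a) (Set.indicator_of_notMem ha _)).symm
  simp_rw [hind]
  have hsm : ∀ a, Measurable ((s a).indicator (scaleDensity c)) := fun a =>
    (measurable_scaleDensity c).indicator (hs a)
  have hindep := iIndepFun_pi (μ := fun _ : ι => gaussianReal 0 1)
    (X := fun a => (s a).indicator (scaleDensity c)) fun a => (hsm a).aemeasurable
  rw [lintegral_prod_eq_prod_lintegral_of_indepFun Finset.univ _ hindep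
    fun a => (hsm a).comp (measurable_pi_apply a)]
  refine Finset.prod_congr rfl fun a _ => ?_
  rw [withDensity_apply _ (hs a), ← lintegral_indicator (hs a)]
  exact (measurePreserving_eval (fun _ : ι => gaussianReal 0 1) a).lintegral_comp (hsm a)

/-- Slightly enlarging a Gaussian tensor does not change probabilities much. -/
theorem stdG_scaled_le {c R : ℝ} (hc : 1 ≤ c) {E : Set (ι → ℝ)} (hE : MeasurableSet E) :
    stdG ι {T | (fun a => c * T a) ∈ E ∧ ∑ a, T a ^ 2 ≤ R}
      ≤ ENNReal.ofReal (Real.exp ((c ^ 2 - 1) * R / 2)) * stdG ι E := by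
  have hc0 : 0 < c := by linarith
  have hS : MeasurableSet {y : ι → ℝ | ∑ a, y a ^ 2 ≤ c ^ 2 * R} :=
    measurableSet_le (by fun_prop) measurable_const
  have h1 : {T : ι → ℝ | (fun a => c * T a) ∈ E ∧ ∑ a, T a ^ 2 ≤ R}
      = (fun (T : ι → ℝ) a => c * T a) ⁻¹' (E ∩ {y | ∑ a, y a ^ 2 ≤ c ^ 2 * R}) := by
    ext T
    simp only [Set.mem_ofPred_eq, Set.mem_preimage, Set.mem_inter_iff, mul_pow, ← Finset.mul_sum]
    rw [mul_le_mul_iff_right₀ (by positivity)]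
  rw [h1, ← Measure.map_apply (by fun_prop) (hE.inter hS), stdG_map_smul hc0,
    withDensity_apply _ (hE.inter hS)]
  calc ∫⁻ T in E ∩ {y | ∑ a, y a ^ 2 ≤ c ^ 2 * R}, ∏ a, scaleDensity c (T a) ∂(stdG ι)
      ≤ ∫⁻ _T in E ∩ {y | ∑ a, y a ^ 2 ≤ c ^ 2 * R},
          ENNReal.ofReal (Real.exp ((c ^ 2 - 1) * R / 2)) ∂(stdG ι) := by
        refine setLIntegral_mono (by fun_prop) fun T hT => ?_
        simp only [scaleDensity]
        rw [← ENNReal.ofReal_prod_of_nonneg fun a _ => by positivity]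
        refine ENNReal.ofReal_le_ofReal ?_
        rw [Finset.prod_mul_distrib, ← Real.exp_sum, ← Finset.sum_div, ← Finset.mul_sum]
        -- The normalising factor helps and is dropped; only the exponent, controlled by the norm
        -- bound, matters.
        have h2 : ∏ _a : ι, c⁻¹ ≤ 1 := Finset.prod_le_one (fun _ _ => by positivity)
          fun _ _ => inv_le_one_of_one_le₀ hc
        have h3 : (1 - (c ^ 2)⁻¹) * ∑ a, T a ^ 2 ≤ (c ^ 2 - 1) * R := by
          have h4 : 0 ≤ 1 - (c ^ 2)⁻¹ := by
            have := inv_le_one_of_one_le₀ (one_le_pow₀ hc (n := 2)); linarith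
          refine (mul_le_mul_of_nonneg_left hT.2 h4).trans (le_of_eq ?_)
          field_simp
        calc _ ≤ 1 * Real.exp ((c ^ 2 - 1) * R / 2) :=
              mul_le_mul h2 (Real.exp_le_exp.2 (by linarith)) (Real.exp_pos _).le zero_le_one
          _ = _ := one_mul _
    _ = ENNReal.ofReal (Real.exp ((c ^ 2 - 1) * R / 2))
          * stdG ι (E ∩ {y | ∑ a, y a ^ 2 ≤ c ^ 2 * R}) := by
        rw [setLIntegral_const]
    _ ≤ _ := mul_le_mul_right (measure_mono Set.inter_subset_left) _

/-- Markov's inequality. -/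
theorem measure_le_ofReal_integral {Ω : Type*} [MeasurableSpace Ω] {P : Measure Ω}
    [IsFiniteMeasure P] {S : Set Ω} {f : Ω → ℝ} (hf : Integrable f P) (h0 : ∀ x, 0 ≤ f x)
    (h1 : ∀ x ∈ S, 1 ≤ f x) : P S ≤ ENNReal.ofReal (∫ x, f x ∂P) := by
  have h := mul_meas_ge_le_integral_of_nonneg (Filter.Eventually.of_forall h0) hf 1
  rw [one_mul] at h
  calc P S ≤ P {x | 1 ≤ f x} := measure_mono h1
    _ = ENNReal.ofReal (P.real {x | 1 ≤ f x}) := (ofReal_measureReal).symm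
    _ ≤ _ := ENNReal.ofReal_le_ofReal h

/-- Chernoff with parameter `1 / 4`, where each coordinate contributes `√2 ≤ e`. -/
theorem stdG_sum_sq_gt_le (R : ℝ) :
    stdG ι {T | R < ∑ a, T a ^ 2}
      ≤ ENNReal.ofReal (Real.exp (Fintype.card ι) * Real.exp (-(R / 4))) := by
  obtain ⟨s, hs⟩ : ∃ s : ℝ, s = 1 / 4 := ⟨_, rfl⟩
  have hs2 : s < 1 / 2 := by rw [hs]; norm_num
  have hi : Integrable (fun T : ι → ℝ => Real.exp (s * ∑ a, T a ^ 2) * Real.exp (-(R / 4)))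
    (stdG ι) := (integrable_exp_sq hs2).mul_const _
  have h0 : ∀ T : ι → ℝ, 0 ≤ Real.exp (s * ∑ a, T a ^ 2) * Real.exp (-(R / 4)) :=
    fun T => mul_nonneg (Real.exp_pos _).le (Real.exp_pos _).le
  have h1 : ∀ T ∈ {T : ι → ℝ | R < ∑ a, T a ^ 2},
      1 ≤ Real.exp (s * ∑ a, T a ^ 2) * Real.exp (-(R / 4)) := by
    intro T hT
    rw [← Real.exp_add]
    refine Real.one_le_exp ?_
    have : R < ∑ a, T a ^ 2 := hT
    rw [hs]; linarith
  refine (measure_le_ofReal_integral hi h0 h1).trans (ENNReal.ofReal_le_ofReal ?_)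
  rw [integral_mul_const, integral_exp_sq hs2]
  refine mul_le_mul_of_nonneg_right ?_ (Real.exp_pos _).le
  have h2 : √(1 / (1 - 2 * s)) ≤ Real.exp 1 := by
    rw [Real.sqrt_le_left (Real.exp_pos 1).le, hs]
    have := Real.add_one_le_exp (1 : ℝ)
    nlinarith
  calc _ ≤ Real.exp 1 ^ Fintype.card ι := pow_le_pow_left₀ (Real.sqrt_nonneg _) h2 _
    _ = _ := by rw [← Real.exp_nat_mul, mul_one]

end Scaling

/-! ### From refutability to bounded refutability with high probability. -/

section Threshold

variable {n d k : ℕ} {obj : ℝ}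

/-- On `[1, 2]` the density is at least `1 / 3 * 1 / 8`; any absolute constant would do. -/
theorem ofReal_le_gaussianReal_Ici : ENNReal.ofReal (1 / 24) ≤ gaussianReal 0 1 (Set.Ici 1) := by
  calc ENNReal.ofReal (1 / 24) = ∫⁻ _x in Set.Icc (1 : ℝ) 2, ENNReal.ofReal (1 / 24) := by
        rw [setLIntegral_const, Real.volume_Icc]; norm_num
    _ ≤ ∫⁻ x in Set.Icc (1 : ℝ) 2, gaussianPDF 0 1 x := by
        refine setLIntegral_mono (measurable_gaussianPDF 0 1) fun x hx => ?_
        rw [gaussianPDF]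
        refine ENNReal.ofReal_le_ofReal ?_
        simp only [gaussianPDFReal, NNReal.coe_one, sub_zero, mul_one]
        have h1 : √(2 * Real.pi) ≤ 3 := by
          rw [Real.sqrt_le_left (by norm_num)]
          linarith [Real.pi_lt_d2]
        have h2 : (1 : ℝ) / 3 ≤ (√(2 * Real.pi))⁻¹ := by
          rw [one_div]; exact inv_anti₀ (Real.sqrt_pos.2 (by positivity)) h1
        have h3 : (1 : ℝ) / 8 ≤ Real.exp (-x ^ 2 / 2) := by
          have h4 : Real.exp (-2) ≤ Real.exp (-x ^ 2 / 2) :=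
            Real.exp_le_exp.2 (by nlinarith [hx.1, hx.2])
          refine le_trans ?_ h4
          rw [Real.exp_neg, one_div]
          refine inv_anti₀ (Real.exp_pos 2) ?_
          have h5 : Real.exp 2 = Real.exp 1 ^ 2 := by rw [← Real.exp_nat_mul]; norm_num
          rw [h5]
          nlinarith [Real.exp_one_lt_d9, Real.exp_pos 1]
        calc (1 : ℝ) / 24 = 1 / 3 * (1 / 8) := by norm_num
          _ ≤ _ := mul_le_mul h2 h3 (by norm_num) (by positivity)
    _ ≤ ∫⁻ x in Set.Ici (1 : ℝ), gaussianPDF 0 1 x :=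
        lintegral_mono_set Set.Icc_subset_Ici_self
    _ = _ := by rw [gaussianReal_apply 0 one_ne_zero]

/-- Random instances can only be refuted with high probability if the threshold is not too
small. -/
theorem one_lt_of_refutable (hn : 0 < n)
    (h : unif n k {T | ¬ Refutable d obj T} < ENNReal.ofReal (1 / 24)) : 1 < obj := by
  by_contra hcon
  push Not at hcon
  refine absurd h (not_lt.2 (ofReal_le_gaussianReal_Ici.trans ?_))
  set i₀ : Fin n := ⟨0, hn⟩
  set a₀ : Idx n k := fun _ => i₀
  have hmp := measurePreserving_eval (fun _ : Idx n k => gaussianReal 0 1) a₀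
  rw [← hmp.measure_preimage measurableSet_Ici.nullMeasurableSet]
  refine measure_mono fun T hT hR => ?_
  obtain ⟨A, b, q, hA, hb, -, he⟩ := hR
  -- At a standard basis vector the objective is a single entry of `T`. If this entry is at least `1
  -- ≥ obj`, the vector is feasible and no refutation exists.
  have hx : ∑ i, (Pi.single i₀ (1 : ℝ) : Fin n → ℝ) i ^ 2 = 1 := by
    rw [Finset.sum_eq_single i₀] <;> simp +contextual
  have h1 := congrArg (MvPolynomial.eval (Pi.single i₀ (1 : ℝ))) he
  rw [map_add, map_add, MvPolynomial.eval_mul, MvPolynomial.eval_mul, MvPolynomial.eval_C,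
    eval_gramPoly, eval_objPoly, eval_spherePoly, hx, map_neg, map_one] at h1
  have h2 : ∑ a, T a * tensorPow k (Pi.single i₀ (1 : ℝ)) a = T a₀ := by
    rw [Finset.sum_eq_single a₀]
    · simp [tensorPow, a₀]
    · intro a _ ha
      obtain ⟨j, hj⟩ := Function.ne_iff.1 ha
      have : tensorPow k (Pi.single i₀ (1 : ℝ)) a = 0 :=
        Finset.prod_eq_zero (Finset.mem_univ j) (Pi.single_eq_of_ne hj _)
      rw [this, mul_zero]
    · simp
  rw [h2] at h1
  have h3 : 1 ≤ T a₀ := hT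
  have h4 := (posSemidef_iff_quad.1 hA).2 (mvec d (Pi.single i₀ 1))
  nlinarith [mul_nonneg hb (show (0 : ℝ) ≤ T a₀ - obj by linarith)]

/-- If random instances are refutable with high probability, then they have bounded refutations
with high probability. -/
theorem wellConditioned (hn : 2 ≤ n) (hd : 1 ≤ d) (hk : k ≤ 2 * d)
    (h : unif n k {T | ¬ Refutable d obj T}
      ≤ ENNReal.ofReal (1 / (2 * (n : ℝ) ^ (8 * (100 * d))))) :
    1 < obj ∧ unif n k {T | ¬ RefutableWithin d obj ((n : ℝ) ^ (100 * d)) T}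
      ≤ ENNReal.ofReal (1 / (n : ℝ) ^ (8 * (100 * d))) := by
  have hn2 : (2 : ℝ) ≤ n := by exact_mod_cast hn
  set x : ℝ := (n : ℝ) ^ d with hx
  have hx2 : 2 ≤ x := two_le_cast_pow hn hd
  have hx0 : 0 < x := by linarith
  have hxp : (n : ℝ) ^ (8 * (100 * d)) = x ^ 800 := by
    rw [hx, ← pow_mul]; congr 1; ring
  rw [hxp] at h ⊢
  have hbig : ∀ m : ℕ, 5 ≤ m → (32 : ℝ) ≤ x ^ m := fun m hm => by
    calc (32 : ℝ) = 2 ^ 5 := by norm_num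
      _ ≤ x ^ 5 := pow_le_pow_left₀ (by norm_num) hx2 5
      _ ≤ x ^ m := pow_le_pow_right₀ (by linarith) hm
  have hobj : 1 < obj := by
    refine one_lt_of_refutable (n := n) (k := k) (d := d) (by omega) (h.trans_lt ?_)
    rw [ENNReal.ofReal_lt_ofReal_iff (by norm_num)]
    have := hbig 800 (by norm_num)
    exact one_div_lt_one_div_of_lt (by norm_num) (by linarith)
  refine ⟨hobj, ?_⟩
  set P : ℝ := x ^ 800 with hP
  have hP0 : 0 < P := by positivity
  -- Small enough that `η ‖T‖² = O(x ^ (-16))`, so the change of measure costs only a constant, and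
  -- large enough that `1 / η` is polynomial in `x`.
  set η : ℝ := x⁻¹ ^ 18 with hη
  have hη16 : η * x ^ 2 ≤ 1 / 65536 := by
    have h1 : η * x ^ 2 = (x ^ 16)⁻¹ := by rw [hη, inv_pow]; field_simp
    rw [h1, one_div]
    refine inv_anti₀ (by norm_num) ?_
    calc (65536 : ℝ) = 2 ^ 16 := by norm_num
      _ ≤ x ^ 16 := pow_le_pow_left₀ (by norm_num) hx2 16
  have hη0 : 0 < η := by positivity
  have hηs : η ≤ 1 / 65536 := by nlinarith
  set c : ℝ := (1 - η)⁻¹ with hc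
  have hc1 : 1 ≤ c := by
    rw [hc]; exact (one_le_inv₀ (by linarith)).2 (by linarith)
  set R : ℝ := 6400 * x ^ 2 with hR
  have hcR : (c ^ 2 - 1) * R / 2 ≤ 1 / 4 := by
    have h1 : c * (1 - η) = 1 := inv_mul_cancel₀ (by linarith)
    have h2 : c ≤ 11 / 10 := by nlinarith
    have h3 : c ^ 2 - 1 ≤ 3 * η := by
      have : c ^ 2 - 1 = c * (c + 1) * η := by linear_combination (c + 1) * h1
      rw [this]
      exact mul_le_mul_of_nonneg_right (by nlinarith) hη0.le
    have h4 : (c ^ 2 - 1) * R ≤ 3 * η * R := mul_le_mul_of_nonneg_right h3 (by positivity)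
    have h5 : 3 * η * R = 19200 * (η * x ^ 2) := by rw [hR]; ring
    linarith
  -- The bad set is replaced by a measurable hull of the same measure, as the scaling bound needs
  -- measurability.
  set E := toMeasurable (unif n k) {T | ¬ Refutable d obj T} with hE
  have hsub : {T : Tensor n k | ¬ RefutableWithin d obj ((n : ℝ) ^ (100 * d)) T}
      ⊆ {T | R < ∑ a, T a ^ 2} ∪ {T | (fun a => c * T a) ∈ E ∧ ∑ a, T a ^ 2 ≤ R} := by
    intro T hT
    by_cases hTR : ∑ a, T a ^ 2 ≤ R
    · refine Or.inr ⟨subset_toMeasurable _ _ fun hRef => hT ?_, hTR⟩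
      exact refutableWithin_of_refutable_smul hn hd hk hobj.le hTR hRef
    · exact Or.inl (not_le.1 hTR)
  have hcard : (Fintype.card (Idx n k) : ℝ) ≤ x ^ 2 := by
    have : (Fintype.card (Idx n k) : ℝ) = (n : ℝ) ^ k := by simp
    rw [this, hx, ← pow_mul]
    exact pow_le_pow_right₀ (by linarith) (by omega)
  have hPexp : 4 * P ≤ Real.exp (1599 * x ^ 2) := by
    have h1 : x ≤ Real.exp x := by linarith [Real.add_one_le_exp x]
    have h2 : P ≤ Real.exp (800 * x) := by
      rw [hP]
      calc x ^ 800 ≤ Real.exp x ^ 800 := pow_le_pow_left₀ hx0.le h1 800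
        _ = Real.exp (800 * x) := by rw [← Real.exp_nat_mul]; norm_num
    have h3 : (4 : ℝ) ≤ Real.exp x * Real.exp x := by nlinarith [Real.add_one_le_exp x]
    calc 4 * P ≤ (Real.exp x * Real.exp x) * Real.exp (800 * x) :=
          mul_le_mul h3 h2 hP0.le (by positivity)
      _ = Real.exp (802 * x) := by rw [← Real.exp_add, ← Real.exp_add]; congr 1; ring
      _ ≤ _ := Real.exp_le_exp.2 (by nlinarith)
  -- Of the budget `1 / P`, large norms take a quarter; the scaled bad set takes `3 / 2 * 1 / 2`,
  -- which is the rest.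
  have hA : unif n k {T | R < ∑ a, T a ^ 2} ≤ ENNReal.ofReal (1 / 4 * (1 / P)) := by
    refine (stdG_sum_sq_gt_le R).trans (ENNReal.ofReal_le_ofReal ?_)
    rw [← Real.exp_add]
    have h1 : Real.exp (Fintype.card (Idx n k) + -(R / 4)) ≤ (Real.exp (1599 * x ^ 2))⁻¹ := by
      rw [← Real.exp_neg]
      refine Real.exp_le_exp.2 ?_
      rw [hR]; linarith
    refine h1.trans ((inv_anti₀ (by positivity) hPexp).trans (le_of_eq ?_))
    rw [mul_inv]; ring
  have hexp : Real.exp ((c ^ 2 - 1) * R / 2) ≤ 3 / 2 := by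
    refine (Real.exp_le_exp.2 hcR).trans ?_
    have h1 := Real.add_one_le_exp (-(1 / 4) : ℝ)
    rw [Real.exp_neg] at h1
    have h2 := mul_inv_cancel₀ (Real.exp_pos (1 / 4 : ℝ)).ne'
    nlinarith [Real.exp_pos (1 / 4 : ℝ)]
  have hB : unif n k {T | (fun a => c * T a) ∈ E ∧ ∑ a, T a ^ 2 ≤ R}
      ≤ ENNReal.ofReal (3 / 4 * (1 / P)) := by
    refine (stdG_scaled_le hc1 (measurableSet_toMeasurable _ _)).trans ?_
    have h1 : stdG (Idx n k) E = unif n k {T | ¬ Refutable d obj T} := measure_toMeasurable _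
    rw [h1]
    calc _ ≤ ENNReal.ofReal (3 / 2) * ENNReal.ofReal (1 / (2 * P)) :=
          mul_le_mul' (ENNReal.ofReal_le_ofReal hexp) h
      _ = ENNReal.ofReal (3 / 4 * (1 / P)) := by
          rw [← ENNReal.ofReal_mul (by norm_num)]; congr 1; field_simp; norm_num
  calc _ ≤ _ := measure_mono hsub
    _ ≤ _ := measure_union_le _ _
    _ ≤ ENNReal.ofReal (1 / 4 * (1 / P)) + ENNReal.ofReal (3 / 4 * (1 / P)) := add_le_add hA hB
    _ = ENNReal.ofReal (1 / P) := by
        rw [← ENNReal.ofReal_add (by positivity) (by positivity)]; congr 1; ring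

end Threshold

/-! ### Independent subsampling. -/

section Bernoulli

variable {ι : Type} [Fintype ι] [DecidableEq ι] {r : ℝ≥0} (hr : r ≤ 1)

/-- Independence of the memberships as a product expansion; the survival probability and the
exponential moment of the size are special choices of `u` and `w`. -/
theorem sum_bernoulliSubset_mul (u w : ι → ℝ≥0∞) :
    ∑ S, bernoulliSubset ι r hr S * ((∏ i ∈ S, u i) * ∏ i ∈ Sᶜ, w i)
      = ∏ i, ((r : ℝ≥0∞) * u i + ((1 - r : ℝ≥0) : ℝ≥0∞) * w i) := by
  rw [Finset.prod_add, Finset.powerset_univ]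
  refine Finset.sum_congr rfl fun S _ => ?_
  rw [Finset.prod_mul_distrib, Finset.prod_mul_distrib, Finset.prod_const, Finset.prod_const,
    ← Finset.compl_eq_univ_sdiff, Finset.card_compl]
  have hS : bernoulliSubset ι r hr S = (r : ℝ≥0∞) ^ S.card
    * ((1 - r : ℝ≥0) : ℝ≥0∞) ^ (Fintype.card ι - S.card) := rfl
  rw [hS]
  ring

theorem sum_bernoulliSubset : ∑ S, bernoulliSubset ι r hr S = 1 := by
  have := sum_bernoulliSubset_mul hr (fun _ : ι => 1) (fun _ => 1)
  simp only [Finset.prod_const_one, mul_one] at this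
  rw [this, ← ENNReal.coe_add, add_tsub_cancel_of_le hr]
  simp

/-- Sets of entries rarely survive the subsampling. -/
theorem toOuterMeasure_superset_le (α : Finset ι) :
    (bernoulliSubset ι r hr).toOuterMeasure {S | α ⊆ S} ≤ (r : ℝ≥0∞) ^ α.card := by
  rw [PMF.toOuterMeasure_apply, tsum_fintype]
  have h := sum_bernoulliSubset_mul hr (fun _ : ι => 1) (fun i => if i ∈ α then 0 else 1)
  have h1 : ∏ i, ((r : ℝ≥0∞) * 1 + ((1 - r : ℝ≥0) : ℝ≥0∞) * (if i ∈ α then 0 else 1))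
      = (r : ℝ≥0∞) ^ α.card := by
    have h2 : ∀ i, (r : ℝ≥0∞) * 1 + ((1 - r : ℝ≥0) : ℝ≥0∞) * (if i ∈ α then 0 else 1)
        = if i ∈ α then (r : ℝ≥0∞) else 1 := by
      intro i
      split_ifs
      · simp
      · rw [mul_one, mul_one, ← ENNReal.coe_add, add_tsub_cancel_of_le hr, ENNReal.coe_one]
    simp_rw [h2]
    rw [Finset.prod_ite_mem, Finset.univ_inter, Finset.prod_const]
  rw [← h1, ← h]
  refine Finset.sum_le_sum fun S _ => ?_
  by_cases hS : α ⊆ S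
  · rw [Set.indicator_of_mem (by exact hS)]
    have : ∏ i ∈ Sᶜ, (if i ∈ α then (0 : ℝ≥0∞) else 1) = 1 :=
      Finset.prod_eq_one fun i hi => if_neg fun hiα => (Finset.mem_compl.1 hi) (hS hiα)
    rw [this]
    simp
  · rw [Set.indicator_of_notMem (by exact hS)]
    exact zero_le

/-- The subsample is rarely small. -/
theorem sum_bernoulliSubset_small_le :
    ∑ S, (if (S.card : ℝ) < 9 / 10 * (r * Fintype.card ι) then bernoulliSubset ι r hr S else 0)
      ≤ ENNReal.ofReal (Real.exp (-(r * Fintype.card ι / 200))) := by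
  set M : ℝ := (Fintype.card ι : ℝ) with hM
  -- Chernoff for the lower tail: the moment gives `exp (-19/200 r M)`, the threshold costs `exp
  -- (9/100 r M)`, and `19/200 - 18/200 = 1/200`.
  set v : ℝ := Real.exp (-(1 / 10)) with hv
  have hv0 : 0 < v := Real.exp_pos _
  have h := sum_bernoulliSubset_mul hr (fun _ : ι => ENNReal.ofReal v) (fun _ => 1)
  have hvb : v ≤ 1 - 19 / 200 := by
    have h3 : v * Real.exp (1 / 10) = 1 := by rw [hv, ← Real.exp_add]; norm_num
    have h4 : 1 + 1 / 10 + (1 / 10) ^ 2 / 2 ≤ Real.exp (1 / 10 : ℝ) :=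
      Real.quadratic_le_exp_of_nonneg (by norm_num)
    nlinarith
  have hr1 : (r : ℝ) ≤ 1 := by exact_mod_cast hr
  have hprod : ∏ _i : ι, ((r : ℝ≥0∞) * ENNReal.ofReal v + ((1 - r : ℝ≥0) : ℝ≥0∞) * 1)
      ≤ ENNReal.ofReal (Real.exp (-(19 / 200 * (r * M)))) := by
    have e : (r : ℝ≥0∞) * ENNReal.ofReal v + ((1 - r : ℝ≥0) : ℝ≥0∞) * 1
        = ENNReal.ofReal (r * v + (1 - r)) := by
      rw [ENNReal.ofReal_add (by positivity) (by linarith), ENNReal.ofReal_mul (NNReal.coe_nonneg r), mul_one]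
      rw [← NNReal.coe_one, ← NNReal.coe_sub hr, ENNReal.ofReal_coe_nnreal,
        ENNReal.ofReal_coe_nnreal]
    rw [Finset.prod_const, e, ← ENNReal.ofReal_pow (by nlinarith [r.2, mul_nonneg r.2 hv0.le])]
    refine ENNReal.ofReal_le_ofReal ?_
    rw [Finset.card_univ]
    have h0 : 0 ≤ r * v + (1 - r) := by nlinarith [mul_nonneg r.2 hv0.le]
    calc (r * v + (1 - r)) ^ Fintype.card ι
        ≤ Real.exp (-(19 / 200 * r)) ^ Fintype.card ι := by
          refine pow_le_pow_left₀ h0 ?_ _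
          have := Real.add_one_le_exp (-(19 / 200 * (r : ℝ)))
          nlinarith [r.2, mul_nonneg r.2 (sub_nonneg.2 hvb)]
      _ = _ := by rw [← Real.exp_nat_mul]; congr 1; rw [← hM]; ring
  have hpt : ∀ S : Finset ι,
      (if (S.card : ℝ) < 9 / 10 * (r * M) then bernoulliSubset ι r hr S else 0)
      ≤ ENNReal.ofReal (Real.exp (9 / 100 * (r * M))) * (bernoulliSubset ι r hr S
        * ((∏ i ∈ S, ENNReal.ofReal v) * ∏ i ∈ Sᶜ, 1)) := by
    intro S
    split_ifs with hS
    · rw [Finset.prod_const_one, mul_one, Finset.prod_const, ← ENNReal.ofReal_pow hv0.le,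
        mul_left_comm, ← ENNReal.ofReal_mul (Real.exp_pos _).le, hv, ← Real.exp_nat_mul,
        ← Real.exp_add]
      refine le_mul_of_one_le_right zero_le ?_
      rw [← ENNReal.ofReal_one]
      refine ENNReal.ofReal_le_ofReal (Real.one_le_exp ?_)
      linarith
    · exact zero_le
  refine (Finset.sum_le_sum fun S _ => hpt S).trans ?_
  rw [← Finset.mul_sum, h]
  refine (mul_le_mul_right hprod _).trans ?_
  rw [← ENNReal.ofReal_mul (Real.exp_pos _).le, ← Real.exp_add]
  refine ENNReal.ofReal_le_ofReal (Real.exp_le_exp.2 (le_of_eq ?_))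
  ring

end Bernoulli

/-! ### Robust inference by maximisation over sign vectors. -/

section Inference

/-- Insert the candidates one at a time, comparing each with the current maximiser on a measurable
set. -/
theorem exists_measurable_argmax {κ Y : Type} [Finite κ] [Nonempty κ] [MeasurableSpace Y]
    [MeasurableSpace κ] [DiscreteMeasurableSpace κ] {f : κ → Y → ℝ} (hf : ∀ s, Measurable (f s)) :
    ∃ g : Y → κ, Measurable g ∧ ∀ y s, f s y ≤ f (g y) y := by
  classical
  have := Fintype.ofFinite κ
  have hf' : Measurable fun p : κ × Y => f p.1 p.2 := measurable_from_prod_countable_right hf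
  have key : ∀ F : Finset κ, ∃ g : Y → κ, Measurable g ∧ ∀ y, ∀ s ∈ F, f s y ≤ f (g y) y := by
    intro F
    induction F using Finset.induction_on with
    | empty => exact ⟨fun _ => Classical.arbitrary κ, measurable_const, by simp⟩
    | insert a F ha ih =>
      obtain ⟨g, hg, hgF⟩ := ih
      have hm : Measurable fun y => f (g y) y := hf'.comp (hg.prodMk measurable_id)
      refine ⟨fun y => if f (g y) y ≤ f a y then a else g y,
        Measurable.ite (measurableSet_le hm (hf a)) measurable_const hg, fun y s hs => ?_⟩
      simp only
      rcases Finset.mem_insert.1 hs with rfl | hs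
      · split_ifs with h
        · exact le_rfl
        · exact (not_le.1 h).le
      · split_ifs with h
        · exact (hgF y s hs).trans h
        · exact hgF y s hs
  obtain ⟨g, hg, h⟩ := key Finset.univ
  exact ⟨g, hg, fun y s => h y s (Finset.mem_univ s)⟩

theorem lintegral_exp_linear {ι : Type} [Fintype ι] (w : ι → ℝ) :
    ∫⁻ G, ENNReal.ofReal (Real.exp (∑ a, w a * G a)) ∂(stdG ι)
      = ENNReal.ofReal (Real.exp ((∑ a, w a ^ 2) / 2)) := by
  rw [← ofReal_integral_eq_lintegral_ofReal (integrable_exp_linear w)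
    (Filter.Eventually.of_forall fun G => (Real.exp_pos _).le), integral_exp_linear]

variable {n k : ℕ} {lam obj θ : ℝ}

/-- Maximising over sign vectors succeeds with high probability, if the subsample is not too
small. -/
theorem prob_not_feasible_le (hn : 0 < n) (S : Finset (Idx n k))
    {g : (S → ℝ) → (Fin n → Bool)} (hg : Measurable g)
    (hmax : ∀ (y : S → ℝ) (s : Fin n → Bool), ∑ a : S, y a * tensorPow k (signVec s) a
      ≤ ∑ a : S, y a * tensorPow k (signVec (g y)) a) (hθ : 0 ≤ θ) :
    ((planted n k lam).prod (unif n k))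
      {p | ¬ Feasible obj (S.piecewise p.1 p.2) (signVec (g fun a => p.1 a))}
      ≤ ENNReal.ofReal (Real.exp (θ ^ 2 - θ * (lam * (S.card / (n : ℝ) ^ k) - obj))) := by
  classical
  set σ : Tensor n k → (Fin n → Bool) := fun T => g fun a => T a with hσ
  have hσm : Measurable σ := hg.comp (by fun_prop)
  have hvm : ∀ a, Measurable fun T => tensorPow k (signVec (σ T)) a := fun a =>
    (measurable_of_countable fun s => tensorPow k (signVec s) a).comp hσm
  set W : Tensor n k × Tensor n k → ℝ := fun p =>
    ∑ a ∈ S, p.1 a * tensorPow k (signVec (σ p.1)) a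
      + ∑ a ∈ Sᶜ, p.2 a * tensorPow k (signVec (σ p.1)) a with hW
  have hWm : Measurable W := by
    refine Measurable.add (Finset.measurable_sum _ fun a _ => ?_)
      (Finset.measurable_sum _ fun a _ => ?_)
    · exact ((measurable_pi_apply a).comp measurable_fst).mul ((hvm a).comp measurable_fst)
    · exact ((measurable_pi_apply a).comp measurable_snd).mul ((hvm a).comp measurable_fst)
  have hWeq : ∀ p : Tensor n k × Tensor n k,
      ∑ a, S.piecewise p.1 p.2 a * tensorPow k (signVec (σ p.1)) a = W p := by
    intro p
    rw [← Finset.sum_add_sum_compl S]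
    congr 1
    · exact Finset.sum_congr rfl fun a ha => by rw [Finset.piecewise_eq_of_mem _ _ _ ha]
    · exact Finset.sum_congr rfl fun a ha => by
        rw [Finset.piecewise_eq_of_notMem _ _ _ (Finset.mem_compl.1 ha)]
  set A : Tensor n k → ℝ := fun T => ∑ a ∈ S, T a * tensorPow k (signVec (σ T)) a with hA
  have hAmax : ∀ T s, ∑ a ∈ S, T a * tensorPow k (signVec s) a ≤ A T := by
    intro T s
    have h := hmax (fun a => T a) s
    rw [Finset.sum_coe_sort S fun a => T a * tensorPow k (signVec s) a,
      Finset.sum_coe_sort S fun a => T a * tensorPow k (signVec (g fun a : S => T a)) a] at h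
    exact h
  have hexpm : Measurable fun p => ENNReal.ofReal (Real.exp (-θ * (W p - obj))) := by fun_prop
  -- Sign vectors lie on the sphere, so only the objective can fail, and its failure is bounded by
  -- an exponential moment.
  have step1 : ((planted n k lam).prod (unif n k))
      {p | ¬ Feasible obj (S.piecewise p.1 p.2) (signVec (g fun a => p.1 a))}
      ≤ ∫⁻ p, ENNReal.ofReal (Real.exp (-θ * (W p - obj)))
        ∂((planted n k lam).prod (unif n k)) := by
    refine meas_le_lintegral₀ hexpm.aemeasurable fun p hp => ?_
    have h1 : W p < obj := by
      by_contra hcon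
      push Not at hcon
      refine hp ⟨?_, ?_⟩
      · rw [eval_objPoly]
        have := hWeq p
        simp only [hσ] at this
        rw [this]; linarith
      · rw [eval_spherePoly, sum_signVec_sq hn, sub_self]
    rw [← ENNReal.ofReal_one]
    refine ENNReal.ofReal_le_ofReal (Real.one_le_exp ?_)
    nlinarith
  -- The estimate depends on `T` alone, so for fixed `T` the fresh entries add a centred Gaussian of
  -- variance at most one.
  have step2 : ∀ T, ∫⁻ T', ENNReal.ofReal (Real.exp (-θ * (W (T, T') - obj))) ∂(unif n k)
      ≤ ENNReal.ofReal (Real.exp (-θ * (A T - obj) + θ ^ 2 / 2)) := by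
    intro T
    set w : Tensor n k := fun a => if a ∈ Sᶜ then -θ * tensorPow k (signVec (σ T)) a else 0 with hw
    have h1 : ∀ T', ENNReal.ofReal (Real.exp (-θ * (W (T, T') - obj)))
        = ENNReal.ofReal (Real.exp (-θ * (A T - obj)))
          * ENNReal.ofReal (Real.exp (∑ a, w a * T' a)) := by
      intro T'
      rw [← ENNReal.ofReal_mul (Real.exp_pos _).le, ← Real.exp_add]
      congr 2
      simp only [hw, ite_mul, zero_mul, Finset.sum_ite_mem, Finset.univ_inter]
      simp only [hW, hA, mul_add, mul_sub, Finset.mul_sum]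
      have : ∑ a ∈ Sᶜ, -θ * (T' a * tensorPow k (signVec (σ T)) a)
          = ∑ a ∈ Sᶜ, -θ * tensorPow k (signVec (σ T)) a * T' a :=
        Finset.sum_congr rfl fun a _ => by ring
      rw [this]; ring
    simp_rw [h1]
    rw [lintegral_const_mul _ (by fun_prop), unif_eq, lintegral_exp_linear,
      ← ENNReal.ofReal_mul (Real.exp_pos _).le, ← Real.exp_add]
    refine ENNReal.ofReal_le_ofReal (Real.exp_le_exp.2 ?_)
    have h2 : ∑ a, w a ^ 2 ≤ θ ^ 2 := by
      calc ∑ a, w a ^ 2 ≤ ∑ a, θ ^ 2 * tensorPow k (signVec (σ T)) a ^ 2 := by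
            refine Finset.sum_le_sum fun a _ => ?_
            simp only [hw]
            split_ifs
            · rw [mul_pow, neg_sq]
            · rw [zero_pow two_ne_zero]; positivity
        _ = θ ^ 2 := by rw [← Finset.mul_sum, sum_tensorPow_sq (sum_signVec_sq hn _), mul_one]
    linarith
  -- The maximum is bounded below by the value at the planted signs, which are independent of the
  -- noise; this avoids a union bound over sign vectors.
  have step3 : ∀ s, ∫⁻ G, ENNReal.ofReal (Real.exp (-θ * (A (plant lam s G) - obj) + θ ^ 2 / 2))
      ∂(unif n k) ≤ ENNReal.ofReal
        (Real.exp (θ ^ 2 - θ * (lam * (S.card / (n : ℝ) ^ k) - obj))) := by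
    intro s
    set w : Tensor n k := fun a => if a ∈ S then -θ * tensorPow k (signVec s) a else 0 with hw
    set c : ℝ := -θ * (lam * (S.card / (n : ℝ) ^ k) - obj) + θ ^ 2 / 2 with hc
    have h1 : ∀ G, ENNReal.ofReal (Real.exp (-θ * (A (plant lam s G) - obj) + θ ^ 2 / 2))
        ≤ ENNReal.ofReal (Real.exp c) * ENNReal.ofReal (Real.exp (∑ a, w a * G a)) := by
      intro G
      rw [← ENNReal.ofReal_mul (Real.exp_pos _).le, ← Real.exp_add]
      refine ENNReal.ofReal_le_ofReal (Real.exp_le_exp.2 ?_)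
      have h2 := hAmax (plant lam s G) s
      have h3 : ∑ a ∈ S, plant lam s G a * tensorPow k (signVec s) a
          = lam * (S.card / (n : ℝ) ^ k) + ∑ a ∈ S, tensorPow k (signVec s) a * G a := by
        have h4 : ∀ a, plant lam s G a * tensorPow k (signVec s) a
            = lam * ((n : ℝ) ^ k)⁻¹ + tensorPow k (signVec s) a * G a := by
          intro a
          rw [← tensorPow_signVec_sq s a]
          simp only [plant, Pi.add_apply, Pi.smul_apply, smul_eq_mul]; ring
        simp_rw [h4, Finset.sum_add_distrib, Finset.sum_const, nsmul_eq_mul]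
        ring
      have h5 : ∑ a, w a * G a = -θ * ∑ a ∈ S, tensorPow k (signVec s) a * G a := by
        simp only [hw, ite_mul, zero_mul, Finset.sum_ite_mem, Finset.univ_inter, Finset.mul_sum,
          mul_assoc]
      rw [h3] at h2
      rw [h5, hc]
      nlinarith [mul_le_mul_of_nonneg_left h2 hθ]
    refine (lintegral_mono h1).trans ?_
    rw [lintegral_const_mul _ (by fun_prop), unif_eq, lintegral_exp_linear,
      ← ENNReal.ofReal_mul (Real.exp_pos _).le, ← Real.exp_add]
    refine ENNReal.ofReal_le_ofReal (Real.exp_le_exp.2 ?_)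
    have h2 : ∑ a, w a ^ 2 ≤ θ ^ 2 := by
      calc ∑ a, w a ^ 2 ≤ ∑ a, θ ^ 2 * tensorPow k (signVec s) a ^ 2 := by
            refine Finset.sum_le_sum fun a _ => ?_
            simp only [hw]
            split_ifs
            · rw [mul_pow, neg_sq]
            · rw [zero_pow two_ne_zero]; positivity
        _ = θ ^ 2 := by rw [← Finset.mul_sum, sum_tensorPow_sq (sum_signVec_sq hn _), mul_one]
    rw [hc]; linarith
  have hAm : Measurable A := Finset.measurable_sum _ fun a _ => (measurable_pi_apply a).mul (hvm a)
  have hAexp : Measurable fun T => ENNReal.ofReal (Real.exp (-θ * (A T - obj) + θ ^ 2 / 2)) := by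
    fun_prop
  have hcomp : Measurable fun p : (Fin n → Bool) × Tensor n k => ENNReal.ofReal
      (Real.exp (-θ * (A (lam • tensorPow k (signVec p.1) + p.2) - obj) + θ ^ 2 / 2)) :=
    hAexp.comp (measurable_plant_uncurry lam)
  refine step1.trans ?_
  rw [lintegral_prod _ hexpm.aemeasurable]
  refine (lintegral_mono step2).trans ?_
  rw [planted, lintegral_map hAexp (measurable_plant_uncurry lam),
    lintegral_prod _ hcomp.aemeasurable]
  refine (lintegral_mono fun s => step3 s).trans ?_
  rw [lintegral_const, measure_univ, mul_one]

end Inference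

/-! ### Numerical parameters for subsampling. -/

section Parameters

variable {n d k D : ℕ} {lam ε obj : ℝ}

/-- Failure means either that the subsample has fewer than `9/10` of its expected size or that the
Gaussian terms use up the gap; each has probability at most `exp (-801 L)`. -/
theorem robustlyInferable {r : ℝ≥0} (hr : r ≤ 1) (hn : 2 ≤ n) (hd : 1 ≤ d)
    (hrM : 1000000 * (d * Real.log n) ≤ r * (n : ℝ) ^ k) (hlam : 0 ≤ lam)
    (hgap : 100000 * √(d * Real.log n) ≤ lam * (9 / 10 * r) - obj) :
    RobustlyInferable n k lam obj (bernoulliSubset (Idx n k) r hr)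
      (ENNReal.ofReal (1 / (n : ℝ) ^ (8 * (100 * d)))) := by
  have hn0 : 0 < n := by omega
  set L := d * Real.log n with hL
  have hL0 := log_two_mul_le hn hd
  have hLs : √L * √L = L := Real.mul_self_sqrt (by linarith)
  have hex : ∀ S : Finset (Idx n k), ∃ g : (S → ℝ) → (Fin n → Bool), Measurable g ∧
      ∀ (y : S → ℝ) (s : Fin n → Bool), ∑ a : S, y a * tensorPow k (signVec s) a
        ≤ ∑ a : S, y a * tensorPow k (signVec (g y)) a := fun S =>
    exists_measurable_argmax fun s => by fun_prop
  choose g hg hmax using hex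
  refine ⟨fun S y => signVec (g S y), fun S => (measurable_of_countable signVec).comp (hg S), ?_⟩
  have hP : ∀ S : Finset (Idx n k), bernoulliSubset (Idx n k) r hr S
      * ((planted n k lam).prod (unif n k))
        {p | ¬ Feasible obj (S.piecewise p.1 p.2) (signVec (g S fun a => p.1 a))}
      ≤ (if (S.card : ℝ) < 9 / 10 * (r * Fintype.card (Idx n k))
          then bernoulliSubset (Idx n k) r hr S else 0)
        + bernoulliSubset (Idx n k) r hr S * ENNReal.ofReal (Real.exp (-(801 * L))) := by
    intro S
    split_ifs with hS
    · exact (mul_le_of_le_one_right zero_le prob_le_one).trans le_self_add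
    · rw [zero_add]
      refine mul_le_mul_right ((prob_not_feasible_le (θ := 50 * √L) hn0 S (hg S) (hmax S)
        (by positivity)).trans (ENNReal.ofReal_le_ofReal (Real.exp_le_exp.2 ?_))) _
      have hM : (Fintype.card (Idx n k) : ℝ) = (n : ℝ) ^ k := by simp
      rw [hM] at hS
      push Not at hS
      have hM0 : (0 : ℝ) < (n : ℝ) ^ k := by
        have : (0 : ℝ) < n := by exact_mod_cast hn0
        positivity
      have h1 : 9 / 10 * (r : ℝ) ≤ S.card / (n : ℝ) ^ k := by
        rw [le_div_iff₀ hM0]; linarith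
      have h2 : 100000 * √L ≤ lam * (S.card / (n : ℝ) ^ k) - obj :=
        hgap.trans (sub_le_sub_right (mul_le_mul_of_nonneg_left h1 hlam) _)
      have h3 := mul_le_mul_of_nonneg_left h2 (show (0 : ℝ) ≤ 50 * √L by positivity)
      nlinarith
  refine (Finset.sum_le_sum fun S _ => hP S).trans ?_
  rw [Finset.sum_add_distrib, ← Finset.sum_mul, sum_bernoulliSubset, one_mul]
  have hsmall : ∑ S, (if (S.card : ℝ) < 9 / 10 * (r * Fintype.card (Idx n k))
      then bernoulliSubset (Idx n k) r hr S else 0) ≤ ENNReal.ofReal (Real.exp (-(801 * L))) := by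
    refine (sum_bernoulliSubset_small_le hr).trans
      (ENNReal.ofReal_le_ofReal (Real.exp_le_exp.2 ?_))
    have hM : (Fintype.card (Idx n k) : ℝ) = (n : ℝ) ^ k := by simp
    rw [hM]
    linarith
  refine (add_le_add_left hsmall _).trans ?_
  rw [← ENNReal.ofReal_add (Real.exp_pos _).le (Real.exp_pos _).le]
  refine ENNReal.ofReal_le_ofReal ?_
  have h1 := exp_mul_log hn d 800
  have h2 := exp_mul_log hn d 1
  rw [← hL] at h1 h2
  rw [show 8 * (100 * d) = d * 800 by ring, pow_mul, ← h1, one_div, ← Real.exp_neg]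
  have h3 : Real.exp L = (n : ℝ) ^ d := by simpa using h2
  have h4 := two_le_cast_pow hn hd
  -- The spare `exp L = n ^ d ≥ 2` absorbs the union of the two failures.
  have h5 : Real.exp (-(((800 : ℕ) : ℝ) * L)) = Real.exp (-(801 * L)) * Real.exp L := by
    rw [← Real.exp_add]; congr 1; push_cast; ring
  rw [h5, h3]
  nlinarith [Real.exp_pos (-(801 * L))]

/-- The origin of `c = 2000`: with rate `n ^ (-ε / 2)` the exponent is `ε (D - 3 d) / 2 ≥ 1000 d`.
-/
theorem rpow_half_pow_le (hn : 2 ≤ n) (hD : 3 * d < D)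
    (hε : 2000 * d / ((D : ℝ) - 3 * d) ≤ ε) :
    ((n : ℝ) ^ (-ε / 2)) ^ (D - 3 * d) ≤ ((n : ℝ) ^ d)⁻¹ ^ 1000 := by
  have hn0 : (0 : ℝ) < n := by exact_mod_cast (by omega : 0 < n)
  have hn1 : (1 : ℝ) ≤ n := by exact_mod_cast (by omega : 1 ≤ n)
  have hDc : ((D - 3 * d : ℕ) : ℝ) = (D : ℝ) - 3 * d := by
    rw [Nat.cast_sub hD.le]; push_cast; ring
  have hDpos : (0 : ℝ) < (D : ℝ) - 3 * d := by
    have : (3 * d : ℝ) < D := by exact_mod_cast hD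
    linarith
  rw [div_le_iff₀ hDpos] at hε
  rw [inv_pow, ← pow_mul, ← Real.rpow_natCast (n : ℝ) (d * 1000), ← Real.rpow_neg hn0.le,
    ← Real.rpow_natCast, ← Real.rpow_mul hn0.le, hDc]
  refine Real.rpow_le_rpow_of_exponent_le hn1 ?_
  push_cast
  linarith

end Parameters

end TensorPCA

end

/-! ### Assembly of the three conclusions. -/

theorem mainTheorem10 :
    ∃ (c₁ : ℕ) (c K : ℝ), 1 < c₁ ∧ 0 < c ∧ 0 < K ∧
      ∀ (n k d D : ℕ) (lam ε obj : ℝ),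
        2 ≤ n → 1 ≤ k → k ≤ 2 * d → 3 * d < D →
        c * d / ((D : ℝ) - 3 * d) ≤ ε →
        K * Real.sqrt (d * Real.log n) ≤ lam * (n : ℝ) ^ (-ε) →
        K * (d * Real.log n) ≤ (n : ℝ) ^ ((k : ℝ) - ε) →
        obj ≤ lam * (n : ℝ) ^ (-ε) → obj ≤ lam / 2 →
        ∃ (r : NNReal) (hr : r ≤ 1), (n : ℝ) ^ (-ε) ≤ r ∧
          -- robust inference, for independent subsampling of the entries at rate `r`
          TensorPCA.RobustlyInferable n k lam obj
            (TensorPCA.bernoulliSubset (TensorPCA.Idx n k) r hr)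
            (ENNReal.ofReal (1 / (n : ℝ) ^ (8 * (c₁ * d)))) ∧
          -- large sets of entries rarely survive the subsampling
          (∀ α : Finset (TensorPCA.Idx n k), D - 3 * d ≤ α.card →
            (TensorPCA.bernoulliSubset (TensorPCA.Idx n k) r hr).toOuterMeasure {S | α ⊆ S} ≤
              ENNReal.ofReal (1 / (n : ℝ) ^ (8 * (c₁ * d)))) ∧
          -- if sum-of-squares refutes random instances, it does so with bounded numbers,
          -- and then a low-degree spectral distinguisher exists
          (TensorPCA.unif n k {T | ¬ TensorPCA.Refutable d obj T} ≤
              ENNReal.ofReal (1 / (2 * (n : ℝ) ^ (8 * (c₁ * d)))) →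
            TensorPCA.unif n k
                {T | ¬ TensorPCA.RefutableWithin d obj ((n : ℝ) ^ (c₁ * d)) T} ≤
              ENNReal.ofReal (1 / (n : ℝ) ^ (8 * (c₁ * d))) ∧
            ∃ Q : Matrix (TensorPCA.Tup n d) (TensorPCA.Tup n d)
                (MvPolynomial (TensorPCA.Idx n k) ℝ),
              TensorPCA.HasInstDegreeLE Q (2 * D) ∧
              TensorPCA.Distinguishes lam ((n : ℝ) ^ (((c₁ * d : ℕ) : ℝ) / 2)) Q) := by
  refine ⟨100, 2000, 1000000, by norm_num, by norm_num, by norm_num, ?_⟩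
  intro n k d D lam ε obj hn hk1 hk hD hε h1 h2 ho1 ho2
  have hd : 1 ≤ d := by omega
  have hn0 : (0 : ℝ) < n := by exact_mod_cast (by omega : 0 < n)
  have hn1 : (1 : ℝ) ≤ n := by exact_mod_cast (by omega : 1 ≤ n)
  have hL := TensorPCA.log_two_mul_le hn hd
  have hDpos : (0 : ℝ) < (D : ℝ) - 3 * d := by
    have : (3 * d : ℝ) < D := by exact_mod_cast hD
    linarith
  have hε0 : 0 ≤ ε := le_trans (by positivity) hε
  -- The rate is the square root of the lower bound `n ^ (-ε)`. Keeping a fraction `u` of the signal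
  -- leaves about `lam u`, which exceeds `obj ≤ lam u²` with room for the fluctuations.
  set u : ℝ := (n : ℝ) ^ (-ε / 2) with hu
  have hu0 : 0 < u := Real.rpow_pos_of_pos hn0 _
  have hu1 : u ≤ 1 := Real.rpow_le_one_of_one_le_of_nonpos hn1 (by linarith)
  have husq : (n : ℝ) ^ (-ε) = u ^ 2 := by
    rw [hu, pow_two, ← Real.rpow_add hn0]; congr 1; ring
  rw [husq] at h1 ho1
  have hsL : 0 < √(d * Real.log n) := Real.sqrt_pos.2 (by linarith)
  have hlamu : 0 < lam * u ^ 2 := lt_of_lt_of_le (by positivity) h1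
  have hlam : 0 < lam := by
    by_contra hcon
    push Not at hcon
    exact absurd hlamu (not_lt.2 (mul_nonpos_of_nonpos_of_nonneg hcon (sq_nonneg u)))
  -- For `u ≤ 4 / 5` the bound `obj ≤ lam u²` suffices. For `u` near `1` it leaves no gap, and `obj
  -- ≤ lam / 2` is used instead.
  have hgap : 1 / 10 * (lam * u ^ 2) ≤ lam * (9 / 10 * u) - obj := by
    rcases le_total u (4 / 5) with h | h
    · have : 0 ≤ lam * (u * (9 / 10 - 11 / 10 * u)) :=
        mul_nonneg hlam.le (mul_nonneg hu0.le (by linarith))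
      nlinarith
    · have : 0 ≤ lam * (9 / 10 * u - 1 / 2 - 1 / 10 * u ^ 2) :=
        mul_nonneg hlam.le (by nlinarith)
      nlinarith
  have hpow := TensorPCA.rpow_half_pow_le hn hD hε
  rw [← hu] at hpow
  have hr1 : u.toNNReal ≤ 1 := by rwa [Real.toNNReal_le_one]
  have hrc : ((u.toNNReal : NNReal) : ℝ) = u := Real.coe_toNNReal u hu0.le
  refine ⟨u.toNNReal, hr1, ?_, ?_, ?_, ?_⟩
  · rw [husq, hrc]; nlinarith
  · refine TensorPCA.robustlyInferable hr1 hn hd ?_ hlam.le ?_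
    · rw [hrc]
      refine h2.trans ?_
      rw [sub_eq_add_neg, Real.rpow_add hn0, Real.rpow_natCast, husq, mul_comm]
      exact mul_le_mul_of_nonneg_right (by nlinarith) (by positivity)
    · rw [hrc]; linarith
  · intro α hα
    refine (TensorPCA.toOuterMeasure_superset_le hr1 α).trans ?_
    have h3 : u ^ α.card ≤ 1 / (n : ℝ) ^ (8 * (100 * d)) := by
      refine (pow_le_pow_of_le_one hu0.le hu1 hα).trans (hpow.trans ?_)
      rw [inv_pow, ← pow_mul, one_div]
      exact inv_anti₀ (by positivity) (pow_le_pow_right₀ hn1 (by omega))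
    rw [show ((u.toNNReal : NNReal) : ENNReal) = ENNReal.ofReal u from rfl,
      ← ENNReal.ofReal_pow hu0.le]
    exact ENNReal.ofReal_le_ofReal h3
  · intro hRef
    obtain ⟨hobj, hW⟩ := TensorPCA.wellConditioned hn hd hk hRef
    refine ⟨hW, ?_⟩
    have hexp : (n : ℝ) ^ (((100 * d : ℕ) : ℝ) / 2) = (n : ℝ) ^ (50 * d) := by
      rw [← Real.rpow_natCast]; congr 1; push_cast; ring
    rw [hexp]
    -- The subsampling rate is reused as the noise parameter, so `hgap` also provides the margin `2
    -- κ` below `u lam - obj`.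
    refine TensorPCA.exists_distinguisher (ρ := u) hn hd hk (by omega) hu0.le hu1
      ((pow_le_pow_of_le_one hu0.le hu1 (by omega)).trans hpow) (by linarith) hlam.le ?_ hW
    have h4 : √(600 * (d * Real.log n)) ≤ 25 * √(d * Real.log n) := by
      rw [Real.sqrt_mul (by norm_num)]
      refine mul_le_mul_of_nonneg_right ?_ hsL.le
      rw [Real.sqrt_le_left (by norm_num)]
      norm_num
    nlinarith [mul_pos hu0 hlam]
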